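/- **Setting.** Let $M$ be a smooth manifold (Hausdorff, $\sigma$-compact, of dimension $n$). Let $\mathcal C=\bigoplus_{k,l}\mathcal C^{k,l}$ be the bigraded commutative algebra of polynomial functions on the supermanifold $T^*\Pi TM$, generated locally by $x^i$ (bidegree $(0,0)$), $\xi^i=dx^i$ (bidegree $(0,1)$), and their conjugate momenta $p_i$ (bidegree $(1,1)$) and $\theta_i$ (bidegree $(1,0)$), with its canonical Poisson bracket $\{\cdot,\cdot\}$ of bidegree $(-1,-1)$. Equivalently, $\mathcal C^{k,l}$ consists of the principal symbols of the differential operators of order $k$ and form degree $l-k$ on $\Omega(M)$, and the bracket is induced by the graded commutator. The total weight is $k+l$. Differential forms are elements of $\mathcal C^{0,\bullet}$, multivector fields of $\mathcal C^{\bullet,0}$ (a vector field $X$ is the symbol of $\iota_X$), and $h_d\in\mathcal C^{1,2}$ is the symbol of the de Rham differential. For $a\in\mathcal C$ put $X_a=\{a,\cdot\}$ and $F_a^*=\exp X_a$. Let $L^*$ be the Lagrangian submanifold $\xi=p=0$, whose ideal is $\bigoplus_{l\ge1}\mathcal C^{k,l}$. A *gauge transformation* is an automorphism of the Poisson algebra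 $\mathcal C$ which preserves the total weight and is the identity on $C^\infty(M)$. For a bivector field $\pi$ and a 2-form $\omega$ write $\tilde\pi(\alpha)(\beta)=\pi(\alpha,\beta)$ and $\tilde\omega(X)(Y)=\omega(X,Y)$; put $T(\pi,\omega)=1+\tilde\pi\tilde\omega$ and, where the inverses exist, define $\tau_\omega\pi$ and $\tau_\pi\omega$ by $$\widetilde{\tau_\omega\pi}=\tilde\pi(1+\tilde\omega\tilde\pi)^{-1},\qquad \widetilde{\tau_\pi\omega}=\tilde\omega(1+\tilde\pi\tilde\omega)^{-1}.$$ For an automorphism $g$ of $TM$ over the identity let $F_g^*$ denote its lift to $\mathcal C$: the gauge transformation which preserves bidegrees and maps each vector field $X$ to $gX$. For a 3-form $\phi$ and a bivector field $\pi$ put $\Theta_{\phi,\pi}=F_\pi^*(h_d+\phi)$, $\mu_\pi=h_d+\{\pi,\phi\}$ and $\gamma_\pi=\{\pi,h_d\}+\tfrac12\{\pi,\{\pi,\phi\}\}$. The bivector field $\pi$ is *$\phi$-Poisson* if $d\phi=0$ and $\tfrac12[\pi,\pi]=(\wedge^3\tilde\pi)\phi$, where $[\pi,\pi]=\{\{\pi,h_d\},\pi\}$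 and $((\wedge^3\tilde\pi)\phi)(\alpha,\beta,\gamma)=\phi(\tilde\pi\alpha,\tilde\pi\beta,\tilde\pi\gamma)$. A *quasi-Lie bialgebroid* structure on $(TM,T^*M)$ is a triple $(\mu,\gamma,\phi)\in\mathcal C^{1,2}\times\mathcal C^{2,1}\times\mathcal C^{0,3}$ with $\tfrac12\{\mu,\mu\}+\{\gamma,\phi\}=0$, $\{\mu,\gamma\}=0$, $\{\gamma,\gamma\}=0$ and $\{\mu,\phi\}=0$; two of them are *isomorphic* if a gauge transformation preserving (the ideal of) $L^*$ maps $\mu+\gamma+\phi$ to $\mu'+\gamma'+\phi'$. The *spectral sequence* of $(\phi,\pi)$ is that of the complex $(\mathcal C,\{\Theta_{\phi,\pi},\cdot\})$, graded by the total weight and filtered by $F^p=\bigoplus_{l\ge p}\mathcal C^{k,l}$. The *Poisson cohomology* of $(\phi,\pi)$ is the cohomology of the multivector fields $(\mathcal C^{\bullet,0},\{\gamma_\pi,\cdot\})$. **Theorem.** 1. Let $\phi$ be a 3-form, $\pi$ a bivector field and $\omega$ a 2-form on $M$ such that $T(-\pi,\omega)=1-\tilde\pi\tilde\omega$ is invertible.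 Then a bivector field $\tau_{-\omega}\pi$ and a unique 2-form $\tau_{-\pi}\omega$ as above exist. There is a lift $F^*_{T^{-1}(-\pi,\omega)}$ for which $$\Phi^*=F^*_{T^{-1}(-\pi,\omega)}\,F^*_{\tau_{-\pi}\omega}$$ is a gauge transformation which preserves $L^*$, and $$\Theta_{\phi-d\omega,\;\tau_{-\omega}\pi}=\Phi^*\,\Theta_{\phi,\pi}.$$ Moreover, if $\pi$ is $\phi$-Poisson, then $\tau_{-\omega}\pi$ is $(\phi-d\omega)$-Poisson. 2. Call twisted Poisson structures $(\phi,\pi)$ and $(\phi',\pi')$ on $M$ (that is, $\pi$ is $\phi$-Poisson and $\pi'$ is $\phi'$-Poisson) *gauge equivalent* if $\phi'=\phi-d\omega$ and $\pi'=\tau_{-\omega}\pi$ for some 2-form $\omega$ for which $T(-\pi,\omega)$ is invertible. If $(\phi,\pi)$ and $(\phi',\pi')$ are gauge equivalent, then $(\mu_\pi,\gamma_\pi,\phi)$ and $(\mu_{\pi'},\gamma_{\pi'},\phi')$ are isomorphic quasi-Lie bialgebroids. Their spectral sequences are isomorphic: all pages $E_r$, $r\ge0$, are linearly isomorphic, compatibly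 with the differentials $d_r$ and with the identifications $E_{r+1}=H(E_r)$. Their Poisson cohomology spaces are isomorphic as well, in every degree. -/

import Mathlib

/-!
Twisted Poisson structures, quasi-Lie bialgebroids and gauge transformations.

Throughout, `A` is a commutative `ℝ`-algebra; the theorem is about `A = C^∞(M)` for a smooth
manifold `M`. Then derivations of `A` are the vector fields on `M`, and the differential forms
on `M` are the finite sums of `f dg₁ ∧ ⋯ ∧ dg_l`.

The graded Poisson algebra `C` of polynomial functions on the supermanifold `T^*ΠTM` is built as the
algebra of principal symbols of the differential operators on `Ω(M) = C^∞(ΠTM)`: the functions on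
a cotangent bundle which are homogeneous of degree `k` in the momenta are the principal symbols of
the differential operators of order `k` on the base, with the product induced by composition and
the canonical Poisson bracket induced by the graded commutator. In local coordinates `x^i` on `M`,
`ξ^i = dx^i` on `ΠTM`, momenta `p_i` (conjugate to `x^i`) and `θ_i` (conjugate to `ξ^i`), the
bidegree `(k, l)` counts momenta and `l = k + (form degree)`: `x` has bidegree `(0, 0)`, `ξ` has
`(0, 1)`, `θ` has `(1, 0)` and `p` has `(1, 1)`.
-/

namespace TwistedPoisson

section Forms

variable (A : Type*) [CommRing A] [Algebra ℝ A]

/-- Vector fields: derivations of the algebra of functions. -/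
abbrev VectorField : Type _ := Derivation ℝ A A

/-- Alternating `k`-linear forms on vector fields. -/
abbrev AltForm (k : ℕ) : Type _ := VectorField A [⋀^Fin k]→ₗ[A] A

/-- Families of alternating forms, one in each degree. -/
abbrev Forms : Type _ := ∀ k : ℕ, AltForm A k

variable {A}

/-- The differential `dg`, `dg(X) = X g`. -/
def differential (g : A) : Module.Dual A (VectorField A) where
  toFun X := X g
  map_add' _ _ := rfl
  map_smul' _ _ := rfl

/-- The operator `η ↦ α ∧ η`. -/
def wedgeLeft (α : Module.Dual A (VectorField A)) : Forms A →ₗ[A] Forms A where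
  toFun η
    | 0 => 0
    | k + 1 => AlternatingMap.alternatizeUncurryFin (α.smulRight (η k))
  map_add' η ζ := by
    funext k
    cases k with
    | zero => simp
    | succ k =>
      ext v
      simp [AlternatingMap.alternatizeUncurryFin_apply, Finset.sum_add_distrib]
  map_smul' f η := by
    funext k
    cases k with
    | zero => simp
    | succ k =>
      ext v
      simp only [AlternatingMap.alternatizeUncurryFin_apply, Pi.smul_apply, RingHom.id_apply,
        AlternatingMap.smul_apply, LinearMap.smulRight_apply, smul_eq_mul, Finset.mul_sum]
      exact Finset.sum_congr rfl fun i _ => by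
        rw [mul_smul_comm, mul_left_comm]

/-- The contraction `ι_X η = η(X, ⋯)`. -/
def contract (X : VectorField A) : Forms A →ₗ[A] Forms A where
  toFun η k := (η (k + 1)).curryLeft X
  map_add' _ _ := rfl
  map_smul' _ _ := rfl

theorem sum_update {B : Type*} [AddCommMonoid B] {ι : Type*} [Fintype ι] [DecidableEq ι]
    {M : Type*} (F : (ι → M) → B) (D : M → M) (v : ι → M) (i : ι) (x : M) :
    (∑ j, F (Function.update (Function.update v i x) j (D (Function.update v i x j)))) =
      F (Function.update v i (D x)) +
        ∑ j ∈ Finset.univ.erase i, F (Function.update (Function.update v j (D (v j))) i x) := by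
  rw [← Finset.add_sum_erase _ _ (Finset.mem_univ i)]
  congr 1
  · simp
  · refine Finset.sum_congr rfl fun j hj => ?_
    have hji : j ≠ i := Finset.ne_of_mem_erase hj
    rw [Function.update_of_ne hji, Function.update_comm hji.symm]

/-- The Lie derivative `(L_X η)(v₁, ⋯) = X(η(v₁, ⋯)) - ∑ i, η(⋯, [X, v_i], ⋯)`. -/
def lieAlt (X : VectorField A) {k : ℕ} (η : AltForm A k) : AltForm A k where
  toFun v := X (η v) - ∑ i, η (Function.update v i ⁅X, v i⁆)
  map_update_add' {inst} v i x y := by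
    have : inst = instDecidableEqFin k := Subsingleton.elim _ _
    subst this
    simp only [sum_update (fun v => η v) (fun Y => ⁅X, Y⁆), η.map_update_add, lie_add, map_add,
      Finset.sum_add_distrib]
    abel
  map_update_smul' {inst} v i f x := by
    have : inst = instDecidableEqFin k := Subsingleton.elim _ _
    subst this
    have h : ⁅X, f • x⁆ = f • ⁅X, x⁆ + (X f) • x := by
      ext a; simp [Derivation.commutator_apply]
    simp only [sum_update (fun v => η v) (fun Y => ⁅X, Y⁆), η.map_update_smul, h, η.map_update_add,
      smul_eq_mul, Derivation.leibniz, ← Finset.mul_sum]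
    ring
  map_eq_zero_of_eq' v i j hv hij := by
    rw [η.map_eq_zero_of_eq v hv hij, map_zero, zero_sub, neg_eq_zero,
      ← Finset.add_sum_erase _ _ (Finset.mem_univ i),
      ← Finset.add_sum_erase _ _ (Finset.mem_erase.2 ⟨hij.symm, Finset.mem_univ j⟩), ← add_assoc]
    have h1 : ∑ l ∈ (Finset.univ.erase i).erase j, η (Function.update v l ⁅X, v l⁆) = 0 := by
      refine Finset.sum_eq_zero fun l hl => η.map_eq_zero_of_eq _ ?_ hij
      rw [Finset.mem_erase, Finset.mem_erase] at hl
      rw [Function.update_of_ne hl.2.1.symm, Function.update_of_ne hl.1.symm, hv]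
    have h2 : Function.update v j ⁅X, v j⁆ = (Function.update v i ⁅X, v i⁆) ∘ Equiv.swap i j := by
      funext l
      by_cases hi : l = i
      · subst hi
        simp [Function.update_of_ne hij, Function.update_of_ne hij.symm, hv]
      · by_cases hj : l = j
        · subst hj; simp [hv]
        · simp [Equiv.swap_apply_of_ne_of_ne hi hj, Function.update_of_ne hi,
            Function.update_of_ne hj]
    rw [h1, h2, η.map_swap _ hij]
    simp

theorem lieAlt_smul_left (f : A) (X : VectorField A) {k : ℕ} (η : AltForm A (k + 1)) :
    lieAlt (f • X) η = f • lieAlt X η +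
      AlternatingMap.alternatizeUncurryFin ((differential f).smulRight (η.curryLeft X)) := by
  ext v
  have h : ∀ Y : VectorField A, ⁅f • X, Y⁆ = f • ⁅X, Y⁆ - (Y f) • X := fun Y => by
    ext a; simp [Derivation.commutator_apply]; ring
  have h2 : ∀ i, η (Function.update v i X) =
      (-1) ^ (i : ℕ) • η.curryLeft X (i.removeNth v) := fun i => by
    rw [AlternatingMap.curryLeft_apply_apply, ← AlternatingMap.map_insertNth,
      ← Fin.insertNth_self_removeNth i v]
    simp
  have h3 : ∀ i, η (Function.update v i ⁅f • X, v i⁆) = f * η (Function.update v i ⁅X, v i⁆) -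
      (-1) ^ (i : ℕ) • ((v i) f * η.curryLeft X (i.removeNth v)) := fun i => by
    rw [h, η.map_update_sub, η.map_update_smul, η.map_update_smul, h2]
    simp only [smul_eq_mul, mul_smul_comm]
  simp only [AlternatingMap.add_apply, AlternatingMap.smul_apply,
    AlternatingMap.alternatizeUncurryFin_apply, LinearMap.smulRight_apply, smul_eq_mul]
  change (f • X) (η v) - ∑ i, η (Function.update v i ⁅f • X, v i⁆) =
    f * (X (η v) - ∑ i, η (Function.update v i ⁅X, v i⁆)) + ∑ i : Fin (k + 1), (-1) ^ (i : ℕ) •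
      ((v i) f * η.curryLeft X (i.removeNth v))
  simp only [h3, Finset.sum_sub_distrib, Derivation.smul_apply, smul_eq_mul, ← Finset.mul_sum]
  ring

theorem lieAlt_add_left (X Y : VectorField A) {k : ℕ} (η : AltForm A k) :
    lieAlt (X + Y) η = lieAlt X η + lieAlt Y η := by
  ext v
  change (X + Y) (η v) - ∑ i, η (Function.update v i ⁅X + Y, v i⁆) =
    (X (η v) - ∑ i, η (Function.update v i ⁅X, v i⁆)) +
    (Y (η v) - ∑ i, η (Function.update v i ⁅Y, v i⁆))
  simp only [add_lie, η.map_update_add, Finset.sum_add_distrib, Derivation.add_apply]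
  abel

theorem lieAlt_add (X : VectorField A) {k : ℕ} (η ζ : AltForm A k) :
    lieAlt X (η + ζ) = lieAlt X η + lieAlt X ζ := by
  ext v
  change X (η v + ζ v) - ∑ i, (η (Function.update v i ⁅X, v i⁆) + ζ (Function.update v i ⁅X, v i⁆)) =
    (X (η v) - ∑ i, η (Function.update v i ⁅X, v i⁆)) +
    (X (ζ v) - ∑ i, ζ (Function.update v i ⁅X, v i⁆))
  simp only [Finset.sum_add_distrib, map_add]
  abel

theorem lieAlt_smul (f : A) (X : VectorField A) {k : ℕ} (η : AltForm A k) :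
    lieAlt X (f • η) = f • lieAlt X η + (X f) • η := by
  ext v
  change X (f * η v) - ∑ i, f * η (Function.update v i ⁅X, v i⁆) =
    f * (X (η v) - ∑ i, η (Function.update v i ⁅X, v i⁆)) + X f * η v
  rw [← Finset.mul_sum, Derivation.leibniz]
  simp only [smul_eq_mul]
  ring

theorem lieAlt_real_smul (c : ℝ) (X : VectorField A) {k : ℕ} (η : AltForm A k) :
    lieAlt X (c • η) = c • lieAlt X η := by
  ext v
  change X (c • η v) - ∑ i, c • η (Function.update v i ⁅X, v i⁆) =
    c • (X (η v) - ∑ i, η (Function.update v i ⁅X, v i⁆))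
  rw [← Finset.smul_sum, Derivation.map_smul_of_tower, smul_sub]

theorem curryLeft_lieAlt (X Y : VectorField A) {k : ℕ} (η : AltForm A (k + 1)) :
    (lieAlt X η).curryLeft Y = lieAlt X (η.curryLeft Y) - η.curryLeft ⁅X, Y⁆ := by
  ext v
  change X (η (Matrix.vecCons Y v)) - ∑ i, η (Function.update (Matrix.vecCons Y v) i
      ⁅X, Matrix.vecCons Y v i⁆) =
    (X (η (Matrix.vecCons Y v)) - ∑ i, η (Matrix.vecCons Y (Function.update v i ⁅X, v i⁆)))
      - η (Matrix.vecCons ⁅X, Y⁆ v)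
  rw [Fin.sum_univ_succ]
  simp only [Matrix.vecCons, Fin.cons_zero, Fin.cons_succ, Fin.update_cons_zero,
    ← Fin.cons_update]
  abel

theorem curryLeft_alternatize (X : VectorField A) {k : ℕ}
    (F : VectorField A →ₗ[A] AltForm A (k + 1)) (G : VectorField A →ₗ[A] AltForm A k)
    (h : ∀ Y, (F Y).curryLeft X = G Y) :
    (AlternatingMap.alternatizeUncurryFin F).curryLeft X =
      F X - AlternatingMap.alternatizeUncurryFin G := by
  ext v
  rw [AlternatingMap.curryLeft_apply_apply, AlternatingMap.alternatizeUncurryFin_apply,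
    Fin.sum_univ_succ, AlternatingMap.sub_apply, AlternatingMap.alternatizeUncurryFin_apply,
    sub_eq_add_neg, ← Finset.sum_neg_distrib]
  congr 1
  · simp [Matrix.vecCons]
  · refine Finset.sum_congr rfl fun i _ => ?_
    rw [← h, AlternatingMap.curryLeft_apply_apply, Matrix.cons_val_succ, Fin.val_succ, pow_succ,
      mul_neg_one, neg_smul]
    congr 4
    funext j
    refine Fin.cases ?_ (fun j => ?_) j
    · simp [Fin.removeNth, Matrix.vecCons]
    · simp [Fin.removeNth, Matrix.vecCons]

theorem curryLeft_wedge (X : VectorField A) {k : ℕ} (α : Module.Dual A (VectorField A))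
    (η : AltForm A (k + 1)) :
    (AlternatingMap.alternatizeUncurryFin (α.smulRight η)).curryLeft X =
      α X • η - AlternatingMap.alternatizeUncurryFin (α.smulRight (η.curryLeft X)) :=
  curryLeft_alternatize X _ _ fun _ => rfl

/-- `L_X η` as a linear function of `X`, for a form `η` of degree zero. -/
def extAltZero (η : AltForm A 0) : VectorField A →ₗ[A] AltForm A 0 where
  toFun X := lieAlt X η
  map_add' X Y := lieAlt_add_left X Y η
  map_smul' f X := by
    ext v
    change (f • X) (η v) - ∑ i, η (Function.update v i ⁅f • X, v i⁆) =
      f * (X (η v) - ∑ i, η (Function.update v i ⁅X, v i⁆))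
    simp

/-- `L_X η - d (ι_X η)` as a linear function of `X`. -/
def extAltSucc {k : ℕ} (D : AltForm A k →ₗ[ℝ] AltForm A (k + 1))
    (hD : ∀ (f : A) (η : AltForm A k),
      D (f • η) = AlternatingMap.alternatizeUncurryFin ((differential f).smulRight η) + f • D η)
    (η : AltForm A (k + 1)) : VectorField A →ₗ[A] AltForm A (k + 1) where
  toFun X := lieAlt X η - D (η.curryLeft X)
  map_add' X Y := by rw [lieAlt_add_left, map_add, map_add]; abel
  map_smul' f X := by
    rw [lieAlt_smul_left, map_smul, hD, RingHom.id_apply, smul_sub]; abel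

theorem extAltSucc_add {k : ℕ} (D : AltForm A k →ₗ[ℝ] AltForm A (k + 1))
    (hD : ∀ (f : A) (η : AltForm A k),
      D (f • η) = AlternatingMap.alternatizeUncurryFin ((differential f).smulRight η) + f • D η)
    (η ζ : AltForm A (k + 1)) :
    extAltSucc D hD (η + ζ) = extAltSucc D hD η + extAltSucc D hD ζ := by
  refine LinearMap.ext fun X => ?_
  change lieAlt X (η + ζ) - D (η.curryLeft X + ζ.curryLeft X) =
    (lieAlt X η - D (η.curryLeft X)) + (lieAlt X ζ - D (ζ.curryLeft X))
  rw [lieAlt_add, map_add]; abel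

theorem extAltSucc_smul {k : ℕ} (D : AltForm A k →ₗ[ℝ] AltForm A (k + 1))
    (hD : ∀ (f : A) (η : AltForm A k),
      D (f • η) = AlternatingMap.alternatizeUncurryFin ((differential f).smulRight η) + f • D η)
    (c : ℝ) (η : AltForm A (k + 1)) :
    extAltSucc D hD (c • η) = c • extAltSucc D hD η := by
  refine LinearMap.ext fun X => ?_
  change lieAlt X (c • η) - D (c • η.curryLeft X) = c • (lieAlt X η - D (η.curryLeft X))
  rw [lieAlt_real_smul, map_smul, smul_sub]

/-- The exterior derivative on forms of degree `k`, determined recursively by Cartan's formula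
`ι_X (dη) = L_X η - d (ι_X η)`, which is the lemma `contract_exteriorDerivative` below. -/
noncomputable def extAltAux : (k : ℕ) →
    {D : AltForm A k →ₗ[ℝ] AltForm A (k + 1) // ∀ (f : A) (η : AltForm A k), D (f • η) = AlternatingMap.alternatizeUncurryFin ((differential f).smulRight η) + f • D η}
  | 0 => ⟨
      { toFun η := AlternatingMap.alternatizeUncurryFin (extAltZero η)
        map_add' η ζ := by
          rw [← AlternatingMap.alternatizeUncurryFin_add]
          congr 1; ext1 X; exact lieAlt_add X η ζ
        map_smul' c η := by
          rw [RingHom.id_apply, ← AlternatingMap.alternatizeUncurryFin_smul]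
          congr 1; ext1 X; exact lieAlt_real_smul c X η }, by
      intro f η
      change AlternatingMap.alternatizeUncurryFin _ =
        _ + f • AlternatingMap.alternatizeUncurryFin _
      rw [← AlternatingMap.alternatizeUncurryFin_smul, ← AlternatingMap.alternatizeUncurryFin_add]
      congr 1; ext1 X; exact (lieAlt_smul f X η).trans (add_comm _ _)⟩
  | k + 1 => ⟨
      { toFun η := (k + 2 : ℝ)⁻¹ •
          AlternatingMap.alternatizeUncurryFin (extAltSucc (extAltAux k).1 (extAltAux k).2 η)
        map_add' η ζ := by
          rw [extAltSucc_add, AlternatingMap.alternatizeUncurryFin_add, smul_add]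
        map_smul' c η := by
          rw [extAltSucc_smul, AlternatingMap.alternatizeUncurryFin_smul, RingHom.id_apply]
          exact smul_comm (k + 2 : ℝ)⁻¹ c (AlternatingMap.alternatizeUncurryFin
            (extAltSucc (extAltAux k).1 (extAltAux k).2 η)) }, by
      intro f η
      have h : (k + 2 : ℝ) ≠ 0 := by positivity
      change (k + 2 : ℝ)⁻¹ • AlternatingMap.alternatizeUncurryFin
          (extAltSucc (extAltAux k).1 (extAltAux k).2 (f • η)) =
        AlternatingMap.alternatizeUncurryFin ((differential f).smulRight η) +
          f • (k + 2 : ℝ)⁻¹ • AlternatingMap.alternatizeUncurryFin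
            (extAltSucc (extAltAux k).1 (extAltAux k).2 η)
      rw [inv_smul_eq_iff₀ h, smul_add, smul_comm f (k + 2 : ℝ)⁻¹, smul_inv_smul₀ h]
      have e : extAltSucc (extAltAux k).1 (extAltAux k).2 (f • η) =
          (AlternatingMap.alternatizeUncurryFin ((differential f).smulRight η)).curryLeft +
            f • extAltSucc (extAltAux k).1 (extAltAux k).2 η := by
        ext1 X
        rw [LinearMap.add_apply, curryLeft_wedge]
        change lieAlt X (f • η) - (extAltAux k).1 (f • η.curryLeft X) = X f • η - _ +
          f • (lieAlt X η - (extAltAux k).1 (η.curryLeft X))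
        rw [lieAlt_smul, (extAltAux k).2, smul_sub]
        abel
      rw [e, AlternatingMap.alternatizeUncurryFin_add, AlternatingMap.alternatizeUncurryFin_smul,
        AlternatingMap.alternatizeUncurryFin_curryLeft]
      congr 1
      rw [← Nat.cast_smul_eq_nsmul ℝ]
      congr 1
      push_cast
      ring⟩

theorem alternatize_zero_degree (F : VectorField A →ₗ[A] AltForm A 0) (X : VectorField A) :
    (AlternatingMap.alternatizeUncurryFin F).curryLeft X = F X := by
  ext v
  rw [AlternatingMap.curryLeft_apply_apply, AlternatingMap.alternatizeUncurryFin_apply]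
  simp [Matrix.vecCons, Subsingleton.elim _ v]

theorem curryLeft_swap {k : ℕ} (η : AltForm A (k + 2)) (X Y : VectorField A) :
    (η.curryLeft X).curryLeft Y = -(η.curryLeft Y).curryLeft X := by
  have h : (η.curryLeft (X + Y)).curryLeft (X + Y) =
      (η.curryLeft X).curryLeft X + (η.curryLeft X).curryLeft Y +
        ((η.curryLeft Y).curryLeft X + (η.curryLeft Y).curryLeft Y) := by
    rw [map_add η.curryLeft, AlternatingMap.curryLeft_add, LinearMap.add_apply,
      map_add (η.curryLeft X).curryLeft, map_add (η.curryLeft Y).curryLeft]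
  simp only [AlternatingMap.curryLeft_same, zero_add, add_zero] at h
  exact eq_neg_of_add_eq_zero_left h.symm

theorem alternatize_neg_curryLeft {k : ℕ} (ζ : AltForm A (k + 1)) :
    AlternatingMap.alternatizeUncurryFin (-ζ.curryLeft) = -((k + 1 : ℕ) • ζ) := by
  rw [← AlternatingMap.alternatizeUncurryFin_curryLeft]
  ext v
  rw [AlternatingMap.neg_apply, AlternatingMap.alternatizeUncurryFin_apply,
    AlternatingMap.alternatizeUncurryFin_apply, ← Finset.sum_neg_distrib]
  exact Finset.sum_congr rfl fun i _ => smul_neg _ _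

theorem curryLeft_alternatize_of_skew {k : ℕ} (F : VectorField A →ₗ[A] AltForm A (k + 1))
    (h : ∀ X Y, (F Y).curryLeft X = -(F X).curryLeft Y) (X : VectorField A) :
    (AlternatingMap.alternatizeUncurryFin F).curryLeft X = (k + 2 : ℝ) • F X := by
  rw [curryLeft_alternatize X F (-(F X).curryLeft) (fun Y => h X Y), alternatize_neg_curryLeft,
    sub_neg_eq_add, ← Nat.cast_smul_eq_nsmul ℝ]
  push_cast
  module

theorem extAlt_cartan (k : ℕ) (X : VectorField A) (η : AltForm A (k + 1)) :
    ((extAltAux (k + 1)).1 η).curryLeft X = lieAlt X η - (extAltAux k).1 (η.curryLeft X) := by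
  have h : (k + 2 : ℝ) ≠ 0 := by positivity
  have key : ∀ X Y, (extAltSucc (extAltAux k).1 (extAltAux k).2 η Y).curryLeft X =
      -(extAltSucc (extAltAux k).1 (extAltAux k).2 η X).curryLeft Y := by
    intro X Y
    change (lieAlt Y η - (extAltAux k).1 (η.curryLeft Y)).curryLeft X =
      -(lieAlt X η - (extAltAux k).1 (η.curryLeft X)).curryLeft Y
    have h1 : ∀ (ζ ξ : AltForm A (k + 1)) (Z : VectorField A),
      (ζ - ξ).curryLeft Z = ζ.curryLeft Z - ξ.curryLeft Z := fun _ _ _ => rfl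
    rw [h1, h1, curryLeft_lieAlt, curryLeft_lieAlt, ← lie_skew X Y, map_neg]
    cases k with
    | zero =>
      have h0 : ∀ (Z : VectorField A) (ζ : AltForm A 0),
        ((extAltAux 0).1 ζ).curryLeft Z = lieAlt Z ζ := fun Z ζ => alternatize_zero_degree _ _
      rw [h0, h0]
      abel
    | succ k =>
      rw [extAlt_cartan k, extAlt_cartan k, curryLeft_swap η X Y, map_neg]
      abel
  have e : (extAltAux (k + 1)).1 η = (k + 2 : ℝ)⁻¹ •
      AlternatingMap.alternatizeUncurryFin (extAltSucc (extAltAux k).1 (extAltAux k).2 η) := rfl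
  have e' : ((k + 2 : ℝ)⁻¹ • AlternatingMap.alternatizeUncurryFin
      (extAltSucc (extAltAux k).1 (extAltAux k).2 η)).curryLeft X = (k + 2 : ℝ)⁻¹ •
      (AlternatingMap.alternatizeUncurryFin
        (extAltSucc (extAltAux k).1 (extAltAux k).2 η)).curryLeft X := rfl
  rw [e, e', curryLeft_alternatize_of_skew _ key X, inv_smul_smul₀ h]
  rfl

theorem altForm_sub_smul (a b : A) {k : ℕ} (η : AltForm A k) : (a - b) • η = a • η - b • η := by
  ext v
  exact sub_mul a b (η v)

/-- The Lie derivative `L_X` of differential forms. -/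
def lieDerivative (X : VectorField A) : Forms A →ₗ[ℝ] Forms A where
  toFun η k := lieAlt X (η k)
  map_add' η ζ := funext fun k => lieAlt_add X (η k) (ζ k)
  map_smul' c η := funext fun k => lieAlt_real_smul c X (η k)

/-- The de Rham differential. -/
noncomputable def exteriorDerivative : Forms A →ₗ[ℝ] Forms A where
  toFun η
    | 0 => 0
    | k + 1 => (extAltAux k).1 (η k)
  map_add' η ζ := by
    funext k
    cases k with
    | zero => simp
    | succ k => exact map_add (extAltAux k).1 (η k) (ζ k)
  map_smul' c η := by
    funext k
    cases k with
    | zero => simp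
    | succ k => exact map_smul (extAltAux k).1 c (η k)

theorem forms_ext (j : ℕ) {η ζ : Forms A} (h : ∀ X, contract X η j = contract X ζ j) :
    η (j + 1) = ζ (j + 1) := by
  ext v
  have := congrArg (fun ξ : AltForm A j => ξ (Matrix.vecTail v)) (h (Matrix.vecHead v))
  change η (j + 1) (Matrix.vecCons _ _) = ζ (j + 1) (Matrix.vecCons _ _) at this
  simpa using this

theorem contract_wedgeLeft (X : VectorField A) (α : Module.Dual A (VectorField A)) (η : Forms A) :
    contract X (wedgeLeft α η) = α X • η - wedgeLeft α (contract X η) := by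
  funext k
  cases k with
  | zero =>
    refine (alternatize_zero_degree _ _).trans ?_
    change α X • η 0 = α X • η 0 - 0
    rw [sub_zero]
  | succ k => exact curryLeft_wedge X α (η (k + 1))

theorem contract_lieDerivative (X Y : VectorField A) (η : Forms A) :
    contract Y (lieDerivative X η) = lieDerivative X (contract Y η) - contract ⁅X, Y⁆ η :=
  funext fun k => curryLeft_lieAlt X Y (η (k + 1))

theorem lieDerivative_smul (f : A) (X : VectorField A) (η : Forms A) :
    lieDerivative X (f • η) = f • lieDerivative X η + (X f) • η :=
  funext fun k => lieAlt_smul f X (η k)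

/-- Cartan's formula. -/
theorem contract_exteriorDerivative (X : VectorField A) (η : Forms A) :
    contract X (exteriorDerivative η) = lieDerivative X η - exteriorDerivative (contract X η) := by
  funext k
  cases k with
  | zero =>
    refine (alternatize_zero_degree _ _).trans ?_
    change lieAlt X (η 0) = lieAlt X (η 0) - 0
    rw [sub_zero]
  | succ k => exact extAlt_cartan k X (η (k + 1))

theorem exteriorDerivative_smul (f : A) (η : Forms A) :
    exteriorDerivative (f • η) = wedgeLeft (differential f) η + f • exteriorDerivative η := by
  funext k
  cases k with
  | zero =>
    change (0 : AltForm A 0) = 0 + f • 0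
    simp
  | succ k => exact (extAltAux k).2 f (η k)

theorem wedgeLeft_anticomm (α β : Module.Dual A (VectorField A)) (η : Forms A) :
    wedgeLeft α (wedgeLeft β η) = -wedgeLeft β (wedgeLeft α η) := by
  have h : ∀ (k : ℕ) (η : Forms A),
      wedgeLeft α (wedgeLeft β η) k = (-wedgeLeft β (wedgeLeft α η)) k := by
    intro k
    induction k with
    | zero => intro η; exact (neg_zero (G := AltForm A 0)).symm
    | succ k ih =>
      intro η
      refine forms_ext k fun X => ?_
      rw [map_neg, contract_wedgeLeft, contract_wedgeLeft, contract_wedgeLeft, contract_wedgeLeft,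
        map_sub, map_sub, map_smul, map_smul]
      have := ih (contract X η)
      simp only [Pi.sub_apply, Pi.neg_apply, Pi.smul_apply] at this ⊢
      rw [this]
      abel
  exact funext fun k => h k η

theorem lieDerivative_wedgeLeft (X : VectorField A) (g : A) (η : Forms A) :
    lieDerivative X (wedgeLeft (differential g) η) =
      wedgeLeft (differential (X g)) η + wedgeLeft (differential g) (lieDerivative X η) := by
  have h : ∀ (k : ℕ) (η : Forms A), lieDerivative X (wedgeLeft (differential g) η) k =
      (wedgeLeft (differential (X g)) η + wedgeLeft (differential g) (lieDerivative X η)) k := by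
    intro k
    induction k with
    | zero =>
      intro η
      have : lieDerivative X (wedgeLeft (differential g) η) 0 = 0 := by
        have := lieAlt_real_smul 0 X (0 : AltForm A 0)
        simp only [zero_smul] at this
        exact this
      rw [this]
      exact (add_zero (0 : AltForm A 0)).symm
    | succ k ih =>
      intro η
      refine forms_ext k fun Y => ?_
      have e : differential g ⁅X, Y⁆ = X (Y g) - Y (X g) := rfl
      have e1 : differential (X g) Y = Y (X g) := rfl
      have e2 : differential g Y = Y g := rfl
      rw [contract_lieDerivative, contract_wedgeLeft, contract_wedgeLeft, map_add,
        contract_wedgeLeft, contract_wedgeLeft, contract_lieDerivative, map_sub, map_sub,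
        lieDerivative_smul, e, e1, e2]
      have := ih (contract Y η)
      simp only [Pi.sub_apply, Pi.add_apply, Pi.smul_apply] at this ⊢
      rw [this, altForm_sub_smul]
      abel
  exact funext fun k => h k η

theorem exteriorDerivative_wedgeLeft (g : A) (η : Forms A) :
    exteriorDerivative (wedgeLeft (differential g) η) =
      -wedgeLeft (differential g) (exteriorDerivative η) := by
  have h : ∀ (k : ℕ) (η : Forms A), exteriorDerivative (wedgeLeft (differential g) η) k =
      (-wedgeLeft (differential g) (exteriorDerivative η)) k := by
    intro k
    induction k with
    | zero => intro η; exact (neg_zero (G := AltForm A 0)).symm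
    | succ k ih =>
      intro η
      refine forms_ext k fun X => ?_
      have e2 : differential g X = X g := rfl
      rw [contract_exteriorDerivative, contract_wedgeLeft, map_neg, contract_wedgeLeft,
        contract_exteriorDerivative, lieDerivative_wedgeLeft, map_sub, map_sub,
        exteriorDerivative_smul, e2]
      have := ih (contract X η)
      simp only [Pi.sub_apply, Pi.add_apply, Pi.smul_apply, Pi.neg_apply] at this ⊢
      rw [this]
      abel
  exact funext fun k => h k η

/-- The constant function `1`. -/
def oneForm : Forms A
  | 0 => AlternatingMap.constOfIsEmpty A (VectorField A) (Fin 0) 1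
  | _ + 1 => 0

theorem contract_oneForm (X : VectorField A) : contract X oneForm = 0 := rfl

theorem exteriorDerivative_oneForm : exteriorDerivative (oneForm : Forms A) = 0 := by
  funext k
  cases k with
  | zero => rfl
  | succ k =>
    refine forms_ext k (ζ := 0) fun X => ?_
    rw [contract_exteriorDerivative, contract_oneForm, map_zero, map_zero, sub_zero]
    cases k with
    | zero =>
      ext v
      change X 1 - ∑ i : Fin 0, (1 : A) = 0
      simp
    | succ k =>
      have := lieAlt_real_smul 0 X (0 : AltForm A (k + 1))
      simp only [zero_smul] at this
      exact this

/-- `dg₁ ∧ ⋯ ∧ dg_l`. -/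
def wedgeList : List A → Forms A
  | [] => oneForm
  | g :: gs => wedgeLeft (differential g) (wedgeList gs)

variable (A) in
/-- Differential forms: finite sums of `f dg₁ ∧ ⋯ ∧ dg_l`, of all degrees `l`. -/
def Omega : Submodule A (Forms A) := Submodule.span A (Set.range wedgeList)

variable (A) in
/-- Differential forms of degree `l`: finite sums of `f dg₁ ∧ ⋯ ∧ dg_l`. -/
def OmegaDeg (l : ℕ) : Submodule A (Forms A) :=
  Submodule.span A (wedgeList '' {gs : List A | gs.length = l})

theorem omegaDeg_le (l : ℕ) : OmegaDeg A l ≤ Omega A :=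
  Submodule.span_mono (Set.image_subset_range _ _)

theorem wedgeList_mem (gs : List A) : wedgeList gs ∈ OmegaDeg A gs.length :=
  Submodule.subset_span ⟨gs, rfl, rfl⟩

theorem wedgeList_apply_of_ne (gs : List A) (j : ℕ) (h : j ≠ gs.length) : wedgeList gs j = 0 := by
  induction gs generalizing j with
  | nil =>
    cases j with
    | zero => exact absurd rfl h
    | succ j => rfl
  | cons g gs ih =>
    cases j with
    | zero => rfl
    | succ j =>
      change AlternatingMap.alternatizeUncurryFin ((differential g).smulRight (wedgeList gs j)) = 0
      rw [ih j (fun e => h (by simp [e]))]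
      ext v
      simp [AlternatingMap.alternatizeUncurryFin_apply]

theorem omegaDeg_apply_of_ne {l : ℕ} {x : Forms A} (hx : x ∈ OmegaDeg A l) (j : ℕ) (h : j ≠ l) :
    x j = 0 := by
  induction hx using Submodule.span_induction with
  | mem x hx =>
    obtain ⟨gs, rfl, rfl⟩ := hx
    exact wedgeList_apply_of_ne gs j h
  | zero => rfl
  | add x y _ _ hx hy => rw [Pi.add_apply, hx, hy, add_zero]
  | smul f x _ hx => rw [Pi.smul_apply, hx, smul_zero]

theorem single_mem_omegaDeg {x : Forms A} (hx : x ∈ Omega A) (l : ℕ) :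
    Pi.single l (x l) ∈ OmegaDeg A l := by
  induction hx using Submodule.span_induction with
  | mem x hx =>
    obtain ⟨gs, rfl⟩ := hx
    by_cases h : l = gs.length
    · subst h
      convert wedgeList_mem gs
      funext j
      by_cases hj : j = gs.length
      · subst hj; simp
      · rw [wedgeList_apply_of_ne gs j hj, Pi.single_eq_of_ne hj]
    · rw [wedgeList_apply_of_ne gs l h, Pi.single_zero]
      exact zero_mem _
  | zero => simp
  | add x y _ _ hx hy => rw [Pi.add_apply, Pi.single_add]; exact add_mem hx hy
  | smul f x _ hx => rw [Pi.smul_apply, Pi.single_smul]; exact Submodule.smul_mem _ f hx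

theorem wedgeLeft_mem_deg (g : A) {l : ℕ} {x : Forms A} (hx : x ∈ OmegaDeg A l) :
    wedgeLeft (differential g) x ∈ OmegaDeg A (l + 1) := by
  induction hx using Submodule.span_induction with
  | mem x hx =>
    obtain ⟨gs, rfl, rfl⟩ := hx
    exact wedgeList_mem (g :: gs)
  | zero => simp
  | add x y _ _ hx hy => rw [map_add]; exact add_mem hx hy
  | smul f x _ hx => rw [map_smul]; exact Submodule.smul_mem _ f hx

theorem contract_wedgeList_mem (X : VectorField A) (gs : List A) :
    contract X (wedgeList gs) ∈ OmegaDeg A (gs.length - 1) := by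
  induction gs with
  | nil => exact zero_mem _
  | cons g gs ih =>
    rw [wedgeList, contract_wedgeLeft]
    refine sub_mem (Submodule.smul_mem _ _ (wedgeList_mem gs)) ?_
    cases gs with
    | nil => rw [wedgeList, contract_oneForm, map_zero]; exact zero_mem _
    | cons h gs => exact wedgeLeft_mem_deg g ih

theorem exteriorDerivative_wedgeList (gs : List A) : exteriorDerivative (wedgeList gs) = 0 := by
  induction gs with
  | nil => exact exteriorDerivative_oneForm
  | cons g gs ih => rw [wedgeList, exteriorDerivative_wedgeLeft, ih, map_zero, neg_zero]

theorem exteriorDerivative_mem_deg {l : ℕ} {x : Forms A} (hx : x ∈ OmegaDeg A l) :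
    exteriorDerivative x ∈ OmegaDeg A (l + 1) := by
  induction hx using Submodule.span_induction with
  | mem x hx =>
    obtain ⟨gs, rfl, rfl⟩ := hx
    rw [exteriorDerivative_wedgeList]; exact zero_mem _
  | zero => simp
  | add x y _ _ hx hy => rw [map_add]; exact add_mem hx hy
  | smul f x hx' hx =>
    rw [exteriorDerivative_smul]
    exact add_mem (wedgeLeft_mem_deg f hx') (Submodule.smul_mem _ f hx)

theorem wedgeLeft_mem (g : A) {x : Forms A} (hx : x ∈ Omega A) :
    wedgeLeft (differential g) x ∈ Omega A := by
  induction hx using Submodule.span_induction with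
  | mem x hx =>
    obtain ⟨gs, rfl⟩ := hx
    exact omegaDeg_le _ (wedgeList_mem (g :: gs))
  | zero => simp
  | add x y _ _ hx hy => rw [map_add]; exact add_mem hx hy
  | smul f x _ hx => rw [map_smul]; exact Submodule.smul_mem _ f hx

theorem contract_mem (X : VectorField A) {x : Forms A} (hx : x ∈ Omega A) :
    contract X x ∈ Omega A := by
  induction hx using Submodule.span_induction with
  | mem x hx =>
    obtain ⟨gs, rfl⟩ := hx
    exact omegaDeg_le _ (contract_wedgeList_mem X gs)
  | zero => simp
  | add x y _ _ hx hy => rw [map_add]; exact add_mem hx hy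
  | smul f x _ hx => rw [map_smul]; exact Submodule.smul_mem _ f hx

theorem exteriorDerivative_mem {x : Forms A} (hx : x ∈ Omega A) :
    exteriorDerivative x ∈ Omega A := by
  induction hx using Submodule.span_induction with
  | mem x hx =>
    obtain ⟨gs, rfl⟩ := hx
    rw [exteriorDerivative_wedgeList]; exact zero_mem _
  | zero => simp
  | add x y _ _ hx hy => rw [map_add]; exact add_mem hx hy
  | smul f x hx' hx =>
    rw [exteriorDerivative_smul]
    exact add_mem (wedgeLeft_mem f hx') (Submodule.smul_mem _ f hx)

variable (A) in
/-- The type of differential `l`-forms. -/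
abbrev DiffForm (l : ℕ) : Type _ := OmegaDeg A l

/-- The exterior derivative of an `l`-form. -/
noncomputable def DiffForm.d {l : ℕ} (η : DiffForm A l) : DiffForm A (l + 1) :=
  ⟨exteriorDerivative η.1, exteriorDerivative_mem_deg η.2⟩


end Forms
end TwistedPoisson

namespace TwistedPoisson
section Forms
variable {A : Type*} [CommRing A] [Algebra ℝ A]
instance (k : ℕ) : IsScalarTower ℝ A (AltForm A k) :=
  ⟨fun c f η => AlternatingMap.ext fun v => smul_assoc c f (η v)⟩

instance : Module ℝ (Forms A) := Pi.module ..

instance : IsScalarTower ℝ A (Forms A) :=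
  ⟨fun c f η => funext fun k => smul_assoc c f (η k)⟩

variable (A) in
/-- The space `Ω` of differential forms of all degrees. -/
def DiffForms : Type _ := Omega A

instance : AddCommGroup (DiffForms A) := inferInstanceAs (AddCommGroup (Omega A))

instance : Module A (DiffForms A) := inferInstanceAs (Module A (Omega A))

instance : Module ℝ (DiffForms A) :=
  { Submodule.module' (R := A) (S := ℝ) (Omega A) with }

instance : SMulCommClass A ℝ (DiffForms A) :=
  ⟨fun f c x => Subtype.ext <| funext fun k => AlternatingMap.ext fun v =>
    mul_smul_comm c f (x.1 k v)⟩

variable (A) in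
/-- Linear operators on differential forms. -/
abbrev Op : Type _ := Module.End ℝ (DiffForms A)

/-- Multiplication by the function `f`. -/
def opFun (f : A) : Op A where
  toFun x := f • x
  map_add' x y := smul_add f x y
  map_smul' c x := smul_comm f c x

/-- The operator `dg ∧`. -/
def opD (g : A) : Op A where
  toFun x := ⟨wedgeLeft (differential g) x.1, wedgeLeft_mem g x.2⟩
  map_add' x y := Subtype.ext (map_add (wedgeLeft (differential g)) x.1 y.1)
  map_smul' c x := Subtype.ext ((wedgeLeft (differential g)).map_smul_of_tower c x.1)

/-- The operator `ι_X`. -/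
def opContract (X : VectorField A) : Op A where
  toFun x := ⟨contract X x.1, contract_mem X x.2⟩
  map_add' x y := Subtype.ext (map_add (contract X) x.1 y.1)
  map_smul' c x := Subtype.ext ((contract X).map_smul_of_tower c x.1)

/-- The de Rham operator `d`. -/
noncomputable def opDeRham : Op A where
  toFun x := ⟨exteriorDerivative x.1, exteriorDerivative_mem x.2⟩
  map_add' x y := Subtype.ext (map_add exteriorDerivative x.1 y.1)
  map_smul' c x := Subtype.ext (map_smul exteriorDerivative c x.1)

variable (A) in
/-- Operators which raise the form degree by `m`. -/
def HasDegree (m : ℤ) : Submodule ℝ (Op A) where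
  carrier := {P | ∀ (l : ℕ) (x : DiffForms A), (∀ i, i ≠ l → x.1 i = 0) →
    ∀ j : ℕ, (j : ℤ) ≠ l + m → (P x).1 j = 0}
  add_mem' hP hQ l x hx j hj := by
    change (_ : AltForm A j) + _ = 0
    rw [hP l x hx j hj, hQ l x hx j hj, add_zero]
  zero_mem' _ _ _ _ _ := rfl
  smul_mem' c P hP l x hx j hj := by
    change c • (_ : AltForm A j) = 0
    rw [hP l x hx j hj, smul_zero]

/-- The operation `P ↦ P Q - s Q P`. -/
noncomputable def scomm (s : ℝ) (Q : Op A) : Op A →ₗ[ℝ] Op A where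
  toFun P := P * Q - s • (Q * P)
  map_add' P P' := by rw [add_mul, mul_add, smul_add]; abel
  map_smul' c P := by
    rw [smul_mul_assoc, mul_smul_comm, smul_comm s c, ← smul_sub, RingHom.id_apply]

variable (A) in
/-- `OrdLT A k m` is the space of differential operators on `Ω`, regarded as the graded algebra of
functions on `ΠTM`, of form degree `m` and of order less than `k`, in the sense of Grothendieck:
only `0` has order less than `0`, and an operator of degree `m` has order less than `k + 1` if its
graded commutators with the (multiplication operators by the) generators `f` and `dg` of `Ω` have
order less than `k`. -/
noncomputable def OrdLT : ℕ → ℤ → Submodule ℝ (Op A)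
  | 0, _ => ⊥
  | k + 1, m => HasDegree A m ⊓ ((⨅ f : A, (OrdLT k m).comap (scomm 1 (opFun f))) ⊓
      ⨅ g : A, (OrdLT k (m + 1)).comap (scomm ((-1) ^ m) (opD g)))

theorem mem_ordLT_succ {k : ℕ} {m : ℤ} {P : Op A} : P ∈ OrdLT A (k + 1) m ↔
    P ∈ HasDegree A m ∧ (∀ f : A, P * opFun f - opFun f * P ∈ OrdLT A k m) ∧
      ∀ g : A, P * opD g - ((-1 : ℝ) ^ m) • (opD g * P) ∈ OrdLT A k (m + 1) := by
  simp only [OrdLT, Submodule.mem_inf, Submodule.mem_iInf, Submodule.mem_comap, scomm,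
    LinearMap.coe_mk, AddHom.coe_mk, one_smul]

theorem mem_ordLT_zero {m : ℤ} {P : Op A} : P ∈ OrdLT A 0 m ↔ P = 0 := Iff.rfl

theorem opFun_comm (f g : A) : opFun f * opFun g = opFun g * opFun f :=
  LinearMap.ext fun x => smul_comm f g x

theorem opD_opFun (g f : A) : opD g * opFun f = opFun f * opD g :=
  LinearMap.ext fun x => Subtype.ext (map_smul (wedgeLeft (differential g)) f x.1)

theorem opD_anticomm (g h : A) : opD g * opD h = -(opD h * opD g) :=
  LinearMap.ext fun x => Subtype.ext (wedgeLeft_anticomm _ _ x.1)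

theorem opContract_opFun (X : VectorField A) (f : A) :
    opContract X * opFun f = opFun f * opContract X :=
  LinearMap.ext fun x => Subtype.ext (map_smul (contract X) f x.1)

theorem opContract_opD (X : VectorField A) (g : A) :
    opContract X * opD g = opFun (X g) - opD g * opContract X :=
  LinearMap.ext fun x => Subtype.ext (contract_wedgeLeft X (differential g) x.1)

theorem opDeRham_opFun (f : A) : opDeRham * opFun f = opD f + opFun f * opDeRham :=
  LinearMap.ext fun x => Subtype.ext (exteriorDerivative_smul f x.1)

theorem opDeRham_opD (g : A) : opDeRham * opD g = -(opD g * opDeRham) :=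
  LinearMap.ext fun x => Subtype.ext (exteriorDerivative_wedgeLeft g x.1)

theorem opFun_degree (f : A) : opFun f ∈ HasDegree A 0 := by
  intro l x hx j hj
  change f • x.1 j = 0
  rw [hx j (by omega), smul_zero]

theorem opD_degree (g : A) : opD g ∈ HasDegree A 1 := by
  intro l x hx j hj
  cases j with
  | zero => rfl
  | succ j =>
    change AlternatingMap.alternatizeUncurryFin ((differential g).smulRight (x.1 j)) = 0
    rw [hx j (by omega)]
    ext v
    simp [AlternatingMap.alternatizeUncurryFin_apply]

theorem opContract_degree (X : VectorField A) : opContract X ∈ HasDegree A (-1) := by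
  intro l x hx j hj
  change (x.1 (j + 1)).curryLeft X = 0
  rw [hx (j + 1) (by omega)]
  rfl

theorem opDeRham_degree : (opDeRham : Op A) ∈ HasDegree A 1 := by
  intro l x hx j hj
  cases j with
  | zero => rfl
  | succ j =>
    change (extAltAux j).1 (x.1 j) = 0
    rw [hx j (by omega), map_zero]

theorem hasDegree_mul {P Q : Op A} {m n : ℤ} (hP : P ∈ HasDegree A m) (hQ : Q ∈ HasDegree A n) :
    P * Q ∈ HasDegree A (m + n) := by
  intro l x hx j hj
  by_cases h : ∃ i : ℕ, (i : ℤ) = l + n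
  · obtain ⟨i, hi⟩ := h
    exact hP i (Q x) (fun i' hi' => hQ l x hx i' (by omega)) j (by omega)
  · have h0 : Q x = 0 := Subtype.ext <| funext fun i => hQ l x hx i fun e => h ⟨i, e⟩
    change (P (Q x)).1 j = 0
    rw [h0, map_zero]
    rfl

theorem ordLT_degree {k : ℕ} {m : ℤ} {P : Op A} (hP : P ∈ OrdLT A k m) : P ∈ HasDegree A m := by
  cases k with
  | zero => rw [mem_ordLT_zero.1 hP]; exact zero_mem _
  | succ k => exact (mem_ordLT_succ.1 hP).1

theorem ordLT_le_succ (k : ℕ) (m : ℤ) : OrdLT A k m ≤ OrdLT A (k + 1) m := by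
  induction k generalizing m with
  | zero => exact bot_le
  | succ k ih =>
    intro P hP
    rw [mem_ordLT_succ] at hP ⊢
    exact ⟨hP.1, fun f => ih _ (hP.2.1 f), fun g => ih _ (hP.2.2 g)⟩

theorem ordLT_mul {a b : ℕ} {m n : ℤ} {P Q : Op A} (hP : P ∈ OrdLT A a m)
    (hQ : Q ∈ OrdLT A (b + 1) n) : P * Q ∈ OrdLT A (a + b) (m + n) := by
  induction hs : a + b generalizing a b m n P Q with
  | zero =>
    obtain rfl : a = 0 := by omega
    rw [mem_ordLT_zero.1 hP, zero_mul]
    exact zero_mem _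
  | succ s ih =>
    cases a with
    | zero => rw [mem_ordLT_zero.1 hP, zero_mul]; exact zero_mem _
    | succ a =>
      have hP' := mem_ordLT_succ.1 hP
      have hQ' := mem_ordLT_succ.1 hQ
      -- products with one factor of smaller order
      have key : ∀ {n' : ℤ} {R : Op A}, R ∈ OrdLT A b n' → P * R ∈ OrdLT A s (m + n') := by
        intro n' R hR
        cases b with
        | zero => rw [mem_ordLT_zero.1 hR, mul_zero]; exact zero_mem _
        | succ b => exact ih hP hR (by omega)
      refine mem_ordLT_succ.2 ⟨hasDegree_mul hP'.1 hQ'.1, fun f => ?_, fun g => ?_⟩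
      · have e : P * Q * opFun f - opFun f * (P * Q) =
            P * (Q * opFun f - opFun f * Q) + (P * opFun f - opFun f * P) * Q := by
          noncomm_ring
        rw [e]
        exact add_mem (key (hQ'.2.1 f)) (ih (hP'.2.1 f) hQ (by omega))
      · have e : P * Q * opD g - (-1 : ℝ) ^ (m + n) • (opD g * (P * Q)) =
            P * (Q * opD g - (-1 : ℝ) ^ n • (opD g * Q)) +
              (-1 : ℝ) ^ n • ((P * opD g - (-1 : ℝ) ^ m • (opD g * P)) * Q) := by
          rw [zpow_add₀ (by norm_num), mul_sub, sub_mul, smul_sub, smul_mul_assoc, mul_smul_comm,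
            smul_smul, mul_comm ((-1 : ℝ) ^ m)]
          simp only [mul_assoc]
          abel
        rw [e]
        have h1 := key (hQ'.2.2 g)
        have h2 := ih (hP'.2.2 g) hQ (by omega : a + b = s)
        rw [← add_assoc] at h1
        rw [add_right_comm] at h2
        exact add_mem h1 (Submodule.smul_mem _ _ h2)

theorem opFun_mem (f : A) : opFun f ∈ OrdLT A 1 0 := by
  refine mem_ordLT_succ.2 ⟨opFun_degree f, fun g => ?_, fun g => ?_⟩
  · rw [mem_ordLT_zero, opFun_comm, sub_self]
  · rw [mem_ordLT_zero, zpow_zero, one_smul, opD_opFun, sub_self]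

theorem opD_mem (g : A) : opD g ∈ OrdLT A 1 1 := by
  refine mem_ordLT_succ.2 ⟨opD_degree g, fun f => ?_, fun h => ?_⟩
  · rw [mem_ordLT_zero, opD_opFun, sub_self]
  · rw [mem_ordLT_zero, zpow_one, opD_anticomm, neg_smul, one_smul, sub_neg_eq_add,
      neg_add_cancel]

theorem opContract_mem (X : VectorField A) : opContract X ∈ OrdLT A 2 (-1) := by
  refine mem_ordLT_succ.2 ⟨opContract_degree X, fun f => ?_, fun h => ?_⟩
  · rw [opContract_opFun, sub_self]; exact zero_mem _
  · rw [opContract_opD, zpow_neg_one, inv_neg, inv_one, neg_smul, one_smul, sub_neg_eq_add,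
      sub_add_cancel]
    exact opFun_mem _

theorem opDeRham_mem : (opDeRham : Op A) ∈ OrdLT A 2 1 := by
  refine mem_ordLT_succ.2 ⟨opDeRham_degree, fun f => ?_, fun h => ?_⟩
  · rw [opDeRham_opFun, add_sub_cancel_right]; exact opD_mem f
  · rw [opDeRham_opD, zpow_one, neg_smul, one_smul, sub_neg_eq_add, neg_add_cancel]
    exact zero_mem _

variable (A) in
/-- The constant function `1`, as a differential form. -/
def DiffForms.one : DiffForms A := ⟨oneForm, Submodule.subset_span ⟨[], rfl⟩⟩

/-- An operator of order zero is determined by its value at `1`. -/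
theorem op_ext_of_order_zero {m : ℤ} {P : Op A} (hP : P ∈ OrdLT A 1 m)
    (h : P (DiffForms.one A) = 0) : P = 0 := by
  have hP' := mem_ordLT_succ.1 hP
  have hf : ∀ f x, P (f • x) = f • P x := fun f x =>
    LinearMap.congr_fun (sub_eq_zero.1 (mem_ordLT_zero.1 (hP'.2.1 f))) x
  have hg : ∀ g x, P (opD g x) = (-1 : ℝ) ^ m • opD g (P x) := fun g x =>
    LinearMap.congr_fun (sub_eq_zero.1 (mem_ordLT_zero.1 (hP'.2.2 g))) x
  have hx : ∀ x : Forms A, x ∈ Omega A → ∃ h : x ∈ Omega A, P (⟨x, h⟩ : DiffForms A) = 0 := by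
    intro x hx
    induction hx using Submodule.span_induction with
    | mem x hx =>
      obtain ⟨gs, rfl⟩ := hx
      refine ⟨Submodule.subset_span ⟨gs, rfl⟩, ?_⟩
      induction gs with
      | nil => exact h
      | cons g gs ih =>
        refine (hg g (⟨wedgeList gs, Submodule.subset_span ⟨gs, rfl⟩⟩ : DiffForms A)).trans ?_
        exact (congrArg (fun y => (-1 : ℝ) ^ m • opD g y) ih).trans (by
          rw [map_zero, smul_zero])
    | zero => exact ⟨zero_mem _, map_zero P⟩
    | add x y hx hy h1 h2 =>
      obtain ⟨h1, e1⟩ := h1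
      obtain ⟨h2, e2⟩ := h2
      exact ⟨add_mem h1 h2, (map_add P (⟨x, h1⟩ : DiffForms A) (⟨y, h2⟩ : DiffForms A)).trans
        ((congrArg₂ (· + ·) e1 e2).trans (add_zero 0))⟩
    | smul f x hx h1 =>
      obtain ⟨h1, e1⟩ := h1
      exact ⟨Submodule.smul_mem _ f h1, (hf f (⟨x, h1⟩ : DiffForms A)).trans
        ((congrArg (f • ·) e1).trans (smul_zero f))⟩
  exact LinearMap.ext fun x => (hx x.1 x.2).2

theorem exists_mulForm {l : ℕ} {x : Forms A} (hx : x ∈ OmegaDeg A l) :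
    ∃ T ∈ OrdLT A 1 (l : ℤ), (T (DiffForms.one A)).1 = x ∧
      ∀ (m : ℤ), ∀ P ∈ OrdLT A 1 m, P * T = (-1 : ℝ) ^ (m * l) • (T * P) := by
  induction hx using Submodule.span_induction with
  | mem x hx =>
    obtain ⟨gs, rfl, rfl⟩ := hx
    induction gs with
    | nil =>
      refine ⟨opFun 1, opFun_mem 1, one_smul A (oneForm : Forms A), fun m P _ => ?_⟩
      have : (opFun 1 : Op A) = 1 := LinearMap.ext fun x => one_smul A x
      simp [this]
    | cons g gs ih =>
      obtain ⟨T, h1, h2, h3⟩ := ih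
      have hl : ((g :: gs).length : ℤ) = 1 + gs.length := by
        rw [List.length_cons]; push_cast; ring
      refine ⟨opD g * T, ?_, ?_, fun m P hP => ?_⟩
      · rw [hl]
        exact ordLT_mul (opD_mem g) h1
      · exact (congrArg (wedgeLeft (differential g)) h2 :)
      · have hg := sub_eq_zero.1 (mem_ordLT_zero.1 ((mem_ordLT_succ.1 hP).2.2 g))
        rw [← mul_assoc, hg, smul_mul_assoc, mul_assoc, h3 m P hP, mul_smul_comm, smul_smul,
          ← zpow_add₀ (by norm_num), mul_assoc, hl, mul_add, mul_one]
  | zero =>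
    exact ⟨0, zero_mem _, rfl, fun m P _ => by rw [mul_zero, zero_mul, smul_zero]⟩
  | add x y hx hy ihx ihy =>
    obtain ⟨T, h1, h2, h3⟩ := ihx
    obtain ⟨T', h1', h2', h3'⟩ := ihy
    refine ⟨T + T', add_mem h1 h1', (congrArg₂ (· + ·) h2 h2' :), fun m P hP => ?_⟩
    rw [mul_add, h3 m P hP, h3' m P hP, add_mul, smul_add]
  | smul f x hx ihx =>
    obtain ⟨T, h1, h2, h3⟩ := ihx
    refine ⟨opFun f * T, ?_, (congrArg (f • ·) h2 :), fun m P hP => ?_⟩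
    · have := ordLT_mul (opFun_mem f) h1
      rwa [add_zero, zero_add] at this
    · have hf := sub_eq_zero.1 (mem_ordLT_zero.1 ((mem_ordLT_succ.1 hP).2.1 f))
      rw [← mul_assoc, hf, mul_assoc, h3 m P hP, mul_smul_comm, mul_assoc]

theorem ordLT_one_scomm {m n : ℤ} {P Q : Op A} (hP : P ∈ OrdLT A 1 m) (hQ : Q ∈ OrdLT A 1 n) :
    P * Q = (-1 : ℝ) ^ (m * n) • (Q * P) := by
  by_cases h : ∃ l : ℕ, (l : ℤ) = n
  · obtain ⟨l, rfl⟩ := h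
    have hd : (Q (DiffForms.one A)).1 ∈ OmegaDeg A l := by
      have := single_mem_omegaDeg (Q (DiffForms.one A)).2 l
      convert this
      funext j
      by_cases hj : j = l
      · subst hj; simp
      · rw [Pi.single_eq_of_ne hj]
        refine ordLT_degree hQ 0 (DiffForms.one A) (fun i hi => ?_) j (by push_cast; omega)
        cases i with
        | zero => exact absurd rfl hi
        | succ i => rfl
    obtain ⟨T, h1, h2, h3⟩ := exists_mulForm hd
    have : Q - T = 0 := op_ext_of_order_zero (sub_mem hQ h1) (by
      rw [LinearMap.sub_apply]; exact sub_eq_zero.2 (Subtype.ext h2.symm))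
    rw [sub_eq_zero.1 this]
    exact h3 m P hP
  · have : Q = 0 := op_ext_of_order_zero hQ <| Subtype.ext <| funext fun j =>
      ordLT_degree hQ 0 (DiffForms.one A) (fun i hi => by
        cases i with
        | zero => exact absurd rfl hi
        | succ i => rfl) j (fun e => h ⟨j, by simpa using e⟩)
    rw [this, mul_zero, zero_mul, smul_zero]

theorem ordLT_scomm {a b : ℕ} {m n : ℤ} {P Q : Op A} (hP : P ∈ OrdLT A (a + 1) m)
    (hQ : Q ∈ OrdLT A (b + 1) n) :
    P * Q - (-1 : ℝ) ^ (m * n) • (Q * P) ∈ OrdLT A (a + b) (m + n) := by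
  induction hs : a + b generalizing a b m n P Q with
  | zero =>
    obtain rfl : a = 0 := by omega
    obtain rfl : b = 0 := by omega
    rw [ordLT_one_scomm hP hQ, sub_self]
    exact zero_mem _
  | succ s ih =>
    have hP' := mem_ordLT_succ.1 hP
    have hQ' := mem_ordLT_succ.1 hQ
    have hdeg : Q * P ∈ HasDegree A (m + n) := by rw [add_comm]; exact hasDegree_mul hQ'.1 hP'.1
    have k1 : ∀ {n' : ℤ} {R : Op A}, R ∈ OrdLT A b n' →
        P * R - (-1 : ℝ) ^ (m * n') • (R * P) ∈ OrdLT A s (m + n') := by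
      intro n' R hR
      cases b with
      | zero =>
        rw [mem_ordLT_zero.1 hR, mul_zero, zero_mul, smul_zero, sub_zero]; exact zero_mem _
      | succ b => exact ih hP hR (by omega)
    have k2 : ∀ {m' : ℤ} {R : Op A}, R ∈ OrdLT A a m' →
        R * Q - (-1 : ℝ) ^ (m' * n) • (Q * R) ∈ OrdLT A s (m' + n) := by
      intro n' R hR
      cases a with
      | zero =>
        rw [mem_ordLT_zero.1 hR, mul_zero, zero_mul, smul_zero, sub_zero]; exact zero_mem _
      | succ a => exact ih hR hQ (by omega)
    have sq : ∀ i : ℤ, (-1 : ℝ) ^ i * (-1 : ℝ) ^ i = 1 := fun i => by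
      rw [← mul_zpow]; norm_num
    refine mem_ordLT_succ.2 ⟨sub_mem (hasDegree_mul hP'.1 hQ'.1) (Submodule.smul_mem _ _ hdeg),
      fun f => ?_, fun g => ?_⟩
    · have e := add_mem (k1 (hQ'.2.1 f)) (k2 (hP'.2.1 f))
      convert e using 1
      simp only [mul_sub, sub_mul, smul_sub, smul_mul_assoc, mul_smul_comm, mul_assoc]
      abel
    · have h1 := k1 (hQ'.2.2 g)
      have h2 := k2 (hP'.2.2 g)
      rw [← add_assoc] at h1
      rw [add_right_comm] at h2
      convert add_mem h1 (Submodule.smul_mem _ ((-1 : ℝ) ^ n) h2) using 1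
      have em : (-1 : ℝ) ^ (m * (n + 1)) = (-1 : ℝ) ^ (m * n) * (-1 : ℝ) ^ m := by
        rw [← zpow_add₀ (by norm_num)]; congr 1; ring
      have en : (-1 : ℝ) ^ ((m + 1) * n) = (-1 : ℝ) ^ (m * n) * (-1 : ℝ) ^ n := by
        rw [← zpow_add₀ (by norm_num)]; congr 1; ring
      rw [em, en, zpow_add₀ (by norm_num) m n]
      have hm := sq m
      have hn := sq n
      generalize (-1 : ℝ) ^ m = p at *
      generalize (-1 : ℝ) ^ n = q at *
      generalize (-1 : ℝ) ^ (m * n) = r at *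
      simp only [mul_sub, sub_mul, smul_sub, smul_mul_assoc, mul_smul_comm, mul_assoc, smul_smul]
      match_scalars <;> grind

end Forms
end TwistedPoisson

namespace TwistedPoisson
section SymbolAlgebra
variable {A : Type*} [CommRing A] [Algebra ℝ A]

theorem ordLT_cast {a b : ℕ} {m n : ℤ} {P : Op A} (h1 : a = b) (h2 : m = n)
    (h : P ∈ OrdLT A a m) : P ∈ OrdLT A b n := by
  rwa [← h1, ← h2]

variable (A) in
/-- Finite sums of differential operators placed in bidegrees `(k, l)`. -/
abbrev BigradedOp : Type _ := AddMonoidAlgebra (Op A) (ℕ × ℤ)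

theorem single_coeff_mem {V : ℕ × ℤ → Submodule ℝ (Op A)} {i : ℕ × ℤ} {P : Op A} (h : P ∈ V i)
    (j : ℕ × ℤ) : (AddMonoidAlgebra.single i P).coeff j ∈ V j := by
  rw [AddMonoidAlgebra.coeff_single, Finsupp.single_apply]
  split_ifs with e
  · rwa [← e]
  · exact zero_mem _

theorem sum_coeff_mem {V : ℕ × ℤ → Submodule ℝ (Op A)} (P Q : BigradedOp A)
    (F : (ℕ × ℤ) → Op A → (ℕ × ℤ) → Op A → BigradedOp A)
    (h : ∀ i j k, (F i (P.coeff i) j (Q.coeff j)).coeff k ∈ V k) (k : ℕ × ℤ) :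
    (P.coeff.sum fun i a => Q.coeff.sum fun j b => F i a j b).coeff k ∈ V k := by
  rw [Finsupp.sum, AddMonoidAlgebra.coeff_sum, Finsupp.finsetSum_apply]
  refine sum_mem fun i _ => ?_
  rw [Finsupp.sum, AddMonoidAlgebra.coeff_sum, Finsupp.finsetSum_apply]
  exact sum_mem fun j _ => h i j k

theorem ordLT_mul' {a b : ℕ} {m n : ℤ} {P Q : Op A} (hP : P ∈ OrdLT A (a + 1) m)
    (hQ : Q ∈ OrdLT A b n) : P * Q ∈ OrdLT A (a + b) (m + n) := by
  cases b with
  | zero => rw [mem_ordLT_zero.1 hQ, mul_zero]; exact zero_mem _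
  | succ b =>
    have := ordLT_mul hP hQ
    rwa [add_right_comm] at this

variable (A) in
/-- The Rees algebra of the order filtration: the component of bidegree `(k, l)` consists of the
differential operators of order at most `k` and degree `l - k`. -/
def Rees : Subalgebra ℝ (BigradedOp A) where
  carrier := {P | ∀ i : ℕ × ℤ, P.coeff i ∈ OrdLT A (i.1 + 1) (i.2 - i.1)}
  add_mem' hP hQ i := add_mem (hP i) (hQ i)
  mul_mem' {P Q} hP hQ := by
    change ∀ k, (P * Q).coeff k ∈ _
    rw [AddMonoidAlgebra.mul_def]
    refine sum_coeff_mem (V := fun i => OrdLT A (i.1 + 1) (i.2 - i.1)) P Q _ fun i j k => ?_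
    refine single_coeff_mem (V := fun i => OrdLT A (i.1 + 1) (i.2 - i.1)) ?_ k
    refine ordLT_cast ?_ ?_ (ordLT_mul (hP i) (hQ j))
    · rw [Prod.fst_add]; omega
    · rw [Prod.fst_add, Prod.snd_add]; push_cast; ring
  algebraMap_mem' c i := by
    rw [AddMonoidAlgebra.coe_algebraMap]
    refine single_coeff_mem (V := fun i => OrdLT A (i.1 + 1) (i.2 - i.1)) ?_ i
    have : (algebraMap ℝ (Op A)) c = opFun (algebraMap ℝ A c) :=
      LinearMap.ext fun x => Subtype.ext (algebraMap_smul A c x.1).symm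
    rw [this]
    exact opFun_mem _

variable (A) in
/-- The ideal of the Rees algebra whose component of bidegree `(k, l)` consists of the differential
operators of order less than `k` and degree `l - k`. -/
def lowerOrder : Ideal (Rees A) where
  carrier := {P | ∀ i : ℕ × ℤ, P.1.coeff i ∈ OrdLT A i.1 (i.2 - i.1)}
  add_mem' hP hQ i := add_mem (hP i) (hQ i)
  zero_mem' _ := zero_mem _
  smul_mem' P Q hQ := by
    change ∀ k, (P.1 * Q.1).coeff k ∈ _
    rw [AddMonoidAlgebra.mul_def]
    refine sum_coeff_mem (V := fun i => OrdLT A i.1 (i.2 - i.1)) P.1 Q.1 _ fun i j k => ?_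
    refine single_coeff_mem (V := fun i => OrdLT A i.1 (i.2 - i.1)) ?_ k
    refine ordLT_cast rfl ?_ (ordLT_mul' (P.2 i) (hQ j))
    rw [Prod.fst_add, Prod.snd_add]; push_cast; ring

instance : (lowerOrder A).IsTwoSided := ⟨fun {P} Q hP => by
    change ∀ k, (P.1 * Q.1).coeff k ∈ _
    rw [AddMonoidAlgebra.mul_def]
    refine sum_coeff_mem (V := fun i => OrdLT A i.1 (i.2 - i.1)) P.1 Q.1 _ fun i j k => ?_
    refine single_coeff_mem (V := fun i => OrdLT A i.1 (i.2 - i.1)) ?_ k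
    refine ordLT_cast rfl ?_ (ordLT_mul (hP i) (Q.2 j))
    rw [Prod.fst_add, Prod.snd_add]; push_cast; ring⟩

noncomputable instance : Ring (Rees A) := (Rees A).toRing

variable (A) in
/-- The graded Poisson algebra `C` of polynomial functions on `T^*ΠTM`, as the algebra of principal
symbols of differential operators on `Ω`: its component of bidegree `(k, l)` is the quotient of
the space of operators of order at most `k` and degree `l - k` by those of order less than `k`. -/
def C : Type _ := Rees A ⧸ lowerOrder A

noncomputable instance : Ring (C A) := inferInstanceAs (Ring (Rees A ⧸ lowerOrder A))

noncomputable instance : Algebra ℝ (C A) := inferInstanceAs (Algebra ℝ (Rees A ⧸ lowerOrder A))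

/-- The class of an element of the Rees algebra. -/
noncomputable def C.mk : Rees A →ₐ[ℝ] C A := Ideal.Quotient.mkₐ ℝ (lowerOrder A)

theorem C.mk_surjective : Function.Surjective (C.mk (A := A)) := Ideal.Quotient.mk_surjective

theorem C.mk_eq {P Q : Rees A} : C.mk P = C.mk Q ↔ P - Q ∈ lowerOrder A := Ideal.Quotient.eq

/-- The graded commutator `P Q - (-1)^(m m') Q P` of operators `P`, `Q` of degrees `m`, `m'`, which
sends bidegrees `(k, l)`, `(k', l')` to the bidegree `(k + k' - 1, l + l' - 1)`. (For `k = k' = 0`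
it vanishes.) -/
noncomputable def gradedCommutator (P Q : BigradedOp A) : BigradedOp A :=
  P.coeff.sum fun i a => Q.coeff.sum fun j b =>
    AddMonoidAlgebra.single (i.1 + j.1 - 1, i.2 + j.2 - 1)
      (a * b - (-1 : ℝ) ^ ((i.2 - i.1) * (j.2 - j.1)) • (b * a))

theorem gradedCommutator_add_left (P P' Q : BigradedOp A) :
    gradedCommutator (P + P') Q = gradedCommutator P Q + gradedCommutator P' Q := by
  unfold gradedCommutator
  rw [AddMonoidAlgebra.coeff_add, Finsupp.sum_add_index']
  · intro i
    simp
  · intro i a a'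
    rw [← Finsupp.sum_add]
    refine Finsupp.sum_congr fun j _ => ?_
    rw [← AddMonoidAlgebra.single_add, add_mul, mul_add, smul_add]
    congr 1
    abel

theorem gradedCommutator_add_right (P Q Q' : BigradedOp A) :
    gradedCommutator P (Q + Q') = gradedCommutator P Q + gradedCommutator P Q' := by
  unfold gradedCommutator
  rw [← Finsupp.sum_add]
  refine Finsupp.sum_congr fun i _ => ?_
  rw [AddMonoidAlgebra.coeff_add, Finsupp.sum_add_index']
  · intro j
    simp
  · intro j b b'
    rw [← AddMonoidAlgebra.single_add, add_mul, mul_add, smul_add]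
    congr 1
    abel

theorem gradedCommutator_smul_left (c : ℝ) (P Q : BigradedOp A) :
    gradedCommutator (c • P) Q = c • gradedCommutator P Q := by
  unfold gradedCommutator
  rw [AddMonoidAlgebra.coeff_smul, Finsupp.sum_smul_index', Finsupp.smul_sum]
  · refine Finsupp.sum_congr fun i _ => ?_
    rw [Finsupp.smul_sum]
    refine Finsupp.sum_congr fun j _ => ?_
    rw [AddMonoidAlgebra.smul_single, smul_mul_assoc, mul_smul_comm, smul_sub, smul_comm c]
  · intro i
    simp

theorem gradedCommutator_smul_right (c : ℝ) (P Q : BigradedOp A) :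
    gradedCommutator P (c • Q) = c • gradedCommutator P Q := by
  unfold gradedCommutator
  rw [Finsupp.smul_sum]
  refine Finsupp.sum_congr fun i _ => ?_
  rw [AddMonoidAlgebra.coeff_smul, Finsupp.sum_smul_index', Finsupp.smul_sum]
  · refine Finsupp.sum_congr fun j _ => ?_
    rw [AddMonoidAlgebra.smul_single, smul_mul_assoc, mul_smul_comm, smul_sub, smul_comm c]
  · intro i
    simp

theorem scomm_mem_rees {i j : ℕ × ℤ} {P Q : Op A} (hP : P ∈ OrdLT A (i.1 + 1) (i.2 - i.1))
    (hQ : Q ∈ OrdLT A (j.1 + 1) (j.2 - j.1)) :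
    P * Q - (-1 : ℝ) ^ ((i.2 - i.1) * (j.2 - j.1)) • (Q * P) ∈
      OrdLT A (i.1 + j.1 - 1 + 1) (i.2 + j.2 - 1 - (i.1 + j.1 - 1 : ℕ)) := by
  have := ordLT_scomm hP hQ
  by_cases h : i.1 + j.1 = 0
  · rw [h] at this
    rw [mem_ordLT_zero.1 this]
    exact zero_mem _
  · exact ordLT_cast (by omega) (by omega) this

theorem scomm_mem_lower_left {i j : ℕ × ℤ} {P Q : Op A} (hP : P ∈ OrdLT A i.1 (i.2 - i.1))
    (hQ : Q ∈ OrdLT A (j.1 + 1) (j.2 - j.1)) :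
    P * Q - (-1 : ℝ) ^ ((i.2 - i.1) * (j.2 - j.1)) • (Q * P) ∈
      OrdLT A (i.1 + j.1 - 1) (i.2 + j.2 - 1 - (i.1 + j.1 - 1 : ℕ)) := by
  obtain ⟨k, l⟩ := i
  cases k with
  | zero =>
    rw [mem_ordLT_zero.1 hP, mul_zero, zero_mul, smul_zero, sub_zero]; exact zero_mem _
  | succ k =>
    refine ordLT_cast ?_ ?_ (ordLT_scomm hP hQ)
    · omega
    · omega

theorem scomm_mem_lower_right {i j : ℕ × ℤ} {P Q : Op A} (hP : P ∈ OrdLT A (i.1 + 1) (i.2 - i.1))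
    (hQ : Q ∈ OrdLT A j.1 (j.2 - j.1)) :
    P * Q - (-1 : ℝ) ^ ((i.2 - i.1) * (j.2 - j.1)) • (Q * P) ∈
      OrdLT A (i.1 + j.1 - 1) (i.2 + j.2 - 1 - (i.1 + j.1 - 1 : ℕ)) := by
  obtain ⟨k, l⟩ := j
  cases k with
  | zero =>
    rw [mem_ordLT_zero.1 hQ, mul_zero, zero_mul, smul_zero, sub_zero]; exact zero_mem _
  | succ k =>
    refine ordLT_cast ?_ ?_ (ordLT_scomm hP hQ)
    · omega
    · omega

theorem gradedCommutator_coeff_mem (V : ℕ × ℤ → Submodule ℝ (Op A)) {P Q : BigradedOp A}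
    (h : ∀ i j : ℕ × ℤ, P.coeff i * Q.coeff j -
      (-1 : ℝ) ^ ((i.2 - i.1) * (j.2 - j.1)) • (Q.coeff j * P.coeff i) ∈
        V (i.1 + j.1 - 1, i.2 + j.2 - 1)) (k : ℕ × ℤ) :
    (gradedCommutator P Q).coeff k ∈ V k := by
  unfold gradedCommutator
  refine sum_coeff_mem P Q (fun i a j b => AddMonoidAlgebra.single (i.1 + j.1 - 1, i.2 + j.2 - 1)
    (a * b - (-1 : ℝ) ^ ((i.2 - i.1) * (j.2 - j.1)) • (b * a))) (fun i j k => ?_) k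
  exact single_coeff_mem (h i j) k

/-- The graded commutator on the Rees algebra. -/
noncomputable def reesCommutator (P Q : Rees A) : Rees A :=
  ⟨gradedCommutator P.1 Q.1, gradedCommutator_coeff_mem
    (fun i => OrdLT A (i.1 + 1) (i.2 - i.1)) fun i j => scomm_mem_rees (P.2 i) (Q.2 j)⟩

theorem reesCommutator_mem_left {P : Rees A} (hP : P ∈ lowerOrder A) (Q : Rees A) :
    reesCommutator P Q ∈ lowerOrder A :=
  gradedCommutator_coeff_mem (fun i => OrdLT A i.1 (i.2 - i.1))
    fun i j => scomm_mem_lower_left (hP i) (Q.2 j)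

theorem reesCommutator_mem_right (P : Rees A) {Q : Rees A} (hQ : Q ∈ lowerOrder A) :
    reesCommutator P Q ∈ lowerOrder A :=
  gradedCommutator_coeff_mem (fun i => OrdLT A i.1 (i.2 - i.1))
    fun i j => scomm_mem_lower_right (P.2 i) (hQ j)

/-- The graded commutator on the Rees algebra as a bilinear map. -/
noncomputable def reesBracket : Rees A →ₗ[ℝ] Rees A →ₗ[ℝ] Rees A :=
  LinearMap.mk₂ ℝ reesCommutator
    (fun P P' Q => Subtype.ext (gradedCommutator_add_left P.1 P'.1 Q.1))
    (fun c P Q => Subtype.ext (gradedCommutator_smul_left c P.1 Q.1))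
    (fun P Q Q' => Subtype.ext (gradedCommutator_add_right P.1 Q.1 Q'.1))
    (fun c P Q => Subtype.ext (gradedCommutator_smul_right c P.1 Q.1))

/-- The function underlying the Poisson bracket. -/
noncomputable def C.bracketFun (x y : C A) : C A :=
  Quotient.liftOn₂' (s₁ := (lowerOrder A).quotientRel) (s₂ := (lowerOrder A).quotientRel) x y
    (fun P Q => C.mk (reesBracket P Q))
    (fun P Q P' Q' hP hQ => by
      rw [Submodule.quotientRel_def] at hP hQ
      refine C.mk_eq.2 ?_
      have e : reesBracket P Q - reesBracket P' Q' =
          reesBracket (P - P') Q + reesBracket P' (Q - Q') := by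
        rw [map_sub, map_sub, LinearMap.sub_apply]; abel
      rw [e]
      exact add_mem (reesCommutator_mem_left hP Q) (reesCommutator_mem_right P' hQ))

theorem C.bracketFun_mk (P Q : Rees A) : C.bracketFun (C.mk P) (C.mk Q) = C.mk (reesBracket P Q) :=
  rfl

/-- The Poisson bracket `{x, y}` on `C`, of bidegree `(-1, -1)`: it is induced by the graded
commutator of operators. -/
noncomputable def C.bracket : C A →ₗ[ℝ] C A →ₗ[ℝ] C A :=
  LinearMap.mk₂ ℝ C.bracketFun
    (fun x x' y => by
      obtain ⟨P, rfl⟩ := C.mk_surjective x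
      obtain ⟨P', rfl⟩ := C.mk_surjective x'
      obtain ⟨Q, rfl⟩ := C.mk_surjective y
      rw [← map_add C.mk, C.bracketFun_mk, C.bracketFun_mk, C.bracketFun_mk, map_add,
        LinearMap.add_apply, map_add])
    (fun c x y => by
      obtain ⟨P, rfl⟩ := C.mk_surjective x
      obtain ⟨Q, rfl⟩ := C.mk_surjective y
      rw [← map_smul C.mk, C.bracketFun_mk, C.bracketFun_mk, map_smul, LinearMap.smul_apply,
        map_smul])
    (fun x y y' => by
      obtain ⟨P, rfl⟩ := C.mk_surjective x
      obtain ⟨Q, rfl⟩ := C.mk_surjective y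
      obtain ⟨Q', rfl⟩ := C.mk_surjective y'
      rw [← map_add C.mk, C.bracketFun_mk, C.bracketFun_mk, C.bracketFun_mk, map_add, map_add])
    (fun c x y => by
      obtain ⟨P, rfl⟩ := C.mk_surjective x
      obtain ⟨Q, rfl⟩ := C.mk_surjective y
      rw [← map_smul C.mk, C.bracketFun_mk, C.bracketFun_mk, map_smul, map_smul])

/-- The principal symbol of bidegree `(k, l)` of an operator of order at most `k` and degree
`l - k`. -/
noncomputable def symbol (k : ℕ) (l : ℤ) : OrdLT A (k + 1) (l - k) →ₗ[ℝ] C A where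
  toFun P := C.mk ⟨AddMonoidAlgebra.single (k, l) P.1,
    single_coeff_mem (V := fun i => OrdLT A (i.1 + 1) (i.2 - i.1)) P.2⟩
  map_add' P Q := by
    rw [← map_add]
    exact congrArg C.mk (Subtype.ext (AddMonoidAlgebra.single_add (k, l) P.1 Q.1))
  map_smul' c P := by
    rw [RingHom.id_apply, ← map_smul]
    exact congrArg C.mk (Subtype.ext (AddMonoidAlgebra.smul_single c (k, l) P.1).symm)

variable (A) in
/-- The component of `C` of bidegree `(k, l)`. (It vanishes for `l < 0`.) -/
noncomputable def bideg (k : ℕ) (l : ℤ) : Submodule ℝ (C A) := LinearMap.range (symbol k l)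

variable (A) in
/-- The elements of `C` of total weight `w`: the sum of the components with `k + l = w`. -/
noncomputable def weight (w : ℤ) : Submodule ℝ (C A) :=
  ⨆ (k : ℕ) (l : ℤ) (_ : k + l = w), bideg A k l

variable (A) in
/-- The filtration `F^p` of `C` by the second degree: the sum of the components with `l ≥ p`.
For `p = 1` it is the ideal generated by the coordinates `ξ^i`, `p_i`, that is, the ideal of
functions that vanish on the Lagrangian submanifold `L^*` on which `ξ = p = 0`. -/
noncomputable def filtration (p : ℤ) : Submodule ℝ (C A) :=
  ⨆ (k : ℕ) (l : ℤ) (_ : p ≤ l), bideg A k l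

/-- The function `f` on the base, as an element of `C` of bidegree `(0, 0)`. -/
noncomputable def fn (f : A) : C A :=
  symbol 0 0 ⟨opFun f, opFun_mem f⟩

/-- The vector field `X`, as an element of `C` of bidegree `(1, 0)`: the symbol of `ι_X`. -/
noncomputable def vec (X : VectorField A) : C A :=
  symbol 1 0 ⟨opContract X, opContract_mem X⟩

variable (A) in
/-- The function `h_d` of bidegree `(1, 2)` given by the de Rham differential: the symbol of `d`. -/
noncomputable def hd : C A := symbol 1 2 ⟨opDeRham, opDeRham_mem⟩

theorem exists_formOp {l : ℕ} (η : DiffForm A l) :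
    ∃ T : OrdLT A (0 + 1) ((l : ℤ) - (0 : ℕ)), (T.1 (DiffForms.one A)).1 = η.1 := by
  obtain ⟨T, h1, h2, -⟩ := exists_mulForm η.2
  refine ⟨⟨T, ?_⟩, h2⟩
  rw [Nat.cast_zero, sub_zero]
  exact h1

/-- The `l`-form `η`, as an element of `C` of bidegree `(0, l)`: the symbol of the operator `η ∧`,
which is the operator of order zero that sends `1` to `η`. -/
noncomputable def form {l : ℕ} (η : DiffForm A l) : C A := symbol 0 l (exists_formOp η).choose

/-- The contraction with multivector fields, `ι_{X ∧ Y ∧ ⋯} = ι_X ι_Y ⋯`. -/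
def contractMulti : ExteriorAlgebra A (VectorField A) →ₐ[A] Module.End A (Forms A) :=
  ExteriorAlgebra.lift A
    ⟨{ toFun := contract
       map_add' := fun X Y => LinearMap.ext fun η => funext fun k => map_add (η (k + 1)).curryLeft X Y
       map_smul' := fun f X => LinearMap.ext fun η => funext fun k =>
        map_smul (η (k + 1)).curryLeft f X },
      fun X => LinearMap.ext fun η => funext fun k => AlternatingMap.curryLeft_same (η (k + 2)) X⟩

theorem contractMulti_mem (π : ExteriorAlgebra A (VectorField A)) {x : Forms A}
    (hx : x ∈ Omega A) : contractMulti π x ∈ Omega A := by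
  induction π using ExteriorAlgebra.induction generalizing x with
  | algebraMap f =>
    rw [AlgHom.commutes]
    exact Submodule.smul_mem _ f hx
  | ι X =>
    rw [contractMulti, ExteriorAlgebra.lift_ι_apply]
    exact contract_mem X hx
  | mul π ρ h1 h2 =>
    rw [map_mul]
    exact h1 (h2 hx)
  | add π ρ h1 h2 =>
    rw [map_add]
    exact add_mem (h1 hx) (h2 hx)

/-- The contraction with a multivector field as an operator on `Ω`. -/
def opMulti (π : ExteriorAlgebra A (VectorField A)) : Op A where
  toFun x := ⟨contractMulti π x.1, contractMulti_mem π x.2⟩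
  map_add' x y := Subtype.ext (map_add (contractMulti π) x.1 y.1)
  map_smul' c x := Subtype.ext ((contractMulti π).map_smul_of_tower c x.1)

variable (A) in
/-- Bivector fields. -/
abbrev Bivector : Type _ := ⋀[A]^2 (VectorField A)

theorem opMulti_mem (π : Bivector A) : opMulti π.1 ∈ OrdLT A (2 + 1) (0 - (2 : ℕ)) := by
  obtain ⟨π, hπ⟩ := π
  have h : π ∈ LinearMap.range (ExteriorAlgebra.ι A) ^ 2 := hπ
  rw [pow_two] at h
  induction h using Submodule.mul_induction_on' with
  | mem_mul_mem x hx y hy =>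
    obtain ⟨X, rfl⟩ := hx
    obtain ⟨Y, rfl⟩ := hy
    have e : opMulti (ExteriorAlgebra.ι A X * ExteriorAlgebra.ι A Y) =
        opContract X * opContract Y := by
      refine LinearMap.ext fun x => Subtype.ext ?_
      change contractMulti _ _ = contract X (contract Y x.1)
      rw [map_mul, contractMulti, ExteriorAlgebra.lift_ι_apply, ExteriorAlgebra.lift_ι_apply]
      rfl
    change opMulti (ExteriorAlgebra.ι A X * ExteriorAlgebra.ι A Y) ∈ _
    rw [e]
    exact ordLT_mul (opContract_mem X) (opContract_mem Y)
  | add x hx y hy h1 h2 =>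
    have e : opMulti (x + y) = opMulti x + opMulti y :=
      LinearMap.ext fun z => Subtype.ext (by
        change contractMulti (x + y) z.1 = contractMulti x z.1 + contractMulti y z.1
        rw [map_add]; rfl)
    change opMulti (x + y) ∈ _
    rw [e]
    exact add_mem (h1 (by
        change _ ∈ LinearMap.range (ExteriorAlgebra.ι A) ^ 2
        rw [pow_two]; exact hx))
      (h2 (by
        change _ ∈ LinearMap.range (ExteriorAlgebra.ι A) ^ 2
        rw [pow_two]; exact hy))

/-- The bivector field `π`, as an element of `C` of bidegree `(2, 0)`. -/
noncomputable def bivec (π : Bivector A) : C A := symbol 2 0 ⟨opMulti π.1, opMulti_mem π⟩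

end SymbolAlgebra
end TwistedPoisson

namespace TwistedPoisson
section Gauge
variable {A : Type*} [CommRing A] [Algebra ℝ A]

/-- A `1`-form as a linear functional on vector fields. -/
def AltForm.toDual : AltForm A 1 →ₗ[A] Module.Dual A (VectorField A) where
  toFun η :=
    { toFun := fun X => η.curryLeft X ![]
      map_add' := fun X Y => by rw [map_add]; rfl
      map_smul' := fun f X => by rw [map_smul]; rfl }
  map_add' _ _ := rfl
  map_smul' _ _ := rfl

/-- The map `η~`, `η~(X)(Y) = η(X, Y)`, from vector fields to `1`-forms, of a `2`-form `η`. -/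
def flat (η : DiffForm A 2) : VectorField A →ₗ[A] Module.Dual A (VectorField A) :=
  AltForm.toDual ∘ₗ (η.1 2).curryLeft

/-- The map `π~`, `π~(α)(β) = π(α, β)`, from `1`-forms to vector fields, of a bivector field `π`:
the contraction `α ⌋ π`, so that `π~(α) = α(X) Y - α(Y) X` for `π = X ∧ Y`. -/
noncomputable def sharp (π : Bivector A) : Module.Dual A (VectorField A) →ₗ[A] VectorField A :=
  ExteriorAlgebra.ιInv ∘ₗ
    { toFun := fun α => CliffordAlgebra.contractLeft α π.1
      map_add' := fun α β => by rw [map_add]; rfl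
      map_smul' := fun f α => by rw [map_smul]; rfl }

/-- `T(π, η) = 1 + π~ η~`. -/
noncomputable def T (π : Bivector A) (η : DiffForm A 2) : Module.End A (VectorField A) :=
  1 + sharp π ∘ₗ flat η

/-- `π' = τ_η π`, that is, `π'~ = π~ (1 + η~ π~)⁻¹`. -/
def IsTauBivector (η : DiffForm A 2) (π π' : Bivector A) : Prop :=
  sharp π' = sharp π ∘ₗ Ring.inverse (1 + flat η ∘ₗ sharp π : Module.End A _)

/-- `η' = τ_π η`, that is, `η'~ = η~ (1 + π~ η~)⁻¹`. -/
def IsTauForm (π : Bivector A) (η η' : DiffForm A 2) : Prop :=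
  flat η' = flat η ∘ₗ Ring.inverse (T π η)

/-- `exp X_a`, where `X_a = {a, ·}`. For `a` a bivector field or a `2`-form, `X_a` is locally
nilpotent, and the sum is finite. -/
noncomputable def twist (a x : C A) : C A :=
  ∑ᶠ n : ℕ, ((n.factorial : ℝ)⁻¹) • (C.bracket a ^ n) x

/-- `Θ_{φ,π} = exp X_π (h_d + φ)`. -/
noncomputable def Theta (φ : DiffForm A 3) (π : Bivector A) : C A :=
  twist (bivec π) (hd A + form φ)

/-- The component `μ_π = h_d + {π, φ}` of `Θ_{φ,π}` of bidegree `(1, 2)`. -/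
noncomputable def muTwist (φ : DiffForm A 3) (π : Bivector A) : C A :=
  hd A + C.bracket (bivec π) (form φ)

/-- The component `γ_π = {π, h_d} + ½ {π, {π, φ}}` of `Θ_{φ,π}` of bidegree `(2, 1)`. -/
noncomputable def gammaTwist (φ : DiffForm A 3) (π : Bivector A) : C A :=
  C.bracket (bivec π) (hd A) + (2⁻¹ : ℝ) • C.bracket (bivec π) (C.bracket (bivec π) (form φ))

/-- A `1`-form as a linear functional on vector fields. -/
def DiffForm.toDual (α : DiffForm A 1) : Module.Dual A (VectorField A) :=
  AltForm.toDual (A := A) (α.1 1)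

/-- The Schouten bracket `[π, π] = {{π, h_d}, π}`. -/
noncomputable def schoutenSelf (π : Bivector A) : C A :=
  C.bracket (C.bracket (bivec π) (hd A)) (bivec π)

/-- The value `P(α, β, γ) = {{{P, γ}, β}, α}` of a trivector field `P` on `1`-forms. For
`P = X ∧ Y ∧ Z` this is the determinant of the matrix of the pairings of `α, β, γ` with
`X, Y, Z`. -/
noncomputable def evalTrivector (P : C A) (α β γ : DiffForm A 1) : C A :=
  C.bracket (C.bracket (C.bracket P (form γ)) (form β)) (form α)

/-- `π` is a `φ`-Poisson structure: `dφ = 0` and `½ [π, π] = (∧³ π~) φ`, where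
`((∧³ π~) φ)(α, β, γ) = φ(π~ α, π~ β, π~ γ)`. -/
def IsTwistedPoisson (φ : DiffForm A 3) (π : Bivector A) : Prop :=
  φ.d = 0 ∧ ∀ α β γ : DiffForm A 1,
    (2⁻¹ : ℝ) • evalTrivector (schoutenSelf π) α β γ =
      fn (φ.1 3 ![sharp π α.toDual, sharp π β.toDual, sharp π γ.toDual])

/-- `(μ, γ, φ)` is a quasi-Lie bialgebroid structure on `(TM, T^*M)`: functions of bidegrees
`(1, 2)`, `(2, 1)`, `(0, 3)` such that `μ + γ + φ` commutes with itself. -/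
structure IsQuasiLieBialgebroid (μ γ φ : C A) : Prop where
  mu_mem : μ ∈ bideg A 1 2
  gamma_mem : γ ∈ bideg A 2 1
  phi_mem : φ ∈ bideg A 0 3
  mu_mu : (2⁻¹ : ℝ) • C.bracket μ μ + C.bracket γ φ = 0
  gamma_gamma : C.bracket γ γ = 0
  mu_gamma : C.bracket μ γ = 0
  mu_phi : C.bracket μ φ = 0

/-- Gauge transformations: automorphisms of the graded Poisson algebra `C` which preserve the total
weight and are trivial on the base. -/
structure IsGauge (Φ : C A ≃ₐ[ℝ] C A) : Prop where
  map_bracket : ∀ x y, Φ (C.bracket x y) = C.bracket (Φ x) (Φ y)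
  map_weight : ∀ w x, Φ x ∈ weight A w ↔ x ∈ weight A w
  map_fn : ∀ f : A, Φ (fn f) = fn f

/-- `Φ` preserves `L^*`, that is, the ideal of functions vanishing on it. -/
def PreservesLstar (Φ : C A ≃ₐ[ℝ] C A) : Prop :=
  ∀ x, Φ x ∈ filtration A 1 ↔ x ∈ filtration A 1

/-- `Ψ = F^*_g` is the canonical lift of the bundle automorphism `g` of `TM`: the gauge transformation
which preserves bidegrees and sends a vector field `X` to `g X`. -/
structure IsLift (g : Module.End A (VectorField A)) (Ψ : C A ≃ₐ[ℝ] C A) : Prop where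
  isGauge : IsGauge Ψ
  map_bideg : ∀ k l x, Ψ x ∈ bideg A k l ↔ x ∈ bideg A k l
  map_vec : ∀ X, Ψ (vec X) = vec (g X)

/-- The quasi-Lie bialgebroids `(μ, γ, φ)` and `(μ', γ', φ')` are isomorphic: a gauge transformation
which preserves `L^*` sends `μ + γ + φ` to `μ' + γ' + φ'`. -/
def QuasiLieBialgebroidIso (μ γ φ μ' γ' φ' : C A) : Prop :=
  ∃ Φ : C A ≃ₐ[ℝ] C A, IsGauge Φ ∧ PreservesLstar Φ ∧ Φ (μ + γ + φ) = μ' + γ' + φ'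

/-- `Z_r^p` in weight `n`: the elements `x` of `F^p` of total weight `n` with `{Θ, x} ∈ F^(p+r)`. -/
noncomputable def cycles (Θ : C A) (r p n : ℤ) : Submodule ℝ (C A) :=
  filtration A p ⊓ weight A n ⊓ (filtration A (p + r)).comap (C.bracket Θ)

/-- `Z_(r-1)^(p+1) + {Θ, Z_(r-1)^(p-r+1)}` in weight `n`. -/
noncomputable def boundaries (Θ : C A) (r p n : ℤ) : Submodule ℝ (C A) :=
  cycles Θ (r - 1) (p + 1) n ⊔ (cycles Θ (r - 1) (p - r + 1) (n - 1)).map (C.bracket Θ)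

/-- The entry `E_r^p` in weight `n` of the spectral sequence of the filtered complex
`(C, {Θ, ·}, F)`. -/
abbrev Page (Θ : C A) (r : ℕ) (p n : ℤ) : Type _ :=
  cycles Θ r p n ⧸ (boundaries Θ r p n).comap (cycles Θ r p n).subtype

/-- The class in `E_r^p` of an element of `Z_r^p`. -/
noncomputable def Page.mk (Θ : C A) {r : ℕ} {p n : ℤ} {x : C A} (hx : x ∈ cycles Θ r p n) :
    Page Θ r p n := Submodule.Quotient.mk ⟨x, hx⟩

/-- Isomorphisms of the spectral sequences of `(C, {Θ, ·}, F)` and `(C, {Θ', ·}, F)`: linear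
isomorphisms of all pages which commute with the differentials `d_r [x] = [{Θ, x}]` and with the
identifications of `E_(r+1)` with the cohomology of `E_r`, by which the class in `E_(r+1)` of
`x ∈ Z_(r+1)` is the cohomology class of the class of `x` in `E_r`. -/
structure SpectralIso (Θ Θ' : C A) where
  equiv : ∀ (r : ℕ) (p n : ℤ), Page Θ r p n ≃ₗ[ℝ] Page Θ' r p n
  differential : ∀ (r : ℕ) (p n : ℤ) (x : C A) (hx : x ∈ cycles Θ r p n),
    ∃ (hd : C.bracket Θ x ∈ cycles Θ r (p + r) (n + 1)) (x' : C A) (hx' : x' ∈ cycles Θ' r p n)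
      (hd' : C.bracket Θ' x' ∈ cycles Θ' r (p + r) (n + 1)),
      equiv r p n (Page.mk Θ hx) = Page.mk Θ' hx' ∧
        equiv r (p + r) (n + 1) (Page.mk Θ hd) = Page.mk Θ' hd'
  next : ∀ (r : ℕ) (p n : ℤ) (x : C A) (hx : x ∈ cycles Θ r p n)
    (hy : x ∈ cycles Θ (r + 1 : ℕ) p n),
    ∃ (x' : C A) (hx' : x' ∈ cycles Θ' r p n) (hy' : x' ∈ cycles Θ' (r + 1 : ℕ) p n),
      equiv r p n (Page.mk Θ hx) = Page.mk Θ' hx' ∧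
        equiv (r + 1) p n (Page.mk Θ hy) = Page.mk Θ' hy'

/-- The `k`-vector fields closed under the Poisson differential `{γ_π, ·}`. -/
noncomputable def poissonCocycles (φ : DiffForm A 3) (π : Bivector A) (k : ℕ) :
    Submodule ℝ (C A) :=
  bideg A k 0 ⊓ LinearMap.ker (C.bracket (gammaTwist φ π))

/-- The `k`-vector fields exact under the Poisson differential `{γ_π, ·}`. -/
noncomputable def poissonCoboundaries (φ : DiffForm A 3) (π : Bivector A) (k : ℕ) :
    Submodule ℝ (C A) :=
  ⨆ (j : ℕ) (_ : j + 1 = k), (bideg A j 0).map (C.bracket (gammaTwist φ π))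

/-- The Poisson cohomology in degree `k` of a `φ`-Poisson structure `π`: the cohomology of multivector
fields with the differential `{γ_π, ·}`. -/
abbrev PoissonCohomology (φ : DiffForm A 3) (π : Bivector A) (k : ℕ) : Type _ :=
  poissonCocycles φ π k ⧸ (poissonCoboundaries φ π k).comap (poissonCocycles φ π k).subtype

/-- `(φ', π')` is obtained from `(φ, π)` by the gauge transformation by a `2`-form `η` for which
`T(-π, η) = 1 - π~ η~` is invertible: `φ' = φ - dη` and `π' = τ_{-η} π`. -/
def GaugeEquivalent (φ : DiffForm A 3) (π : Bivector A) (φ' : DiffForm A 3) (π' : Bivector A) :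
    Prop :=
  ∃ η : DiffForm A 2, IsUnit (T (-π) η) ∧ φ' = φ - η.d ∧ IsTauBivector (-η) π π'

end Gauge
end TwistedPoisson

open scoped Manifold ContDiff in
/-- The algebra of smooth real functions on `M`. -/
abbrev TwistedPoisson.SmoothFun (n : ℕ) (M : Type*) [TopologicalSpace M]
    [ChartedSpace (EuclideanSpace ℝ (Fin n)) M] : Type _ :=
  ContMDiffMap (𝓡 n) 𝓘(ℝ) M ℝ ∞

open scoped Manifold ContDiff
open TwistedPoisson

/-! Everything rests on one identity between automorphisms of the Poisson algebra `C`,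
`liftInvT_twist_twist`: F_{T⁻¹} ∘ exp X_{η'} ∘ exp X_π = exp X_{π'} ∘ exp X_η, where T = 1 - π~ η~,
η' = τ_{-π} η and π' = τ_{-η} π. On TM ⊕ T^*M the exponential of π acts by α ↦ α - π~ α and that of
η by X ↦ X - η~ X, so the identity is a factorisation of a product of two unipotent block matrices
in the opposite order, with T⁻¹ as the block-diagonal correction. Since exp X_η (h_d + φ) = h_d + φ
- dη, applying both sides to h_d + φ gives Φ Θ_{φ,π} = Θ_{φ-dη,π'}.

That it suffices to compare automorphisms on TM ⊕ T^*M is a rigidity statement,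
`IsPoissonEnd.eq_id`: a linear map which preserves brackets and weights and fixes all f, dg and X is
the identity. It is proved from the definition of the order of a differential operator and needs no
coordinates; the whole argument works over an arbitrary commutative ℝ-algebra `A`. The price is that
τ_{-η} π and τ_{-π} η must be shown to be a bivector field and a form spanned by products of
differentials; closed formulas and the finite rank of η~ give this.

For the Poisson condition, Θ_{φ,π} is sorted by bidegree into φ, μ_π, γ_π and a trivector ψ, and π
is φ-Poisson exactly when dφ = 0 and ψ = 0 (`isTwistedPoisson_iff`). The exponential of a 2-form
only adds terms of lower order in the momenta, and the lift Ψ = F_{T⁻¹} preserves bidegrees. Hence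
the component of highest order is transported by Ψ alone: ψ' = Ψ ψ, so the Poisson condition is
preserved, and if ψ = 0 then γ' = Ψ γ, which yields the isomorphism of Poisson cohomologies.

Finally Φ preserves the bracket, the weight and every F^p and maps Θ to Θ', so it induces
isomorphisms of the spectral sequences and of the quasi-Lie bialgebroids. The bialgebroid equations
are the bidegree components of {Θ, Θ} = 0, which follows from d² = 0 and dφ = 0. -/

namespace TwistedPoisson
-- Principal symbols, bidegrees and projections to homogeneous components.
section Symbols
variable {A : Type*} [CommRing A] [Algebra ℝ A]

variable (A) in
/-- Operators of degree `m` and of order at most `k`, for an integer `k`. -/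
noncomputable def Ord (k m : ℤ) : Submodule ℝ (Op A) := OrdLT A (k + 1).toNat m

/-- Integer orders make the index `k + k' - 1` of a bracket exact: every negative order gives the
zero space, so the truncated subtraction of natural numbers never has to be discussed again. -/
theorem ord_natCast (k : ℕ) (m : ℤ) : Ord A k m = OrdLT A (k + 1) m := by
  unfold Ord; congr 1

theorem ord_natCast_sub_one (k : ℕ) (m : ℤ) : Ord A (k - 1) m = OrdLT A k m := by
  unfold Ord; congr 1; omega

theorem eq_zero_of_mem_ord {k m : ℤ} (hk : k < 0) {P : Op A} (hP : P ∈ Ord A k m) : P = 0 := by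
  unfold Ord at hP
  rwa [Int.toNat_of_nonpos (by omega), mem_ordLT_zero] at hP

theorem ord_cast {k k' m m' : ℤ} {P : Op A} (h1 : k = k') (h2 : m = m') (h : P ∈ Ord A k m) :
    P ∈ Ord A k' m' := by
  rwa [← h1, ← h2]

theorem ord_mul {k k' m m' : ℤ} {P Q : Op A} (hP : P ∈ Ord A k m) (hQ : Q ∈ Ord A k' m') :
    P * Q ∈ Ord A (k + k') (m + m') := by
  by_cases hk : k < 0
  · rw [eq_zero_of_mem_ord hk hP, zero_mul]; exact zero_mem _
  by_cases hk' : k' < 0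
  · rw [eq_zero_of_mem_ord hk' hQ, mul_zero]; exact zero_mem _
  lift k to ℕ using by omega
  lift k' to ℕ using by omega
  rw [ord_natCast] at hP hQ
  rw [← Nat.cast_add, ord_natCast]
  exact ordLT_cast (by omega) rfl (ordLT_mul hP hQ)

/-- The graded commutator of operators of degrees `m` and `m'`. -/
noncomputable def opComm (m m' : ℤ) (P Q : Op A) : Op A := P * Q - (-1 : ℝ) ^ (m * m') • (Q * P)

theorem ord_opComm {k k' m m' : ℤ} {P Q : Op A} (hP : P ∈ Ord A k m) (hQ : Q ∈ Ord A k' m') :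
    opComm m m' P Q ∈ Ord A (k + k' - 1) (m + m') := by
  unfold opComm
  by_cases hk : k < 0
  · rw [eq_zero_of_mem_ord hk hP, zero_mul, mul_zero, smul_zero, sub_zero]; exact zero_mem _
  by_cases hk' : k' < 0
  · rw [eq_zero_of_mem_ord hk' hQ, zero_mul, mul_zero, smul_zero, sub_zero]; exact zero_mem _
  lift k to ℕ using by omega
  lift k' to ℕ using by omega
  rw [ord_natCast] at hP hQ
  rw [← Nat.cast_add, ord_natCast_sub_one]
  exact ordLT_scomm hP hQ

theorem single_mem_rees {k l : ℤ} {P : Op A} (hP : P ∈ Ord A k (l - k)) :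
    AddMonoidAlgebra.single (k.toNat, l) P ∈ Rees A := by
  refine single_coeff_mem (V := fun i => OrdLT A (i.1 + 1) (i.2 - i.1)) ?_
  by_cases hk : k < 0
  · rw [eq_zero_of_mem_ord hk hP]; exact zero_mem _
  lift k to ℕ using by omega
  rw [ord_natCast] at hP
  exact hP

open Classical in
/-- The principal symbol of bidegree `(k, l)` of an operator of order at most `k` and degree
`l - k` (and `0` for other operators). -/
noncomputable def sym (k l : ℤ) (P : Op A) : C A :=
  if h : P ∈ Ord A k (l - k) then C.mk ⟨_, single_mem_rees h⟩ else 0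

theorem sym_of_mem {k l : ℤ} {P : Op A} (h : P ∈ Ord A k (l - k)) :
    sym k l P = C.mk ⟨_, single_mem_rees h⟩ := dif_pos h

theorem symbol_eq_sym (k : ℕ) (l : ℤ) (P : OrdLT A (k + 1) (l - k)) :
    symbol k l P = sym k l P.1 := by
  rw [sym_of_mem (by rw [ord_natCast]; exact P.2)]
  rfl

theorem sym_zero (k l : ℤ) : sym k l (0 : Op A) = 0 := by
  rw [sym_of_mem (zero_mem _), ← map_zero C.mk]
  exact congrArg C.mk (Subtype.ext (AddMonoidAlgebra.single_zero _))

theorem sym_add {k l : ℤ} {P Q : Op A} (hP : P ∈ Ord A k (l - k)) (hQ : Q ∈ Ord A k (l - k)) :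
    sym k l (P + Q) = sym k l P + sym k l Q := by
  rw [sym_of_mem hP, sym_of_mem hQ, sym_of_mem (add_mem hP hQ), ← map_add]
  exact congrArg C.mk (Subtype.ext (AddMonoidAlgebra.single_add _ _ _))

theorem sym_smul {k l : ℤ} {P : Op A} (hP : P ∈ Ord A k (l - k)) (c : ℝ) :
    sym k l (c • P) = c • sym k l P := by
  rw [sym_of_mem hP, sym_of_mem (Submodule.smul_mem _ c hP), ← map_smul]
  exact congrArg C.mk (Subtype.ext (AddMonoidAlgebra.smul_single _ _ _).symm)

theorem sym_neg {k l : ℤ} {P : Op A} (hP : P ∈ Ord A k (l - k)) :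
    sym k l (-P) = -sym k l P := by
  rw [← neg_one_smul ℝ, sym_smul hP, neg_one_smul]

theorem sym_of_neg {k l : ℤ} (hk : k < 0) {P : Op A} (hP : P ∈ Ord A k (l - k)) :
    sym k l P = 0 := by
  rw [eq_zero_of_mem_ord hk hP, sym_zero]

theorem ord_mul_sym {k k' l l' : ℤ} {P Q : Op A} (hP : P ∈ Ord A k (l - k))
    (hQ : Q ∈ Ord A k' (l' - k')) : P * Q ∈ Ord A (k + k') (l + l' - (k + k')) :=
  ord_cast rfl (by ring) (ord_mul hP hQ)

theorem sym_mul {k k' l l' : ℤ} {P Q : Op A} (hP : P ∈ Ord A k (l - k))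
    (hQ : Q ∈ Ord A k' (l' - k')) : sym k l P * sym k' l' Q = sym (k + k') (l + l') (P * Q) := by
  by_cases hk : k < 0
  · rw [eq_zero_of_mem_ord hk hP, zero_mul, sym_zero, sym_zero, zero_mul]
  by_cases hk' : k' < 0
  · rw [eq_zero_of_mem_ord hk' hQ, mul_zero, sym_zero, sym_zero, mul_zero]
  rw [sym_of_mem hP, sym_of_mem hQ, sym_of_mem (ord_mul_sym hP hQ), ← map_mul]
  refine congrArg C.mk (Subtype.ext ?_)
  refine (AddMonoidAlgebra.single_mul_single _ _ _ _).trans ?_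
  change _ = AddMonoidAlgebra.single _ _
  rw [Prod.mk_add_mk, Int.toNat_add (by omega) (by omega)]

theorem ord_opComm_sym {k k' l l' : ℤ} {P Q : Op A} (hP : P ∈ Ord A k (l - k))
    (hQ : Q ∈ Ord A k' (l' - k')) :
    opComm (l - k) (l' - k') P Q ∈ Ord A (k + k' - 1) (l + l' - 1 - (k + k' - 1)) :=
  ord_cast rfl (by ring) (ord_opComm hP hQ)

/-- This turns identities of brackets into identities of graded commutators. For `k = k' = 0` the
index on the right is `-1`, where `gradedCommutator` uses the truncated value `0`; the commutator
vanishes there, so both agree. -/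
theorem bracket_sym {k k' l l' : ℤ} {P Q : Op A} (hP : P ∈ Ord A k (l - k))
    (hQ : Q ∈ Ord A k' (l' - k')) : C.bracket (sym k l P) (sym k' l' Q) =
      sym (k + k' - 1) (l + l' - 1) (opComm (l - k) (l' - k') P Q) := by
  have hc := ord_opComm_sym hP hQ
  by_cases hk : k < 0
  · rw [sym_of_neg hk hP, eq_zero_of_mem_ord hk hP, map_zero, opComm]
    simp [sym_zero]
  by_cases hk' : k' < 0
  · rw [sym_of_neg hk' hQ, eq_zero_of_mem_ord hk' hQ, map_zero, opComm]
    simp [sym_zero]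
  rw [sym_of_mem hP, sym_of_mem hQ, sym_of_mem hc]
  refine (C.bracketFun_mk _ _).trans (congrArg C.mk (Subtype.ext ?_))
  change gradedCommutator _ _ = _
  lift k to ℕ using by omega
  lift k' to ℕ using by omega
  unfold gradedCommutator opComm
  rw [AddMonoidAlgebra.coeff_single, AddMonoidAlgebra.coeff_single, Finsupp.sum_single_index,
    Finsupp.sum_single_index]
  · congr 2
    simp only [Int.toNat_natCast]
    omega
  · simp
  · simp

theorem sym_eq_zero {k l : ℤ} {P : Op A} (h : P ∈ Ord A (k - 1) (l - k)) : sym k l P = 0 := by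
  by_cases hk : k < 0
  · rw [eq_zero_of_mem_ord (by omega) h, sym_zero]
  lift k to ℕ using by omega
  have hP : P ∈ Ord A k (l - k) := by
    rw [ord_natCast]; rw [ord_natCast_sub_one] at h; exact ordLT_le_succ _ _ h
  rw [sym_of_mem hP, ← map_zero C.mk, C.mk_eq, sub_zero]
  refine single_coeff_mem (V := fun i => OrdLT A i.1 (i.2 - i.1)) ?_
  rwa [ord_natCast_sub_one] at h

/-- With `sym_eq_zero`, the kernel of the symbol map is exactly the space of operators of smaller
order. This is how the vanishing of brackets is translated back into a bound on orders. -/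
theorem mem_of_sym_eq_zero {k l : ℤ} {P : Op A} (hP : P ∈ Ord A k (l - k)) (h : sym k l P = 0) :
    P ∈ Ord A (k - 1) (l - k) := by
  by_cases hk : k < 0
  · rw [eq_zero_of_mem_ord hk hP]; exact zero_mem _
  lift k to ℕ using by omega
  rw [sym_of_mem hP, ← map_zero C.mk, C.mk_eq, sub_zero] at h
  have := h (k, l)
  rw [ord_natCast_sub_one]
  simpa using this

variable (A) in
/-- The component of bidegree `(k, l)`, for integers `k`, `l`. -/
noncomputable def gr (k l : ℤ) : Submodule ℝ (C A) where
  carrier := {x | ∃ P ∈ Ord A k (l - k), sym k l P = x}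
  add_mem' := by
    rintro _ _ ⟨P, hP, rfl⟩ ⟨Q, hQ, rfl⟩
    exact ⟨P + Q, add_mem hP hQ, sym_add hP hQ⟩
  zero_mem' := ⟨0, zero_mem _, sym_zero k l⟩
  smul_mem' := by
    rintro c _ ⟨P, hP, rfl⟩
    exact ⟨c • P, Submodule.smul_mem _ c hP, sym_smul hP c⟩

theorem sym_mem_gr {k l : ℤ} {P : Op A} (h : P ∈ Ord A k (l - k)) : sym k l P ∈ gr A k l :=
  ⟨P, h, rfl⟩

theorem bideg_eq_gr (k : ℕ) (l : ℤ) : bideg A k l = gr A k l := by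
  ext x
  constructor
  · rintro ⟨P, rfl⟩
    rw [symbol_eq_sym]
    exact sym_mem_gr (by rw [ord_natCast]; exact P.2)
  · rintro ⟨P, hP, rfl⟩
    rw [ord_natCast] at hP
    exact ⟨⟨P, hP⟩, symbol_eq_sym k l _⟩

theorem gr_cast {k k' l l' : ℤ} (h1 : k = k') (h2 : l = l') {x : C A} (h : x ∈ gr A k l) :
    x ∈ gr A k' l' := by rwa [← h1, ← h2]

theorem eq_zero_of_mem_gr {k l : ℤ} (hk : k < 0) {x : C A} (hx : x ∈ gr A k l) : x = 0 := by
  obtain ⟨P, hP, rfl⟩ := hx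
  exact sym_of_neg hk hP

theorem bracket_mem_gr {k k' l l' : ℤ} {x y : C A} (hx : x ∈ gr A k l) (hy : y ∈ gr A k' l') :
    C.bracket x y ∈ gr A (k + k' - 1) (l + l' - 1) := by
  obtain ⟨P, hP, rfl⟩ := hx
  obtain ⟨Q, hQ, rfl⟩ := hy
  rw [bracket_sym hP hQ]
  exact sym_mem_gr (ord_opComm_sym hP hQ)

/-- Operators of order at most `k` lower the degree by at most `k`. -/
theorem ord_eq_zero_of_degree (k : ℕ) {m : ℤ} (hm : m < -k) {P : Op A}
    (hP : P ∈ OrdLT A (k + 1) m) : P = 0 := by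
  induction k generalizing m P with
  | zero =>
    refine op_ext_of_order_zero hP (Subtype.ext (funext fun j => ?_))
    refine ordLT_degree hP 0 (DiffForms.one A) (fun i hi => ?_) j (by push_cast at *; omega)
    cases i with
    | zero => exact absurd rfl hi
    | succ i => rfl
  | succ k ih =>
    have h := mem_ordLT_succ.1 hP
    -- The commutators of P with f and dg have order at most k and degree m or m + 1, still less
    -- than -k, so they vanish by induction. Hence P has order zero, and its value at 1 would have
    -- negative degree.
    have h1 : P ∈ OrdLT A 1 m := by
      refine mem_ordLT_succ.2 ⟨h.1, fun f => ?_, fun g => ?_⟩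
      · rw [ih (by push_cast at *; omega) (h.2.1 f)]; exact zero_mem _
      · rw [ih (by push_cast at *; omega) (h.2.2 g)]; exact zero_mem _
    refine op_ext_of_order_zero h1 (Subtype.ext (funext fun j => ?_))
    refine ordLT_degree h1 0 (DiffForms.one A) (fun i hi => ?_) j (by push_cast at *; omega)
    cases i with
    | zero => exact absurd rfl hi
    | succ i => rfl

theorem eq_zero_of_mem_gr' {k l : ℤ} (hl : l < 0) {x : C A} (hx : x ∈ gr A k l) : x = 0 := by
  by_cases hk : k < 0
  · exact eq_zero_of_mem_gr hk hx
  lift k to ℕ using by omega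
  obtain ⟨P, hP, rfl⟩ := hx
  rw [ord_natCast] at hP
  rw [ord_eq_zero_of_degree k (by omega) hP, sym_zero]

theorem C_sum_sym (P : Rees A) :
    C.mk P = ∑ i ∈ P.1.coeff.support, sym i.1 i.2 (P.1.coeff i) := by
  have h : ∀ i, P.1.coeff i ∈ Ord A i.1 (i.2 - i.1) := fun i => by
    rw [ord_natCast]; exact P.2 i
  have : P = ∑ i ∈ P.1.coeff.support, (⟨_, single_mem_rees (h i)⟩ : Rees A) := by
    refine Subtype.ext ?_
    rw [AddSubmonoidClass.coe_finsetSum]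
    exact (AddMonoidAlgebra.sum_coeff_single P.1).symm
  conv_lhs => rw [this]
  rw [map_sum]
  exact Finset.sum_congr rfl fun i _ => (sym_of_mem (h i)).symm

-- Identities linear in each argument need only be checked on homogeneous elements, where they
-- become identities between operators.
@[elab_as_elim]
theorem C_induction {p : C A → Prop} (x : C A) (zero : p 0) (add : ∀ x y, p x → p y → p (x + y))
    (homogeneous : ∀ k l x, x ∈ gr A k l → p x) : p x := by
  obtain ⟨P, rfl⟩ := C.mk_surjective x
  rw [C_sum_sym]
  refine Finset.sum_induction _ p add zero fun i _ => homogeneous i.1 i.2 _ (sym_mem_gr ?_)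
  rw [ord_natCast]; exact P.2 i

/-- The linear map induced by a linear map on the Rees algebra. -/
noncomputable def C.lift {N : Type*} [AddCommGroup N] [Module ℝ N] (f : Rees A →ₗ[ℝ] N)
    (h : ∀ P ∈ lowerOrder A, f P = 0) : C A →ₗ[ℝ] N :=
  have e : ∀ P Q, C.mk P = C.mk Q → f P = f Q := fun P Q e => by
    rw [← sub_eq_zero, ← map_sub]; exact h _ (C.mk_eq.1 e)
  { toFun := fun x => f (Function.surjInv C.mk_surjective x)
    map_add' := fun x y => by
      rw [← map_add]; apply e
      rw [map_add]; simp only [Function.surjInv_eq C.mk_surjective]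
    map_smul' := fun c x => by
      rw [RingHom.id_apply, ← map_smul]; apply e
      rw [map_smul]; simp only [Function.surjInv_eq C.mk_surjective] }

theorem C.lift_mk {N : Type*} [AddCommGroup N] [Module ℝ N] (f : Rees A →ₗ[ℝ] N)
    (h : ∀ P ∈ lowerOrder A, f P = 0) (P : Rees A) : C.lift f h (C.mk P) = f P := by
  change f _ = f P
  rw [← sub_eq_zero, ← map_sub]
  refine h _ (C.mk_eq.1 ?_)
  exact Function.surjInv_eq C.mk_surjective _

/-- The map on `C` induced by linear maps of operators which preserve the orders. -/
noncomputable def C.mapCoeff (f : ℕ × ℤ → Op A →ₗ[ℝ] Op A)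
    (hf : ∀ i k P, P ∈ OrdLT A k (i.2 - i.1) → f i P ∈ OrdLT A k (i.2 - i.1)) :
    C A →ₗ[ℝ] C A :=
  C.lift
    { toFun := fun P => C.mk ⟨AddMonoidAlgebra.ofCoeff (Finsupp.onFinset P.1.coeff.support
        (fun i => f i (P.1.coeff i)) (fun i hi => by
          rw [Finsupp.mem_support_iff]; intro e; exact hi (by rw [e, map_zero]))),
        fun i => hf i _ _ (P.2 i)⟩
      map_add' := fun P Q => by
        rw [← map_add]
        refine congrArg C.mk (Subtype.ext (AddMonoidAlgebra.coeff_injective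
          (Finsupp.ext fun i => ?_)))
        exact map_add (f i) (P.1.coeff i) (Q.1.coeff i)
      map_smul' := fun c P => by
        rw [RingHom.id_apply, ← map_smul]
        refine congrArg C.mk (Subtype.ext (AddMonoidAlgebra.coeff_injective
          (Finsupp.ext fun i => ?_)))
        exact map_smul (f i) c (P.1.coeff i) }
    (fun P hP => by
      change C.mk _ = 0
      rw [← map_zero C.mk, C.mk_eq, sub_zero]
      exact fun i => hf i _ _ (hP i))

theorem C.mapCoeff_sym (f : ℕ × ℤ → Op A →ₗ[ℝ] Op A)
    (hf : ∀ i k P, P ∈ OrdLT A k (i.2 - i.1) → f i P ∈ OrdLT A k (i.2 - i.1)) {k l : ℤ}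
    {P : Op A} (hP : P ∈ Ord A k (l - k)) :
    C.mapCoeff f hf (sym k l P) = sym k l (f (k.toNat, l) P) := by
  by_cases hk : k < 0
  · rw [eq_zero_of_mem_ord hk hP, map_zero, sym_zero, map_zero]
  lift k to ℕ using by omega
  have hP' : f (k, l) P ∈ Ord A k (l - k) := by
    rw [ord_natCast] at hP ⊢; exact hf (k, l) _ _ hP
  rw [Int.toNat_natCast, sym_of_mem hP, sym_of_mem hP']
  refine (C.lift_mk _ _ _).trans (congrArg C.mk (Subtype.ext (AddMonoidAlgebra.coeff_injective
          (Finsupp.ext fun i => ?_))))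
  change f i ((AddMonoidAlgebra.single _ P).coeff i) = (AddMonoidAlgebra.single _ (f (k, l) P)).coeff i
  rw [AddMonoidAlgebra.coeff_single, AddMonoidAlgebra.coeff_single, Finsupp.single_apply,
    Finsupp.single_apply]
  split_ifs with h
  · rw [← h]; rfl
  · exact map_zero _

open Classical in
/-- The projection to the component of bidegree `(k, l)`. -/
noncomputable def pr (k l : ℤ) : C A →ₗ[ℝ] C A :=
  C.mapCoeff (fun i => if (i.1 : ℤ) = k ∧ i.2 = l then LinearMap.id else 0)
    (fun i k P hP => by
      split_ifs
      · exact hP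
      · exact zero_mem _)

theorem pr_of_mem {k l : ℤ} {x : C A} (hx : x ∈ gr A k l) : pr k l x = x := by
  by_cases hk : k < 0
  · rw [eq_zero_of_mem_gr hk hx, map_zero]
  obtain ⟨P, hP, rfl⟩ := hx
  rw [pr, C.mapCoeff_sym _ _ hP, if_pos ⟨by simp; omega, rfl⟩]
  rfl

theorem pr_of_ne {k l k' l' : ℤ} (h : k ≠ k' ∨ l ≠ l') {x : C A} (hx : x ∈ gr A k l) :
    pr k' l' x = 0 := by
  by_cases hk : k < 0
  · rw [eq_zero_of_mem_gr hk hx, map_zero]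
  obtain ⟨P, hP, rfl⟩ := hx
  rw [pr, C.mapCoeff_sym _ _ hP, if_neg]
  · exact sym_zero _ _
  · rintro ⟨h1, h2⟩
    simp only at h1 h2
    omega

theorem pr_mem (k l : ℤ) (x : C A) : pr k l x ∈ gr A k l := by
  induction x using C_induction with
  | zero => rw [map_zero]; exact zero_mem _
  | add x y hx hy => rw [map_add]; exact add_mem hx hy
  | homogeneous k' l' x hx =>
    by_cases h : k' = k ∧ l' = l
    · obtain ⟨rfl, rfl⟩ := h
      rwa [pr_of_mem hx]
    · rw [pr_of_ne (by omega) hx]; exact zero_mem _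

/-- Every element lies in the span of its own homogeneous components, because it is a finite sum of
symbols of distinct bidegrees. -/
theorem eq_zero_of_pr {x : C A} (h : ∀ k l, pr k l x = 0) : x = 0 := by
  have e : ∀ x : C A, x ∈ Submodule.span ℝ (Set.range fun i : ℤ × ℤ => pr i.1 i.2 x) := by
    intro x
    obtain ⟨P, rfl⟩ := C.mk_surjective x
    have hP : ∀ i : ℕ × ℤ, sym i.1 i.2 (P.1.coeff i) ∈ gr A i.1 i.2 := fun i =>
      sym_mem_gr (by rw [ord_natCast]; exact P.2 i)
    rw [C_sum_sym]
    refine sum_mem fun i hi => Submodule.subset_span ⟨(i.1, i.2), ?_⟩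
    dsimp only
    rw [map_sum, Finset.sum_eq_single i]
    · exact pr_of_mem (hP i)
    · intro j _ hj
      refine pr_of_ne ?_ (hP j)
      by_contra! hc
      exact hj (Prod.ext (by omega) hc.2)
    · intro h; exact absurd hi h
  have := e x
  simp only [h] at this
  have h2 : Submodule.span ℝ (Set.range fun _ : ℤ × ℤ => (0 : C A)) ≤ ⊥ := by
    rw [Submodule.span_le]; rintro _ ⟨i, rfl⟩; rfl
  exact h2 this

theorem gr_le_weight {k l w : ℤ} (h : k + l = w) : gr A k l ≤ weight A w := by
  intro x hx
  by_cases hk : k < 0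
  · rw [eq_zero_of_mem_gr hk hx]; exact zero_mem _
  lift k to ℕ using by omega
  rw [← bideg_eq_gr] at hx
  exact Submodule.mem_iSup_of_mem k (Submodule.mem_iSup_of_mem l (Submodule.mem_iSup_of_mem h hx))

theorem gr_le_filtration {k l p : ℤ} (h : p ≤ l) : gr A k l ≤ filtration A p := by
  intro x hx
  by_cases hk : k < 0
  · rw [eq_zero_of_mem_gr hk hx]; exact zero_mem _
  lift k to ℕ using by omega
  rw [← bideg_eq_gr] at hx
  exact Submodule.mem_iSup_of_mem k (Submodule.mem_iSup_of_mem l (Submodule.mem_iSup_of_mem h hx))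

theorem filtration_le {p : ℤ} {S : Submodule ℝ (C A)} (h : ∀ k l, p ≤ l → gr A k l ≤ S) :
    filtration A p ≤ S :=
  iSup_le fun k => iSup_le fun l => iSup_le fun hl => by rw [bideg_eq_gr]; exact h k l hl

theorem weight_le {w : ℤ} {S : Submodule ℝ (C A)} (h : ∀ k l, k + l = w → gr A k l ≤ S) :
    weight A w ≤ S :=
  iSup_le fun k => iSup_le fun l => iSup_le fun hl => by rw [bideg_eq_gr]; exact h k l hl

theorem pr_of_mem_weight {w k l : ℤ} (h : k + l ≠ w) {x : C A} (hx : x ∈ weight A w) :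
    pr k l x = 0 :=
  weight_le (S := LinearMap.ker (pr k l)) (fun k' l' e _ hy => pr_of_ne (by omega) hy) hx

end Symbols

/-! ### Graded antisymmetry, Jacobi identity and Leibniz rule. -/

section PoissonIdentities
variable {A : Type*} [CommRing A] [Algebra ℝ A]

theorem opComm_swap (m m' : ℤ) (P Q : Op A) :
    opComm m m' P Q = -((-1 : ℝ) ^ (m * m') • opComm m' m Q P) := by
  have h : (-1 : ℝ) ^ (m * m') * (-1 : ℝ) ^ (m * m') = 1 := by rw [← mul_zpow]; norm_num
  unfold opComm
  rw [mul_comm m' m, smul_sub, smul_smul, h, one_smul, neg_sub]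

theorem opComm_jacobi (m m' m'' : ℤ) (P Q R : Op A) :
    opComm m (m' + m'') P (opComm m' m'' Q R) = opComm (m + m') m'' (opComm m m' P Q) R +
      (-1 : ℝ) ^ (m * m') • opComm m' (m + m'') Q (opComm m m'' P R) := by
  have e : (-1 : ℝ) ^ (m' * m) = (-1 : ℝ) ^ (m * m') := by rw [mul_comm]
  have h : (-1 : ℝ) ^ (m * m') * (-1 : ℝ) ^ (m * m') = 1 := by rw [← mul_zpow]; norm_num
  unfold opComm
  rw [mul_add, add_mul, mul_add, zpow_add₀ (by norm_num), zpow_add₀ (by norm_num),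
    zpow_add₀ (by norm_num), e]
  -- The signs become free variables, of which only `p * p = 1` matters; the rest is a comparison of
  -- the coefficients of the triple products.
  generalize (-1 : ℝ) ^ (m * m') = p at *
  generalize (-1 : ℝ) ^ (m * m'') = q at *
  generalize (-1 : ℝ) ^ (m' * m'') = r at *
  simp only [mul_sub, sub_mul, smul_sub, smul_mul_assoc, mul_smul_comm, mul_assoc, smul_smul]
  match_scalars <;> grind

theorem bracket_swap {k k' l l' : ℤ} {x y : C A} (hx : x ∈ gr A k l) (hy : y ∈ gr A k' l') :
    C.bracket x y = -((-1 : ℝ) ^ ((l - k) * (l' - k')) • C.bracket y x) := by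
  obtain ⟨P, hP, rfl⟩ := hx
  obtain ⟨Q, hQ, rfl⟩ := hy
  have h := ord_opComm_sym hQ hP
  rw [bracket_sym hP hQ, bracket_sym hQ hP, ← sym_smul h, ← sym_neg (Submodule.smul_mem _ _ h),
    ← opComm_swap, add_comm k k', add_comm l l']

theorem bracket_swap_of_even {k k' l l' : ℤ} {x y : C A} (hx : x ∈ gr A k l)
    (hy : y ∈ gr A k' l') (h : Even ((l - k) * (l' - k'))) :
    C.bracket x y = -C.bracket y x := by
  rw [bracket_swap hx hy, h.neg_one_zpow, one_smul]

theorem bracket_swap_of_odd {k k' l l' : ℤ} {x y : C A} (hx : x ∈ gr A k l)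
    (hy : y ∈ gr A k' l') (h : Odd ((l - k) * (l' - k'))) :
    C.bracket x y = C.bracket y x := by
  rw [bracket_swap hx hy, h.neg_one_zpow, neg_one_smul, neg_neg]

theorem bracket_jacobi {k k' l l' : ℤ} {x y : C A} (hx : x ∈ gr A k l) (hy : y ∈ gr A k' l')
    (z : C A) : C.bracket x (C.bracket y z) = C.bracket (C.bracket x y) z +
      (-1 : ℝ) ^ ((l - k) * (l' - k')) • C.bracket y (C.bracket x z) := by
  induction z using C_induction with
  | zero => simp
  | add z z' h h' => simp only [map_add, h, h', smul_add]; abel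
  | homogeneous k'' l'' z hz =>
    obtain ⟨P, hP, rfl⟩ := hx
    obtain ⟨Q, hQ, rfl⟩ := hy
    obtain ⟨R, hR, rfl⟩ := hz
    have h1 := ord_opComm_sym hP (ord_opComm_sym hQ hR)
    have h2 := ord_opComm_sym (ord_opComm_sym hP hQ) hR
    have h3 := ord_opComm_sym hQ (ord_opComm_sym hP hR)
    rw [bracket_sym hQ hR, bracket_sym hP hR, bracket_sym hP hQ, bracket_sym hP
      (ord_opComm_sym hQ hR), bracket_sym hQ (ord_opComm_sym hP hR),
      bracket_sym (ord_opComm_sym hP hQ) hR]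
    have ek1 : k + k' - 1 + k'' - 1 = k + (k' + k'' - 1) - 1 := by ring
    have ek2 : k' + (k + k'' - 1) - 1 = k + (k' + k'' - 1) - 1 := by ring
    have el1 : l + l' - 1 + l'' - 1 = l + (l' + l'' - 1) - 1 := by ring
    have el2 : l' + (l + l'' - 1) - 1 = l + (l' + l'' - 1) - 1 := by ring
    have em1 : l' + l'' - 1 - (k' + k'' - 1) = (l' - k') + (l'' - k'') := by ring
    have em2 : l + l'' - 1 - (k + k'' - 1) = (l - k) + (l'' - k'') := by ring
    have em3 : l + l' - 1 - (k + k' - 1) = (l - k) + (l' - k') := by ring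
    rw [ek1, el1, em3] at h2 ⊢
    rw [ek2, el2, em2] at h3 ⊢
    rw [em1, opComm_jacobi, sym_add h2 (Submodule.smul_mem _ _ h3), sym_smul h3]

/-- For even `x` the sign is +1 whatever the parity of `y`, so `y` need not be homogeneous. Thus {x,
·} is an ordinary derivation of the bracket, which is what makes its exponential an automorphism. -/
theorem bracket_jacobi_of_even {k l : ℤ} {x : C A} (hx : x ∈ gr A k l) (h : Even (l - k))
    (y z : C A) : C.bracket x (C.bracket y z) = C.bracket (C.bracket x y) z +
      C.bracket y (C.bracket x z) := by
  induction y using C_induction with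
  | zero => simp
  | add y y' h h' => simp only [map_add, LinearMap.add_apply, h, h']; abel
  | homogeneous k' l' y hy =>
    rw [bracket_jacobi hx hy, (h.mul_right _).neg_one_zpow, one_smul]

theorem bracket_jacobi_of_odd {k k' l l' : ℤ} {x y : C A} (hx : x ∈ gr A k l)
    (hy : y ∈ gr A k' l') (h : Odd (l - k)) (h' : Odd (l' - k')) (z : C A) :
    C.bracket x (C.bracket y z) + C.bracket y (C.bracket x z) = C.bracket (C.bracket x y) z := by
  rw [bracket_jacobi hx hy, (h.mul h').neg_one_zpow, neg_one_smul, neg_add_cancel_right]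

/-- An operator P of even degree has ungraded commutators with everything, and PQR - QRP = (PQ -
QP)R + Q(PR - RP). -/
theorem bracket_mul_of_even {k l : ℤ} {x : C A} (hx : x ∈ gr A k l) (h : Even (l - k))
    (y z : C A) : C.bracket x (y * z) = C.bracket x y * z + y * C.bracket x z := by
  induction y using C_induction with
  | zero => simp
  | add y y' h h' => simp only [map_add, add_mul, h, h']; abel
  | homogeneous k' l' y hy =>
    induction z using C_induction with
    | zero => simp
    | add z z' h h' => simp only [map_add, mul_add, h, h']; abel
    | homogeneous k'' l'' z hz =>
      obtain ⟨P, hP, rfl⟩ := hx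
      obtain ⟨Q, hQ, rfl⟩ := hy
      obtain ⟨R, hR, rfl⟩ := hz
      have h1 := ord_mul_sym (ord_opComm_sym hP hQ) hR
      have h2 := ord_mul_sym hQ (ord_opComm_sym hP hR)
      rw [sym_mul hQ hR, bracket_sym hP (ord_mul_sym hQ hR), bracket_sym hP hQ,
        bracket_sym hP hR, sym_mul (ord_opComm_sym hP hQ) hR, sym_mul hQ (ord_opComm_sym hP hR)]
      have ek1 : k + k' - 1 + k'' = k + (k' + k'') - 1 := by ring
      have ek2 : k' + (k + k'' - 1) = k + (k' + k'') - 1 := by ring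
      have el1 : l + l' - 1 + l'' = l + (l' + l'') - 1 := by ring
      have el2 : l' + (l + l'' - 1) = l + (l' + l'') - 1 := by ring
      rw [ek1, el1] at h1 ⊢
      rw [ek2, el2] at h2 ⊢
      rw [← sym_add h1 h2]
      congr 1
      simp only [opComm, (h.mul_right _).neg_one_zpow, one_smul]
      noncomm_ring

theorem bracket_mem_weight {k l w w' : ℤ} {x y : C A} (hx : x ∈ gr A k l) (hy : y ∈ weight A w)
    (h : k + l + w - 2 = w') : C.bracket x y ∈ weight A w' :=
  weight_le (S := (weight A w').comap (C.bracket x)) (fun _ _ e _ hz =>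
    gr_le_weight (by omega) (bracket_mem_gr hx hz)) hy

theorem bracket_mem_filtration {k l p p' : ℤ} {x y : C A} (hx : x ∈ gr A k l)
    (hy : y ∈ filtration A p) (h : p' ≤ l + p - 1) : C.bracket x y ∈ filtration A p' :=
  filtration_le (S := (filtration A p').comap (C.bracket x)) (fun _ _ e _ hz =>
    gr_le_filtration (by omega) (bracket_mem_gr hx hz)) hy

end PoissonIdentities

/-! ### Exponentials of locally nilpotent derivations. -/

section Exponential
variable {V : Type*} [AddCommGroup V] [Module ℝ V]

/-- The exponential of a locally nilpotent endomorphism. -/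
noncomputable def expEnd (D : Module.End ℝ V) (x : V) : V :=
  ∑ᶠ n : ℕ, ((n.factorial : ℝ)⁻¹) • (D ^ n) x

/-- Locally nilpotent endomorphisms. -/
def IsLocallyNilpotent (D : Module.End ℝ V) : Prop := ∀ x, ∃ n : ℕ, (D ^ n) x = 0

theorem pow_apply_eq_zero_of_le {D : Module.End ℝ V} {x : V} {m n : ℕ} (h : (D ^ m) x = 0)
    (hmn : m ≤ n) : (D ^ n) x = 0 := by
  rw [← Nat.sub_add_cancel hmn, pow_add, Module.End.mul_apply, h, map_zero]

/-- A `finsum` with infinite support has the default value 0; nilpotency at `x` excludes this case.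
The freedom in `N` lets several vectors share one range. -/
theorem expEnd_eq_sum {D : Module.End ℝ V} {x : V} {N : ℕ} (h : (D ^ N) x = 0) :
    expEnd D x = ∑ n ∈ Finset.range N, ((n.factorial : ℝ)⁻¹) • (D ^ n) x := by
  refine finsum_eq_sum_of_support_subset _ fun n hn => ?_
  rw [Finset.mem_coe, Finset.mem_range]
  by_contra! hc
  exact hn (by dsimp only; rw [pow_apply_eq_zero_of_le h hc, smul_zero])

theorem expEnd_of_eq_zero {D : Module.End ℝ V} {x : V} (h : D x = 0) : expEnd D x = x := by
  rw [expEnd_eq_sum (N := 1) (by rwa [pow_one])]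
  simp

theorem expEnd_of_sq_eq_zero {D : Module.End ℝ V} {x : V} (h : D (D x) = 0) :
    expEnd D x = x + D x := by
  rw [expEnd_eq_sum (N := 2) h]
  simp [Finset.sum_range_succ]

theorem expEnd_add {D : Module.End ℝ V} (hD : IsLocallyNilpotent D) (x y : V) :
    expEnd D (x + y) = expEnd D x + expEnd D y := by
  obtain ⟨m, hm⟩ := hD x
  obtain ⟨n, hn⟩ := hD y
  have hm' := pow_apply_eq_zero_of_le hm (le_max_left m n)
  have hn' := pow_apply_eq_zero_of_le hn (le_max_right m n)
  rw [expEnd_eq_sum hm', expEnd_eq_sum hn', expEnd_eq_sum (N := max m n)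
    (by rw [map_add, hm', hn', add_zero]), ← Finset.sum_add_distrib]
  simp only [map_add, smul_add]

theorem expEnd_smul {D : Module.End ℝ V} (hD : IsLocallyNilpotent D) (c : ℝ) (x : V) :
    expEnd D (c • x) = c • expEnd D x := by
  obtain ⟨m, hm⟩ := hD x
  rw [expEnd_eq_sum hm, expEnd_eq_sum (N := m) (by rw [map_smul, hm, smul_zero]),
    Finset.smul_sum]
  exact Finset.sum_congr rfl fun n _ => by rw [map_smul, smul_comm]

theorem expEnd_mem {D : Module.End ℝ V} (hD : IsLocallyNilpotent D) {S : Submodule ℝ V}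
    (hS : ∀ x ∈ S, D x ∈ S) {x : V} (hx : x ∈ S) : expEnd D x ∈ S := by
  obtain ⟨m, hm⟩ := hD x
  rw [expEnd_eq_sum hm]
  refine sum_mem fun n _ => Submodule.smul_mem _ _ ?_
  clear hm
  rename_i h; clear h
  induction n with
  | zero => exact hx
  | succ n ih => rw [pow_succ', Module.End.mul_apply]; exact hS _ ih

theorem pow_apply_bilinear {D : Module.End ℝ V} {B : V →ₗ[ℝ] V →ₗ[ℝ] V}
    (hB : ∀ x y, D (B x y) = B (D x) y + B x (D y)) (n : ℕ) (x y : V) :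
    (D ^ n) (B x y) = ∑ i ∈ Finset.HasAntidiagonal.antidiagonal n,
      n.choose i.1 • B ((D ^ i.1) x) ((D ^ i.2) y) := by
  induction n with
  | zero => simp
  | succ n ih =>
    rw [Finset.sum_antidiagonal_choose_succ_nsmul
      (f := fun i j => B ((D ^ i) x) ((D ^ j) y)), pow_succ', Module.End.mul_apply, ih, map_sum,
      ← Finset.sum_add_distrib]
    refine Finset.sum_congr rfl fun i hi => ?_
    rw [map_nsmul, hB, smul_add, add_comm, pow_succ', pow_succ']
    congr 2
    rw [← Finset.HasAntidiagonal.mem_antidiagonal.1 hi, Nat.choose_symm_add]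

/-- This is exp(D ⊗ 1 + 1 ⊗ D) = exp D ⊗ exp D. It is applied with `B` the bracket and with `B` the
product of `C`. -/
theorem expEnd_bilinear {D : Module.End ℝ V} (hD : IsLocallyNilpotent D)
    {B : V →ₗ[ℝ] V →ₗ[ℝ] V} (hB : ∀ x y, D (B x y) = B (D x) y + B x (D y)) (x y : V) :
    expEnd D (B x y) = B (expEnd D x) (expEnd D y) := by
  obtain ⟨m, hm⟩ := hD x
  obtain ⟨n, hn⟩ := hD y
  have h1 : ∀ i : ℕ × ℕ, i ∉ Finset.range m ×ˢ Finset.range n →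
      B ((D ^ i.1) x) ((D ^ i.2) y) = 0 := by
    intro i hi
    rw [Finset.mem_product, Finset.mem_range, Finset.mem_range, not_and_or, not_lt, not_lt] at hi
    rcases hi with hi | hi
    · rw [pow_apply_eq_zero_of_le hm hi, map_zero, LinearMap.zero_apply]
    · rw [pow_apply_eq_zero_of_le hn hi, map_zero]
  have h2 : (D ^ (m + n)) (B x y) = 0 := by
    rw [pow_apply_bilinear hB]
    refine Finset.sum_eq_zero fun i hi => ?_
    rw [h1 i, smul_zero]
    rw [Finset.mem_product, Finset.mem_range, Finset.mem_range]
    have := Finset.HasAntidiagonal.mem_antidiagonal.1 hi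
    omega
  rw [expEnd_eq_sum hm, expEnd_eq_sum hn, expEnd_eq_sum h2, LinearMap.map_sum₂]
  simp only [map_sum]
  -- The double sum over the box of indices below (m, n) is regrouped along the antidiagonals. The
  -- terms of an antidiagonal outside the box vanish by `h1`, and inside it the binomial coefficient
  -- divided by k! is the product of the two inverse factorials.
  rw [← Finset.sum_product', ← Finset.sum_fiberwise_of_maps_to (t := Finset.range (m + n))
    (g := fun i : ℕ × ℕ => i.1 + i.2)]
  · refine Finset.sum_congr rfl fun k _ => ?_
    rw [pow_apply_bilinear hB, Finset.smul_sum]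
    refine (Finset.sum_subset (s₁ := (Finset.range m ×ˢ Finset.range n).filter
      (fun i => i.1 + i.2 = k)) ?_ ?_).symm.trans ?_
    rotate_left 2
    · refine Finset.sum_congr rfl fun i hi => ?_
      have hi' := (Finset.mem_filter.1 hi).2
      simp only [map_smul, LinearMap.smul_apply, smul_smul]
      rw [← Nat.cast_smul_eq_nsmul ℝ, smul_smul, ← hi']
      congr 1
      have e := Nat.choose_mul_factorial_mul_factorial (Nat.le_add_right i.1 i.2)
      rw [Nat.add_sub_cancel_left] at e
      rw [← e]
      have h3 : ((i.1 + i.2).choose i.1 : ℝ) ≠ 0 := by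
        exact_mod_cast (Nat.choose_pos (Nat.le_add_right i.1 i.2)).ne'
      push_cast
      field_simp
    · intro i hi
      exact Finset.HasAntidiagonal.mem_antidiagonal.2 (Finset.mem_filter.1 hi).2
    · intro i hi hi'
      rw [h1 i, smul_zero, smul_zero]
      intro hc
      exact hi' (Finset.mem_filter.2 ⟨hc, Finset.HasAntidiagonal.mem_antidiagonal.1 hi⟩)
  · intro i hi
    rw [Finset.mem_product, Finset.mem_range, Finset.mem_range] at hi
    rw [Finset.mem_range]
    omega

end Exponential

/-! ### The automorphisms exp X_a for bivector fields and 2-forms. -/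

section Twist
variable {A : Type*} [CommRing A] [Algebra ℝ A]

theorem twist_eq_expEnd (a x : C A) : twist a x = expEnd (C.bracket a) x := rfl

theorem isLocallyNilpotent_of_gr {D : Module.End ℝ (C A)}
    (h : ∀ k l x, x ∈ gr A k l → ∃ n : ℕ, (D ^ n) x = 0) : IsLocallyNilpotent D := by
  intro x
  induction x using C_induction with
  | zero => exact ⟨0, map_zero _⟩
  | add x y hx hy =>
    obtain ⟨m, hm⟩ := hx
    obtain ⟨n, hn⟩ := hy
    refine ⟨max m n, ?_⟩
    rw [map_add, pow_apply_eq_zero_of_le hm (le_max_left m n),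
      pow_apply_eq_zero_of_le hn (le_max_right m n), add_zero]
  | homogeneous k l x hx => exact h k l x hx

theorem pow_bracket_mem {k₀ l₀ k l : ℤ} {a x : C A} (ha : a ∈ gr A k₀ l₀) (hx : x ∈ gr A k l)
    (n : ℕ) : (C.bracket a ^ n) x ∈ gr A (k + n * (k₀ - 1)) (l + n * (l₀ - 1)) := by
  induction n with
  | zero => simpa using hx
  | succ n ih =>
    rw [pow_succ', Module.End.mul_apply]
    exact gr_cast (by push_cast; ring) (by push_cast; ring) (bracket_mem_gr ha ih)

/-- Each bracket with `a` lowers the order k by one, and there is nothing of negative order. -/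
theorem isLocallyNilpotent_of_mem_zero_two {a : C A} (ha : a ∈ gr A 0 2) :
    IsLocallyNilpotent (C.bracket a) :=
  isLocallyNilpotent_of_gr fun k _ _ hx =>
    ⟨k.toNat + 1, eq_zero_of_mem_gr (by push_cast; omega) (pow_bracket_mem ha hx _)⟩

/-- Here each bracket lowers l by one, and `eq_zero_of_mem_gr'` says that nothing lives in negative
l. -/
theorem isLocallyNilpotent_of_mem_two_zero {a : C A} (ha : a ∈ gr A 2 0) :
    IsLocallyNilpotent (C.bracket a) :=
  isLocallyNilpotent_of_gr fun _ l _ hx =>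
    ⟨l.toNat + 1, eq_zero_of_mem_gr' (by push_cast; omega) (pow_bracket_mem ha hx _)⟩

/-- The elements of bidegrees `(2, 0)` and `(0, 2)`, such as bivector fields and `2`-forms. -/
def IsTwistable (a : C A) : Prop := a ∈ gr A 2 0 ∨ a ∈ gr A 0 2

theorem IsTwistable.isLocallyNilpotent {a : C A} (ha : IsTwistable a) :
    IsLocallyNilpotent (C.bracket a) :=
  ha.elim isLocallyNilpotent_of_mem_two_zero isLocallyNilpotent_of_mem_zero_two

theorem twist_bracket {a : C A} (ha : IsTwistable a) (x y : C A) :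
    twist a (C.bracket x y) = C.bracket (twist a x) (twist a y) :=
  expEnd_bilinear ha.isLocallyNilpotent (fun x y => ha.elim
    (fun h => bracket_jacobi_of_even h (by decide) x y)
    (fun h => bracket_jacobi_of_even h (by decide) x y)) x y

theorem twist_mul {a : C A} (ha : IsTwistable a) (x y : C A) :
    twist a (x * y) = twist a x * twist a y :=
  expEnd_bilinear (B := LinearMap.mul ℝ (C A)) ha.isLocallyNilpotent (fun x y => ha.elim
    (fun h => bracket_mul_of_even h (by decide) x y)
    (fun h => bracket_mul_of_even h (by decide) x y)) x y

theorem twist_mem_weight {a : C A} (ha : IsTwistable a) {w : ℤ} {x : C A} (hx : x ∈ weight A w) :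
    twist a x ∈ weight A w :=
  expEnd_mem ha.isLocallyNilpotent (fun x hx => ha.elim
    (fun h => bracket_mem_weight h hx (by ring)) (fun h => bracket_mem_weight h hx (by ring))) hx

/-- The bracket with an element of bidegree (0, 2) raises l by one. For bivector fields it lowers l,
which is why only the exponentials of 2-forms enter Φ. -/
theorem twist_mem_filtration {a : C A} (ha : a ∈ gr A 0 2) {p : ℤ} {x : C A}
    (hx : x ∈ filtration A p) : twist a x ∈ filtration A p :=
  expEnd_mem (isLocallyNilpotent_of_mem_zero_two ha)
    (fun _ hx => bracket_mem_filtration ha hx (by omega)) hx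

/-- `exp X_a` as a linear map. -/
noncomputable def twistLinear {a : C A} (ha : IsTwistable a) : C A →ₗ[ℝ] C A where
  toFun := twist a
  map_add' := expEnd_add ha.isLocallyNilpotent
  map_smul' := expEnd_smul ha.isLocallyNilpotent

/-- The components of `exp X_a x`, for a `2`-form `a`, of the largest order. -/
theorem pr_twist {a : C A} (ha : a ∈ gr A 0 2) {k l k' l' : ℤ} (h : k ≤ k') {x : C A}
    (hx : x ∈ gr A k l) : pr k' l' (twist a x) = pr k' l' x := by
  obtain ⟨n, hn⟩ := isLocallyNilpotent_of_mem_zero_two ha x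
  -- The range is enlarged to n + 1 so that the term of index 0 can be split off. The remaining
  -- terms have order less than k, hence less than k', and are killed by the projection.
  rw [twist_eq_expEnd, expEnd_eq_sum (pow_apply_eq_zero_of_le hn (Nat.le_succ n)),
    Finset.sum_range_succ', map_add, map_sum, Finset.sum_eq_zero]
  · simp
  · intro i _
    rw [map_smul, pr_of_ne (Or.inl _) (pow_bracket_mem ha hx (i + 1)), smul_zero]
    push_cast
    omega

end Twist

/-! ### Functions, vector fields, forms and bivector fields in `C`, and their brackets. -/

section Generators
variable {A : Type*} [CommRing A] [Algebra ℝ A]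

theorem fn_eq_sym (f : A) : fn f = sym 0 0 (opFun f) := symbol_eq_sym 0 0 _

theorem vec_eq_sym (X : VectorField A) : vec X = sym 1 0 (opContract X) := symbol_eq_sym 1 0 _

theorem hd_eq_sym : hd A = sym 1 2 opDeRham := symbol_eq_sym 1 2 _

theorem bivec_eq_sym (π : Bivector A) : bivec π = sym 2 0 (opMulti π.1) := symbol_eq_sym 2 0 _

theorem opFun_mem_ord (f : A) : opFun f ∈ Ord A 0 (0 - 0) := opFun_mem f

theorem opD_mem_ord (g : A) : opD g ∈ Ord A 0 (1 - 0) := opD_mem g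

theorem opContract_mem_ord (X : VectorField A) : opContract X ∈ Ord A 1 (0 - 1) := opContract_mem X

theorem opDeRham_mem_ord : (opDeRham : Op A) ∈ Ord A 1 (2 - 1) := opDeRham_mem

theorem opMulti_mem_ord (π : Bivector A) : opMulti π.1 ∈ Ord A 2 (0 - 2) := opMulti_mem π

theorem fn_mem_gr (f : A) : fn f ∈ gr A 0 0 := by
  rw [fn_eq_sym]; exact sym_mem_gr (opFun_mem_ord f)

theorem vec_mem_gr (X : VectorField A) : vec X ∈ gr A 1 0 := by
  rw [vec_eq_sym]; exact sym_mem_gr (opContract_mem_ord X)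

theorem hd_mem_gr : hd A ∈ gr A 1 2 := by
  rw [hd_eq_sym]; exact sym_mem_gr opDeRham_mem_ord

theorem bivec_mem_gr (π : Bivector A) : bivec π ∈ gr A 2 0 := by
  rw [bivec_eq_sym]; exact sym_mem_gr (opMulti_mem_ord π)

theorem vec_add (X Y : VectorField A) : vec (X + Y) = vec X + vec Y := by
  rw [vec_eq_sym, vec_eq_sym, vec_eq_sym, ← sym_add (opContract_mem_ord X) (opContract_mem_ord Y)]
  congr 1
  exact LinearMap.ext fun x => Subtype.ext (funext fun k => map_add (x.1 (k + 1)).curryLeft X Y)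

theorem vec_neg (X : VectorField A) : vec (-X) = -vec X := by
  rw [vec_eq_sym, vec_eq_sym, ← sym_neg (opContract_mem_ord X)]
  congr 1
  exact LinearMap.ext fun x => Subtype.ext (funext fun k => map_neg (x.1 (k + 1)).curryLeft X)

theorem opMulti_add (π ρ : ExteriorAlgebra A (VectorField A)) :
    opMulti (π + ρ) = opMulti π + opMulti ρ :=
  LinearMap.ext fun z => Subtype.ext (by
    change contractMulti (π + ρ) z.1 = contractMulti π z.1 + contractMulti ρ z.1
    rw [map_add]; rfl)

theorem bivec_add (π ρ : Bivector A) : bivec (π + ρ) = bivec π + bivec ρ := by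
  rw [bivec_eq_sym, bivec_eq_sym, bivec_eq_sym, ← sym_add (opMulti_mem_ord π) (opMulti_mem_ord ρ)]
  congr 1
  exact opMulti_add _ _

theorem diffForm_ext {l : ℕ} {η ζ : DiffForm A l} (h : η.1 l = ζ.1 l) : η = ζ := by
  refine Subtype.ext (funext fun j => ?_)
  by_cases hj : j = l
  · rw [hj, h]
  · rw [omegaDeg_apply_of_ne η.2 j hj, omegaDeg_apply_of_ne ζ.2 j hj]

theorem op_one_mem {l : ℕ} {T : Op A} (hT : T ∈ OrdLT A 1 l) :
    (T (DiffForms.one A)).1 ∈ OmegaDeg A l := by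
  have := single_mem_omegaDeg (T (DiffForms.one A)).2 l
  convert this
  funext j
  by_cases hj : j = l
  · subst hj; simp
  · rw [Pi.single_eq_of_ne hj]
    refine ordLT_degree hT 0 (DiffForms.one A) (fun i hi => ?_) j (by push_cast; omega)
    cases i with
    | zero => exact absurd rfl hi
    | succ i => rfl

theorem op_ext_of_one {m : ℤ} {S T : Op A} (hS : S ∈ OrdLT A 1 m) (hT : T ∈ OrdLT A 1 m)
    (h : (S (DiffForms.one A)).1 = (T (DiffForms.one A)).1) : S = T :=
  sub_eq_zero.1 (op_ext_of_order_zero (sub_mem hS hT) (by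
    rw [LinearMap.sub_apply]; exact sub_eq_zero.2 (Subtype.ext h)))

/-- An operator of order zero is determined by its value at 1, so the operator chosen in the
definition of `form` may be replaced by any convenient one. -/
theorem form_eq_sym {l : ℕ} {η : DiffForm A l} {T : Op A} (hT : T ∈ OrdLT A 1 l)
    (h : (T (DiffForms.one A)).1 = η.1) : form η = sym 0 l T := by
  have h1 : (exists_formOp η).choose.1 ∈ OrdLT A 1 l :=
    ordLT_cast rfl (by rw [Nat.cast_zero, sub_zero]) (exists_formOp η).choose.2
  refine (symbol_eq_sym 0 l _).trans ?_
  congr 1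
  exact op_ext_of_one h1 hT ((exists_formOp η).choose_spec.trans h.symm)

theorem exists_op {l : ℕ} (η : DiffForm A l) : ∃ T ∈ OrdLT A 1 (l : ℤ),
    (T (DiffForms.one A)).1 = η.1 := by
  obtain ⟨T, h1, h2, -⟩ := exists_mulForm η.2
  exact ⟨T, h1, h2⟩

theorem mem_ord_zero {l : ℤ} {T : Op A} (hT : T ∈ OrdLT A 1 l) : T ∈ Ord A 0 (l - 0) := by
  rw [sub_zero]; exact hT

theorem form_mem_gr {l : ℕ} (η : DiffForm A l) : form η ∈ gr A 0 l := by
  obtain ⟨T, h1, h2⟩ := exists_op η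
  rw [form_eq_sym h1 h2]
  exact sym_mem_gr (mem_ord_zero h1)

theorem form_add {l : ℕ} (η ζ : DiffForm A l) : form (η + ζ) = form η + form ζ := by
  obtain ⟨S, h1, h2⟩ := exists_op η
  obtain ⟨T, h3, h4⟩ := exists_op ζ
  rw [form_eq_sym h1 h2, form_eq_sym h3 h4, ← sym_add (mem_ord_zero h1) (mem_ord_zero h3)]
  exact form_eq_sym (add_mem h1 h3) (congrArg₂ (· + ·) h2 h4)

theorem form_neg {l : ℕ} (η : DiffForm A l) : form (-η) = -form η := by
  obtain ⟨S, h1, h2⟩ := exists_op η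
  rw [form_eq_sym h1 h2, ← sym_neg (mem_ord_zero h1)]
  exact form_eq_sym (neg_mem h1) (congrArg Neg.neg h2)

theorem form_sub {l : ℕ} (η ζ : DiffForm A l) : form (η - ζ) = form η - form ζ := by
  have e : η - ζ = η + -ζ := sub_eq_add_neg η ζ
  rw [e, form_add, form_neg, sub_eq_add_neg]

theorem form_zero (l : ℕ) : form (0 : DiffForm A l) = 0 := by
  have e : (0 : DiffForm A l) + 0 = 0 := add_zero _
  have h := form_add (0 : DiffForm A l) 0
  rw [e] at h
  exact left_eq_add.1 h

/-- In order zero the symbol map has no kernel: an operator of order at most -1 is zero. -/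
theorem form_eq_zero {l : ℕ} {η : DiffForm A l} (h : form η = 0) : η = 0 := by
  obtain ⟨T, h1, h2⟩ := exists_op η
  rw [form_eq_sym h1 h2] at h
  have := eq_zero_of_mem_ord (by norm_num) (mem_of_sym_eq_zero (mem_ord_zero h1) h)
  rw [this] at h2
  exact Subtype.ext h2.symm

theorem exists_form_eq {l : ℕ} {x : C A} (hx : x ∈ gr A 0 l) : ∃ η : DiffForm A l, form η = x := by
  obtain ⟨P, hP, rfl⟩ := hx
  rw [sub_zero] at hP
  exact ⟨⟨_, op_one_mem hP⟩, form_eq_sym hP rfl⟩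

theorem exists_fn_eq {x : C A} (hx : x ∈ gr A 0 0) : ∃ f : A, fn f = x := by
  obtain ⟨P, hP, rfl⟩ := hx
  rw [sub_zero] at hP
  refine ⟨(P (DiffForms.one A)).1 0 ![], ?_⟩
  rw [fn_eq_sym]
  congr 1
  refine op_ext_of_one (opFun_mem _) hP (funext fun j => ?_)
  cases j with
  | zero =>
    ext v
    rw [Subsingleton.elim v ![]]
    exact mul_one _
  | succ j =>
    rw [omegaDeg_apply_of_ne (op_one_mem (l := 0) hP) (j + 1) (by omega)]
    exact smul_zero (M := A) (A := AltForm A (j + 1)) _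

/-- The contraction `ι_X η` of a form of positive degree. -/
def DiffForm.contract {l : ℕ} (X : VectorField A) (η : DiffForm A (l + 1)) : DiffForm A l :=
  ⟨TwistedPoisson.contract X η.1, by
    obtain ⟨η, hη⟩ := η
    dsimp only
    unfold OmegaDeg at hη
    induction hη using Submodule.span_induction with
    | mem x hx =>
      obtain ⟨gs, hgs, rfl⟩ := hx
      have := contract_wedgeList_mem X gs
      rwa [show gs.length = l + 1 from hgs, Nat.add_sub_cancel] at this
    | zero => rw [map_zero]; exact zero_mem _
    | add x y _ _ hx hy => rw [map_add]; exact add_mem hx hy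
    | smul f x _ hx => rw [map_smul]; exact Submodule.smul_mem _ f hx⟩

/-- The commutator of ι_X with η ∧ has order zero, so it is identified by its value at 1; since ι_X
1 = 0, only ι_X η remains. The computation of `bracket_hd_form` is the same, with d 1 = 0. -/
theorem bracket_vec_form {l : ℕ} (X : VectorField A) (η : DiffForm A (l + 1)) :
    C.bracket (vec X) (form η) = form (η.contract X) := by
  obtain ⟨T, h1, h2⟩ := exists_op η
  have h := ord_opComm_sym (opContract_mem_ord X) (mem_ord_zero h1)
  have e : (0 : ℤ) + (l + 1 : ℕ) - 1 = l := by push_cast; ring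
  rw [vec_eq_sym, form_eq_sym h1 h2, bracket_sym (opContract_mem_ord X) (mem_ord_zero h1)]
  rw [e, add_zero, sub_self, sub_zero] at h ⊢
  refine (form_eq_sym h ?_).symm
  change TwistedPoisson.contract X (T (DiffForms.one A)).1 - _ • (T (opContract X (DiffForms.one A))).1 = _
  have e0 : opContract X (DiffForms.one A) = 0 := Subtype.ext (contract_oneForm X)
  rw [h2, e0, map_zero]
  exact (congrArg _ (smul_zero _)).trans (sub_zero _)

theorem bracket_hd_form {l : ℕ} (η : DiffForm A l) :
    C.bracket (hd A) (form η) = form η.d := by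
  obtain ⟨T, h1, h2⟩ := exists_op η
  have h := ord_opComm_sym opDeRham_mem_ord (mem_ord_zero h1)
  have e : (2 : ℤ) + l - 1 = (l + 1 : ℕ) := by push_cast; ring
  rw [hd_eq_sym, form_eq_sym h1 h2, bracket_sym opDeRham_mem_ord (mem_ord_zero h1)]
  rw [e, add_zero, sub_self, sub_zero] at h ⊢
  refine (form_eq_sym h ?_).symm
  change exteriorDerivative (T (DiffForms.one A)).1 - _ • (T (opDeRham (DiffForms.one A))).1 = _
  have e0 : opDeRham (DiffForms.one A) = 0 := Subtype.ext exteriorDerivative_oneForm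
  rw [h2, e0, map_zero]
  exact (congrArg _ (smul_zero _)).trans (sub_zero _)

theorem opContract_mul_of_order_zero {T : Op A} (hT : T ∈ OrdLT A 1 1) {α : DiffForm A 1}
    (h : (T (DiffForms.one A)).1 = α.1) (X : VectorField A) :
    opContract X * T = opFun (α.toDual X) - T * opContract X := by
  have h1 := ord_opComm_sym (opContract_mem_ord X) (mem_ord_zero hT)
  norm_num [opComm] at h1
  rw [eq_sub_iff_add_eq]
  refine op_ext_of_one h1 (opFun_mem _) ?_
  change TwistedPoisson.contract X (T (DiffForms.one A)).1 +
    (T (opContract X (DiffForms.one A))).1 = α.toDual X • oneForm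
  have e0 : opContract X (DiffForms.one A) = 0 := Subtype.ext (contract_oneForm X)
  rw [h, e0, map_zero]
  refine (add_zero _).trans (funext fun j => ?_)
  cases j with
  | zero =>
    ext v
    rw [Subsingleton.elim v ![]]
    exact (mul_one _).symm
  | succ j =>
    refine (omegaDeg_apply_of_ne (α.contract X).2 _ (by omega)).trans ?_
    exact (smul_zero (M := A) (A := AltForm A (j + 1)) _).symm

/-- The bivector field `X ∧ Y`. -/
def wedge (X Y : VectorField A) : Bivector A :=
  ⟨ExteriorAlgebra.ι A X * ExteriorAlgebra.ι A Y, by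
    change _ ∈ LinearMap.range (ExteriorAlgebra.ι A) ^ 2
    rw [pow_two]
    exact Submodule.mul_mem_mul ⟨X, rfl⟩ ⟨Y, rfl⟩⟩

theorem bivector_induction {p : Bivector A → Prop} (π : Bivector A)
    (h1 : ∀ X Y, p (wedge X Y)) (h2 : ∀ π ρ, p π → p ρ → p (π + ρ)) : p π := by
  obtain ⟨π, hπ⟩ := π
  have h : π ∈ LinearMap.range (ExteriorAlgebra.ι A (M := VectorField A)) *
    LinearMap.range (ExteriorAlgebra.ι A (M := VectorField A)) := by rw [← pow_two]; exact hπ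
  induction h using Submodule.mul_induction_on' with
  | mem_mul_mem x hx y hy =>
    obtain ⟨X, rfl⟩ := hx
    obtain ⟨Y, rfl⟩ := hy
    exact h1 X Y
  | add x hx y hy hx' hy' =>
    rw [← pow_two] at hx hy
    exact h2 ⟨x, hx⟩ ⟨y, hy⟩ (hx' hx) (hy' hy)

theorem sharp_add (π ρ : Bivector A) : sharp (π + ρ) = sharp π + sharp ρ := by
  ext1 α
  change ExteriorAlgebra.ιInv (CliffordAlgebra.contractLeft α (π.1 + ρ.1)) =
    ExteriorAlgebra.ιInv (CliffordAlgebra.contractLeft α π.1) +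
      ExteriorAlgebra.ιInv (CliffordAlgebra.contractLeft α ρ.1)
  rw [map_add, map_add]

theorem sharp_smul (f : A) (π : Bivector A) : sharp (f • π) = f • sharp π := by
  ext1 α
  change ExteriorAlgebra.ιInv (CliffordAlgebra.contractLeft α (f • π.1)) =
    f • ExteriorAlgebra.ιInv (CliffordAlgebra.contractLeft α π.1)
  rw [map_smul, map_smul]

theorem sharp_neg (π : Bivector A) : sharp (-π) = -sharp π := by
  have e : -π = (-1 : A) • π := (neg_one_smul A π).symm
  rw [e, sharp_smul]
  exact neg_one_smul A (sharp π)

theorem sharp_wedge (X Y : VectorField A) (α : Module.Dual A (VectorField A)) :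
    sharp (wedge X Y) α = α X • Y - α Y • X := by
  change ExteriorAlgebra.ιInv (CliffordAlgebra.contractLeft α
    (CliffordAlgebra.ι 0 X * CliffordAlgebra.ι 0 Y)) = _
  rw [CliffordAlgebra.contractLeft_ι_mul, CliffordAlgebra.contractLeft_ι, map_sub, map_smul,
    ← Algebra.commutes, ← Algebra.smul_def, map_smul]
  congr 2
  · exact ExteriorAlgebra.ι_leftInverse Y
  · exact ExteriorAlgebra.ι_leftInverse X

theorem dual_sharp (π : Bivector A) (α β : Module.Dual A (VectorField A)) :
    α (sharp π β) = -β (sharp π α) := by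
  induction π using bivector_induction with
  | h1 X Y => simp only [sharp_wedge, map_sub, map_smul, smul_eq_mul]; ring
  | h2 π ρ h h' => simp only [sharp_add, LinearMap.add_apply, map_add, h, h']; ring

theorem opMulti_wedge (X Y : VectorField A) :
    opMulti (wedge X Y).1 = opContract X * opContract Y := by
  refine LinearMap.ext fun x => Subtype.ext ?_
  change contractMulti (ExteriorAlgebra.ι A X * ExteriorAlgebra.ι A Y) _ =
    TwistedPoisson.contract X (TwistedPoisson.contract Y x.1)
  rw [map_mul, contractMulti, ExteriorAlgebra.lift_ι_apply, ExteriorAlgebra.lift_ι_apply]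
  rfl

theorem opContract_smul_sub (f g : A) (X Y : VectorField A) :
    opContract (f • X - g • Y) = opFun f * opContract X - opFun g * opContract Y :=
  LinearMap.ext fun x => Subtype.ext (funext fun k => by
    change (x.1 (k + 1)).curryLeft _ =
      f • (x.1 (k + 1)).curryLeft X - g • (x.1 (k + 1)).curryLeft Y
    rw [map_sub, map_smul, map_smul])

/-- For π = X ∧ Y, moving α to the left through ι_X ι_Y leaves α(Y) ι_X - α(X) ι_Y, which is the
contraction with -π~ α; hence the sign. -/
theorem bracket_bivec_form (π : Bivector A) (α : DiffForm A 1) :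
    C.bracket (bivec π) (form α) = -vec (sharp π α.toDual) := by
  induction π using bivector_induction with
  | h2 π ρ h h' =>
    rw [bivec_add, map_add, LinearMap.add_apply, h, h', sharp_add, LinearMap.add_apply, vec_add,
      neg_add]
  | h1 X Y =>
    obtain ⟨T, h1, h2⟩ := exists_op α
    have e := opContract_mul_of_order_zero h1 h2
    rw [bivec_eq_sym, form_eq_sym h1 h2, bracket_sym (opMulti_mem_ord _) (mem_ord_zero h1),
      opMulti_wedge, ← vec_neg, vec_eq_sym, sharp_wedge, neg_sub]
    norm_num [opComm]
    rw [opContract_smul_sub, mul_assoc, e, ← mul_assoc, mul_sub, ← mul_assoc, e,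
      opContract_opFun]
    congr 1
    noncomm_ring

/-- This bracket and the next three vanish for reasons of bidegree: one of the two degrees of the
result would be -1. -/
theorem bracket_bivec_vec (π : Bivector A) (X : VectorField A) :
    C.bracket (bivec π) (vec X) = 0 :=
  eq_zero_of_mem_gr' (by norm_num) (bracket_mem_gr (bivec_mem_gr π) (vec_mem_gr X))

theorem bracket_bivec_fn (π : Bivector A) (f : A) : C.bracket (bivec π) (fn f) = 0 :=
  eq_zero_of_mem_gr' (by norm_num) (bracket_mem_gr (bivec_mem_gr π) (fn_mem_gr f))

theorem bracket_form_fn {l : ℕ} (η : DiffForm A l) (f : A) : C.bracket (form η) (fn f) = 0 :=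
  eq_zero_of_mem_gr (by norm_num) (bracket_mem_gr (form_mem_gr η) (fn_mem_gr f))

theorem bracket_form_form {l m : ℕ} (η : DiffForm A l) (ζ : DiffForm A m) :
    C.bracket (form η) (form ζ) = 0 :=
  eq_zero_of_mem_gr (by norm_num) (bracket_mem_gr (form_mem_gr η) (form_mem_gr ζ))

theorem bracket_form_vec (η : DiffForm A 2) (X : VectorField A) :
    C.bracket (form η) (vec X) = -form (η.contract X) := by
  rw [bracket_swap_of_even (form_mem_gr η) (vec_mem_gr X) (by decide), bracket_vec_form]

/-- The `1`-form `dg`. -/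
def dForm (g : A) : DiffForm A 1 := ⟨wedgeList [g], wedgeList_mem [g]⟩

theorem form_dForm (g : A) : form (dForm g) = sym 0 1 (opD g) := form_eq_sym (opD_mem g) rfl

/-- A function of positive order in the momenta vanishes if it commutes with the functions and
the differentials of functions on the base. -/
theorem eq_zero_of_bracket_eq_zero {k l : ℤ} (hk : 1 ≤ k) {x : C A} (hx : x ∈ gr A k l)
    (hf : ∀ f : A, C.bracket x (fn f) = 0) (hg : ∀ g : A, C.bracket x (form (dForm g)) = 0) :
    x = 0 := by
  obtain ⟨k, rfl⟩ : ∃ j : ℕ, k = (j + 1 : ℕ) := ⟨(k - 1).toNat, by omega⟩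
  obtain ⟨P, hP, rfl⟩ := hx
  have hP' := hP
  rw [ord_natCast] at hP'
  refine sym_eq_zero ?_
  -- By the definition of order, P drops to order k as soon as its commutators with f and dg drop
  -- below order k, and this is the vanishing of the symbols of these commutators.
  rw [ord_natCast_sub_one, mem_ordLT_succ]
  refine ⟨ordLT_degree hP', fun f => ?_, fun g => ?_⟩
  · have h := hf f
    rw [fn_eq_sym, bracket_sym hP (opFun_mem_ord f)] at h
    have h1 := mem_of_sym_eq_zero (ord_opComm_sym hP (opFun_mem_ord f)) h
    rw [opComm, sub_self, mul_zero, zpow_zero, one_smul] at h1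
    rw [← ord_natCast_sub_one]
    exact ord_cast (by push_cast; ring) (by push_cast; ring) h1
  · have h := hg g
    rw [form_dForm, bracket_sym hP (opD_mem_ord g)] at h
    have h1 := mem_of_sym_eq_zero (ord_opComm_sym hP (opD_mem_ord g)) h
    rw [opComm, sub_zero, mul_one] at h1
    rw [← ord_natCast_sub_one]
    exact ord_cast (by push_cast; ring) (by push_cast; ring) h1

end Generators

/-! ### Poisson maps are determined on functions, exact 1-forms and vector fields. -/

section Rigidity
variable {A : Type*} [CommRing A] [Algebra ℝ A]

/-- Linear maps that preserve the Poisson bracket and the weight and are trivial on the base. -/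
structure IsPoissonEnd (L : C A →ₗ[ℝ] C A) : Prop where
  map_bracket : ∀ x y, L (C.bracket x y) = C.bracket (L x) (L y)
  map_weight : ∀ w x, x ∈ weight A w → L x ∈ weight A w
  map_fn : ∀ f : A, L (fn f) = fn f

theorem IsPoissonEnd.comp {L L' : C A →ₗ[ℝ] C A} (h : IsPoissonEnd L) (h' : IsPoissonEnd L') :
    IsPoissonEnd (L ∘ₗ L') where
  map_bracket x y := by simp only [LinearMap.comp_apply, h'.map_bracket, h.map_bracket]
  map_weight w x hx := h.map_weight w _ (h'.map_weight w x hx)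
  map_fn f := by simp only [LinearMap.comp_apply, h'.map_fn, h.map_fn]

theorem bracket_mem_weight_right {k l w w' : ℤ} {x y : C A} (hx : x ∈ weight A w)
    (hy : y ∈ gr A k l) (h : k + l + w - 2 = w') : C.bracket x y ∈ weight A w' :=
  weight_le (S := (weight A w').comap (C.bracket.flip y)) (fun _ _ e _ hz =>
    gr_le_weight (by omega) (bracket_mem_gr hz hy)) hx

theorem pr_bracket {k l k' l' : ℤ} {y : C A} (hy : y ∈ gr A k' l') (x : C A) :
    pr (k + k' - 1) (l + l' - 1) (C.bracket x y) = C.bracket (pr k l x) y := by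
  induction x using C_induction with
  | zero => simp
  | add x x' h h' => simp only [map_add, LinearMap.add_apply, h, h']
  | homogeneous i j x hx =>
    by_cases h : i = k ∧ j = l
    · obtain ⟨rfl, rfl⟩ := h
      rw [pr_of_mem hx, pr_of_mem (bracket_mem_gr hx hy)]
    · rw [pr_of_ne (by omega) hx, pr_of_ne (by omega) (bracket_mem_gr hx hy), map_zero,
        LinearMap.zero_apply]

theorem eq_zero_of_contract_eq_zero {l : ℕ} {η : DiffForm A (l + 1)}
    (h : ∀ X, η.contract X = 0) : η = 0 :=
  diffForm_ext (forms_ext l fun X => congrFun (congrArg Subtype.val (h X)) l)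

/-- Induction on the weight. Brackets with f, dg and X lower the weight, so by induction L x - x has
zero bracket with all of them. Commuting with f and dg kills its components of positive order; what
remains is a form, and its contractions with all X vanish. Neither multiplicativity of L nor
generators of the algebra `C` are used. -/
theorem IsPoissonEnd.eq_id {L : C A →ₗ[ℝ] C A} (hL : IsPoissonEnd L)
    (hg : ∀ g : A, L (form (dForm g)) = form (dForm g)) (hX : ∀ X, L (vec X) = vec X) (x : C A) :
    L x = x := by
  -- The bound `w < n` turns the induction over integers into one over natural numbers; it starts
  -- with negative weights, where every element is zero.
  have key : ∀ (n : ℕ) (w : ℤ), w < n → ∀ x ∈ weight A w, L x = x := by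
    intro n
    induction n with
    | zero =>
      intro w hw x hx
      refine (LinearMap.mem_eqLocus (f := L) (g := LinearMap.id)).1
        (weight_le (fun k l e y hy => ?_) hx)
      have : y = 0 := by
        by_cases hk : k < 0
        · exact eq_zero_of_mem_gr hk hy
        · exact eq_zero_of_mem_gr' (by push_cast at hw; omega) hy
      rw [this]; exact zero_mem _
    | succ n ih =>
      intro w hw x hx
      -- The bracket {x, z} has weight w + (k + l) - 2 < w, so L fixes it: {L x, z} = {L x, L z} = L
      -- {x, z} = {x, z}.
      have hb : ∀ (k l : ℤ) (z : C A), z ∈ gr A k l → k + l < 2 → L z = z →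
          C.bracket (L x - x) z = 0 := by
        intro k l z hz hkl e
        have h1 := ih _ (by push_cast at hw; omega) _ (bracket_mem_weight_right hx hz rfl)
        rw [hL.map_bracket, e] at h1
        rw [map_sub, LinearMap.sub_apply, h1, sub_self]
      have hpr : ∀ k l : ℤ, ¬(k = 0 ∧ l = w) → pr k l (L x - x) = 0 := by
        intro k l hkl
        by_cases hw' : k + l = w
        · by_cases hk : k < 0
          · exact eq_zero_of_mem_gr hk (pr_mem k l _)
          refine eq_zero_of_bracket_eq_zero (by omega) (pr_mem k l _) (fun f => ?_) (fun g => ?_)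
          · rw [← pr_bracket (fn_mem_gr f), hb 0 0 _ (fn_mem_gr f) (by norm_num) (hL.map_fn f),
              map_zero]
          · rw [← pr_bracket (form_mem_gr _), hb 0 1 _ (form_mem_gr _) (by norm_num) (hg g),
              map_zero]
        · exact pr_of_mem_weight hw' (sub_mem (hL.map_weight w x hx) hx)
      have hy : L x - x = pr 0 w (L x - x) := by
        rw [← sub_eq_zero]
        refine eq_zero_of_pr fun k l => ?_
        rw [map_sub]
        by_cases h : k = 0 ∧ l = w
        · obtain ⟨rfl, rfl⟩ := h
          rw [pr_of_mem (pr_mem _ _ _), sub_self]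
        · rw [hpr k l h, pr_of_ne (by omega) (pr_mem 0 w _), sub_self]
      have hmem : L x - x ∈ gr A 0 w := by rw [hy]; exact pr_mem 0 w _
      -- Weight zero is separate because a form of degree zero cannot be contracted; there L is the
      -- identity by assumption.
      rcases lt_trichotomy w 0 with h0 | h0 | h0
      · exact ih w (by omega) x hx
      · subst h0
        -- in weight zero there are only functions on the base
        refine (LinearMap.mem_eqLocus (f := L) (g := LinearMap.id)).1
          (weight_le (fun k l e y hy => ?_) hx)
        by_cases hk : k = 0
        · obtain ⟨f, rfl⟩ := exists_fn_eq (gr_cast hk (by omega) hy)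
          exact hL.map_fn f
        · have : y = 0 := by
            by_cases hk : k < 0
            · exact eq_zero_of_mem_gr hk hy
            · exact eq_zero_of_mem_gr' (by omega) hy
          rw [this]; exact zero_mem _
      · obtain ⟨l, rfl⟩ : ∃ l : ℕ, w = (l + 1 : ℕ) := ⟨(w - 1).toNat, by omega⟩
        obtain ⟨η, hη⟩ := exists_form_eq hmem
        have : η = 0 := eq_zero_of_contract_eq_zero fun X => form_eq_zero (by
          rw [← bracket_vec_form, bracket_swap (vec_mem_gr X) (form_mem_gr η), hη,
            hb 1 0 _ (vec_mem_gr X) (by norm_num) (hX X), smul_zero, neg_zero])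
        rw [this] at hη
        rw [← sub_eq_zero, ← hη, form_zero]
  induction x using C_induction with
  | zero => exact map_zero L
  | add x y hx hy => rw [map_add, hx, hy]
  | homogeneous k l x hx =>
    exact key ((k + l).toNat + 1) (k + l) (by push_cast; omega) x (gr_le_weight rfl hx)

end Rigidity

/-! ### Functionals on vector fields that come from 1-forms. -/

section ExactDuals
variable {A : Type*} [CommRing A] [Algebra ℝ A]

variable (A) in
/-- The functionals on vector fields given by `1`-forms: finite sums of `f dg`. -/
def formDual : Submodule A (Module.Dual A (VectorField A)) :=
  Submodule.span A (Set.range differential)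

theorem differential_mem_formDual (g : A) : differential g ∈ formDual A :=
  Submodule.subset_span ⟨g, rfl⟩

theorem wedgeLeft_add_left (α β : Module.Dual A (VectorField A)) (η : Forms A) :
    wedgeLeft (α + β) η = wedgeLeft α η + wedgeLeft β η := by
  funext k
  cases k with
  | zero => exact (add_zero _).symm
  | succ k =>
    change AlternatingMap.alternatizeUncurryFin ((α + β).smulRight (η k)) =
      AlternatingMap.alternatizeUncurryFin (α.smulRight (η k)) +
        AlternatingMap.alternatizeUncurryFin (β.smulRight (η k))
    rw [← AlternatingMap.alternatizeUncurryFin_add]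
    congr 1
    ext1 X
    exact add_smul _ _ _

theorem wedgeLeft_smul_left (f : A) (α : Module.Dual A (VectorField A)) (η : Forms A) :
    wedgeLeft (f • α) η = f • wedgeLeft α η := by
  funext k
  cases k with
  | zero => exact (smul_zero (M := A) (A := AltForm A 0) _).symm
  | succ k =>
    change AlternatingMap.alternatizeUncurryFin ((f • α).smulRight (η k)) =
      f • AlternatingMap.alternatizeUncurryFin (α.smulRight (η k))
    rw [← AlternatingMap.alternatizeUncurryFin_smul]
    congr 1
    ext1 X
    exact mul_smul f (α X) (η k)

theorem wedgeLeft_mem_of_mem_formDual {α : Module.Dual A (VectorField A)} (hα : α ∈ formDual A)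
    {l : ℕ} {x : Forms A} (hx : x ∈ OmegaDeg A l) : wedgeLeft α x ∈ OmegaDeg A (l + 1) := by
  unfold formDual at hα
  induction hα using Submodule.span_induction with
  | mem α hα =>
    obtain ⟨g, rfl⟩ := hα
    exact wedgeLeft_mem_deg g hx
  | zero =>
    have : wedgeLeft (0 : Module.Dual A (VectorField A)) x = 0 := by
      have := wedgeLeft_smul_left 0 (0 : Module.Dual A (VectorField A)) x
      rwa [zero_smul, zero_smul] at this
    rw [this]; exact zero_mem _
  | add α β _ _ h h' => rw [wedgeLeft_add_left]; exact add_mem h h'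
  | smul f α _ h => rw [wedgeLeft_smul_left]; exact Submodule.smul_mem _ f h

theorem omegaDeg_induction {l : ℕ} {p : DiffForm A l → Prop} (η : DiffForm A l) (zero : p 0)
    (wedgeList : ∀ (gs : List A) (h : gs.length = l),
      p ⟨wedgeList gs, Submodule.subset_span ⟨gs, h, rfl⟩⟩)
    (add : ∀ η ζ, p η → p ζ → p (η + ζ)) (smul : ∀ (f : A) η, p η → p (f • η)) : p η := by
  obtain ⟨η, hη⟩ := η
  induction hη using Submodule.span_induction with
  | mem x hx =>
    obtain ⟨gs, hgs, rfl⟩ := hx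
    exact wedgeList gs hgs
  | zero => exact zero
  | add x y hx hy h h' => exact add ⟨x, hx⟩ ⟨y, hy⟩ h h'
  | smul f x hx h => exact smul f ⟨x, hx⟩ h

theorem toDual_dForm (g : A) : (dForm g).toDual = differential g := by
  ext X
  have h := congrFun (contract_wedgeLeft X (differential g) oneForm) 0
  have h2 := congrArg (fun ζ : AltForm A 0 => ζ ![]) h
  refine h2.trans ?_
  change differential g X * 1 - 0 = differential g X
  rw [mul_one, sub_zero]

/-- Over a general algebra a functional on derivations need not come from a 1-form, so membership in
`formDual` has to be carried through all constructions with η~ and T. -/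
theorem toDual_mem_formDual (α : DiffForm A 1) : α.toDual ∈ formDual A := by
  induction α using omegaDeg_induction with
  | zero => exact zero_mem _
  | wedgeList gs h =>
    obtain ⟨g, rfl⟩ := List.length_eq_one_iff.1 h
    exact (toDual_dForm g).symm ▸ differential_mem_formDual g
  | add η ζ h h' => exact add_mem h h'
  | smul f η h => exact Submodule.smul_mem _ f h

theorem toDual_injective {α β : DiffForm A 1} (h : α.toDual = β.toDual) : α = β :=
  diffForm_ext (by
    ext v
    have := LinearMap.congr_fun h (v 0)
    change α.1 1 (Matrix.vecCons (v 0) ![]) = β.1 1 (Matrix.vecCons (v 0) ![]) at this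
    convert this using 2 <;> · funext i; fin_cases i; rfl)

theorem flat_apply (η : DiffForm A 2) (X : VectorField A) : flat η X = (η.contract X).toDual := rfl

theorem flat_mem_formDual (η : DiffForm A 2) (X : VectorField A) : flat η X ∈ formDual A := by
  rw [flat_apply]; exact toDual_mem_formDual _

theorem flat_add (η ζ : DiffForm A 2) : flat (η + ζ) = flat η + flat ζ := rfl

theorem flat_neg (η : DiffForm A 2) : flat (-η) = -flat η := rfl

theorem flat_sub (η ζ : DiffForm A 2) : flat (η - ζ) = flat η - flat ζ := rfl

theorem flat_smul (f : A) (η : DiffForm A 2) : flat (f • η) = f • flat η := rfl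

theorem flat_swap (η : DiffForm A 2) (X Y : VectorField A) : flat η X Y = -flat η Y X :=
  congrArg (fun ζ : AltForm A 0 => ζ ![]) (curryLeft_swap (η.1 2) X Y)

theorem flat_injective {η ζ : DiffForm A 2} (h : flat η = flat ζ) : η = ζ := by
  rw [← sub_eq_zero]
  refine eq_zero_of_contract_eq_zero fun X => toDual_injective ?_
  rw [← flat_apply, flat_sub, h]
  exact LinearMap.congr_fun (sub_self (flat ζ)) X

theorem exists_flat_eq_wedge {α β : Module.Dual A (VectorField A)} (hα : α ∈ formDual A)
    (hβ : β ∈ formDual A) : ∃ ζ : DiffForm A 2, ∀ X, flat ζ X = α X • β - β X • α := by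
  have h1 : (oneForm : Forms A) ∈ OmegaDeg A 0 := Submodule.subset_span ⟨[], rfl, rfl⟩
  refine ⟨⟨_, wedgeLeft_mem_of_mem_formDual hα (wedgeLeft_mem_of_mem_formDual hβ h1)⟩,
    fun X => ?_⟩
  ext Y
  have e1 := contract_wedgeLeft X α (wedgeLeft β oneForm)
  have e2 : contract Y (contract X (wedgeLeft α (wedgeLeft β oneForm))) =
      (α X * β Y - β X * α Y) • oneForm := by
    rw [e1, contract_wedgeLeft, contract_oneForm, map_zero, sub_zero, map_sub, map_smul,
      contract_wedgeLeft, map_smul, map_smul, contract_wedgeLeft, contract_oneForm, map_zero,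
      map_zero, sub_zero, sub_zero, smul_smul, smul_smul]
    funext k
    exact (altForm_sub_smul _ _ _).symm
  refine (congrArg (fun ζ : Forms A => ζ 0 ![]) e2).trans ?_
  exact mul_one _

theorem flat_wedgeList (g h : A) (hs : [g, h].length = 2) (X : VectorField A) :
    flat (⟨wedgeList [g, h], Submodule.subset_span ⟨_, hs, rfl⟩⟩ : DiffForm A 2) X =
      X g • differential h - X h • differential g := by
  ext Y
  have e2 : contract Y (contract X (wedgeLeft (differential g) (wedgeLeft (differential h)
      oneForm))) = (X g * Y h - X h * Y g) • oneForm := by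
    have d : ∀ (X : VectorField A) g, differential g X = X g := fun _ _ => rfl
    rw [contract_wedgeLeft, contract_wedgeLeft, contract_oneForm, map_zero, sub_zero, map_sub,
      map_smul, contract_wedgeLeft, map_smul, map_smul, contract_wedgeLeft, contract_oneForm,
      map_zero, map_zero, sub_zero, sub_zero, smul_smul, smul_smul, d, d, d, d]
    funext k
    exact (altForm_sub_smul _ _ _).symm
  refine (congrArg (fun ζ : Forms A => ζ 0 ![]) e2).trans ?_
  exact mul_one _

/-- This finite-rank expression replaces a local frame: it reduces the inversion of 1 - π~ η~ on
1-forms to finitely many functionals. -/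
theorem exists_flat_eq_sum (η : DiffForm A 2) : ∃ (ι : Type) (_ : Fintype ι)
    (α β : ι → Module.Dual A (VectorField A)), (∀ i, α i ∈ formDual A) ∧
      ∀ X, flat η X = ∑ i, α i X • β i := by
  induction η using omegaDeg_induction with
  | zero => exact ⟨Empty, inferInstance, Empty.elim, Empty.elim, fun i => i.elim, fun X => rfl⟩
  | wedgeList gs hs =>
    obtain ⟨g, h, rfl⟩ := List.length_eq_two.1 hs
    refine ⟨Fin 2, inferInstance, ![differential g, differential h],
      ![differential h, -differential g], fun i => ?_, fun X => ?_⟩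
    · fin_cases i
      · exact differential_mem_formDual g
      · exact differential_mem_formDual h
    · rw [flat_wedgeList g h hs, Fin.sum_univ_two]
      change _ = X g • differential h + X h • -differential g
      rw [smul_neg, sub_eq_add_neg]
  | add η ζ h h' =>
    obtain ⟨ι, _, α, β, h1, h2⟩ := h
    obtain ⟨κ, _, α', β', h1', h2'⟩ := h'
    refine ⟨ι ⊕ κ, inferInstance, Sum.elim α α', Sum.elim β β', fun i => ?_, fun X => ?_⟩
    · cases i with
      | inl i => exact h1 i
      | inr i => exact h1' i
    · rw [flat_add, LinearMap.add_apply, h2, h2', Fintype.sum_sum_type]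
      rfl
  | smul f η h =>
    obtain ⟨ι, _, α, β, h1, h2⟩ := h
    refine ⟨ι, inferInstance, α, fun i => f • β i, h1, fun X => ?_⟩
    rw [flat_smul, LinearMap.smul_apply, h2, Finset.smul_sum]
    exact Finset.sum_congr rfl fun i _ => smul_comm _ _ _

/-- If `S = 1 + S P F = 1 + P F S` with `F` given by a `2`-form, then the transpose of `S` preserves
the functionals given by `1`-forms. -/
theorem comp_mem_formDual (η : DiffForm A 2)
    (P : Module.Dual A (VectorField A) →ₗ[A] VectorField A) (S : Module.End A (VectorField A))
    (h1 : ∀ X, S X = X + S (P (flat η X))) (h2 : ∀ X, S X = X + P (flat η (S X)))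
    {α : Module.Dual A (VectorField A)} (hα : α ∈ formDual A) : α ∘ₗ S ∈ formDual A := by
  classical
  obtain ⟨ι, _, a, b, ha, hab⟩ := exists_flat_eq_sum η
  -- By S = 1 + S P η~, each a_i ∘ S is a combination of the a_j, with the functions a_i (S P b_j)
  -- as coefficients.
  have h3 : ∀ i X, a i (S X) = a i X + ∑ j, a j X * a i (S (P (b j))) := by
    intro i X
    conv_lhs => rw [h1, hab]
    simp [map_sum]
  -- By S = 1 + P η~ S, the functional α ∘ S is α plus a combination of the a_i ∘ S, which `h3` has
  -- already expressed through 1-forms.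
  have : α ∘ₗ S = α + ∑ i, α (P (b i)) • (a i + ∑ j, a i (S (P (b j))) • a j) := by
    ext X
    rw [LinearMap.comp_apply, h2, hab]
    simp only [map_add, map_sum, map_smul, LinearMap.add_apply, LinearMap.sum_apply,
      LinearMap.smul_apply, smul_eq_mul]
    congr 1
    refine Finset.sum_congr rfl fun i _ => ?_
    rw [h3, mul_comm]
    congr 2
    exact Finset.sum_congr rfl fun j _ => mul_comm _ _
  rw [this]
  exact add_mem hα (sum_mem fun i _ => Submodule.smul_mem _ _ (add_mem (ha i)
    (sum_mem fun j _ => Submodule.smul_mem _ _ (ha j))))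

end ExactDuals

/-! ### Linear algebra of T, existence of the transformed bivector field and 2-form, pullbacks. -/

section GaugeAlgebra
variable {A : Type*} [CommRing A] [Algebra ℝ A]

theorem T_neg_apply (π : Bivector A) (η : DiffForm A 2) (X : VectorField A) :
    T (-π) η X = X - sharp π (flat η X) := by
  rw [T, sharp_neg, sub_eq_add_neg]
  rfl

/-- Both π~ and η~ are skew, so the transpose of 1 - π~ η~ is 1 - η~ π~. -/
theorem dual_T (π : Bivector A) (η : DiffForm A 2) (α : Module.Dual A (VectorField A)) :
    α ∘ₗ T (-π) η = α - flat η (sharp π α) := by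
  ext X
  rw [LinearMap.comp_apply, T_neg_apply, map_sub, dual_sharp, flat_swap, LinearMap.sub_apply]
  ring

variable {π : Bivector A} {η : DiffForm A 2}

/-- The inverse of `T(-π, η) = 1 - π~ η~`. -/
noncomputable def invT (π : Bivector A) (η : DiffForm A 2) : Module.End A (VectorField A) :=
  Ring.inverse (T (-π) η)

theorem T_invT (h : IsUnit (T (-π) η)) (X : VectorField A) : T (-π) η (invT π η X) = X :=
  LinearMap.congr_fun (Ring.mul_inverse_cancel _ h) X

theorem invT_T (h : IsUnit (T (-π) η)) (X : VectorField A) : invT π η (T (-π) η X) = X :=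
  LinearMap.congr_fun (Ring.inverse_mul_cancel _ h) X

theorem invT_eq_left (h : IsUnit (T (-π) η)) (X : VectorField A) :
    invT π η X = X + sharp π (flat η (invT π η X)) := by
  have := T_invT h X
  rw [T_neg_apply] at this
  exact sub_eq_iff_eq_add.1 this

theorem invT_eq_right (h : IsUnit (T (-π) η)) (X : VectorField A) :
    invT π η X = X + invT π η (sharp π (flat η X)) := by
  have := invT_T h X
  rw [T_neg_apply, map_sub] at this
  exact sub_eq_iff_eq_add.1 this

theorem dual_comp_T_mem {α : Module.Dual A (VectorField A)} (hα : α ∈ formDual A) :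
    α ∘ₗ T (-π) η ∈ formDual A := by
  rw [dual_T]; exact sub_mem hα (flat_mem_formDual η _)

theorem dual_comp_invT_mem (h : IsUnit (T (-π) η)) {α : Module.Dual A (VectorField A)}
    (hα : α ∈ formDual A) : α ∘ₗ invT π η ∈ formDual A :=
  comp_mem_formDual η (sharp π) (invT π η) (invT_eq_right h) (invT_eq_left h) hα

/-- With T^* the transpose, π~ T^* = π~ - π~ η~ π~ = T π~; inverting T gives the claim. The
companion for η~ comes from T^* η~ = η~ T in the same way. -/
theorem sharp_comp_invT (h : IsUnit (T (-π) η)) (α : Module.Dual A (VectorField A)) :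
    sharp π (α ∘ₗ invT π η) = invT π η (sharp π α) := by
  have e : α = (α ∘ₗ invT π η) ∘ₗ T (-π) η := LinearMap.ext fun X => by
    rw [LinearMap.comp_apply, LinearMap.comp_apply, invT_T h]
  conv_rhs => rw [e, dual_T, map_sub, ← T_neg_apply, invT_T h]

theorem flat_comp_invT (h : IsUnit (T (-π) η)) (X : VectorField A) :
    flat η X ∘ₗ invT π η = flat η (invT π η X) := by
  ext Y
  have e : flat η X = flat η (invT π η X) ∘ₗ T (-π) η := by
    conv_lhs => rw [← T_invT h X, T_neg_apply, map_sub]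
    rw [dual_T]
  rw [e, LinearMap.comp_apply, LinearMap.comp_apply, T_invT h]

/-- The factor 1 - η~ π~ to be inverted is the transpose of T, hence a unit whose inverse is the
transpose of T⁻¹, and `Ring.inverse` does not take its default value 0. Then T⁻¹ is moved across π~.
-/
theorem isTauBivector_iff (h : IsUnit (T (-π) η)) {π' : Bivector A} :
    IsTauBivector (-η) π π' ↔ ∀ α, sharp π' α = invT π η (sharp π α) := by
  have e : (1 + flat (-η) ∘ₗ sharp π : Module.End A (Module.Dual A (VectorField A))) =
      (T (-π) η).dualMap := by
    ext1 α
    change α + flat (-η) (sharp π α) = α ∘ₗ T (-π) η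
    rw [dual_T, flat_neg, LinearMap.neg_apply, sub_eq_add_neg]
  have e2 : Ring.inverse ((T (-π) η).dualMap : Module.End A (Module.Dual A (VectorField A))) =
      (invT π η).dualMap := by
    refine Ring.inverse_unit (⟨(T (-π) η).dualMap, (invT π η).dualMap, ?_, ?_⟩ :
      (Module.End A (Module.Dual A (VectorField A)))ˣ)
    · ext α X
      exact congrArg α (invT_T h X)
    · ext α X
      exact congrArg α (T_invT h X)
  unfold IsTauBivector
  rw [e, e2]
  constructor
  · intro h' α
    rw [h', ← sharp_comp_invT h]
    rfl
  · intro h'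
    ext1 α
    rw [h', ← sharp_comp_invT h]
    rfl

theorem exists_sharp_eq_conj (g : Module.End A (VectorField A)) (π : Bivector A) :
    ∃ ρ : Bivector A, ∀ α, sharp ρ α = g (sharp π (α ∘ₗ g)) := by
  induction π using bivector_induction with
  | h1 X Y =>
    exact ⟨wedge (g X) (g Y), fun α => by
      simp only [sharp_wedge, map_sub, map_smul, LinearMap.comp_apply]⟩
  | h2 π ρ h h' =>
    obtain ⟨π', h⟩ := h
    obtain ⟨ρ', h'⟩ := h'
    exact ⟨π' + ρ', fun α => by
      simp only [sharp_add, LinearMap.add_apply, map_add, h, h']⟩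

/-- Pushing η forward along the skew map Q sends dg ∧ dh, up to sign, to Q(dg) ∧ Q(dh). -/
theorem exists_sharp_eq_form (η : DiffForm A 2)
    (Q : Module.Dual A (VectorField A) →ₗ[A] VectorField A) 
    (hQ : ∀ α β : Module.Dual A (VectorField A), β (Q α) = -α (Q β)) :
    ∃ ρ : Bivector A, ∀ α, sharp ρ α = Q (flat η (Q α)) := by
  induction η using omegaDeg_induction with
  | zero =>
    refine ⟨wedge 0 0, fun α => ?_⟩
    rw [sharp_wedge]
    change _ = Q 0
    simp
  | wedgeList gs hs =>
    obtain ⟨g, h, rfl⟩ := List.length_eq_two.1 hs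
    refine ⟨wedge (Q (differential h)) (Q (differential g)), fun α => ?_⟩
    have e : ∀ g, (Q α) g = -α (Q (differential g)) := fun g => hQ α (differential g)
    rw [sharp_wedge, flat_wedgeList g h hs, map_sub, map_smul, map_smul, e, e]
    module
  | add η ζ h h' =>
    obtain ⟨π', h⟩ := h
    obtain ⟨ρ', h'⟩ := h'
    exact ⟨π' + ρ', fun α => by
      simp only [sharp_add, flat_add, LinearMap.add_apply, map_add, h, h']⟩
  | smul f η h =>
    obtain ⟨π', h⟩ := h
    exact ⟨f • π', fun α => by
      simp only [sharp_smul, flat_smul, LinearMap.smul_apply, map_smul, h]⟩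

theorem exists_flat_eq_bivector (π : Bivector A)
    (N : VectorField A →ₗ[A] Module.Dual A (VectorField A)) (hN : ∀ X Y, N X Y = -N Y X)
    (hN' : ∀ X, N X ∈ formDual A) :
    ∃ ζ : DiffForm A 2, ∀ X, flat ζ X = N (sharp π (N X)) := by
  induction π using bivector_induction with
  | h1 X Y =>
    obtain ⟨ζ, hζ⟩ := exists_flat_eq_wedge (hN' Y) (hN' X)
    refine ⟨ζ, fun Z => ?_⟩
    rw [hζ, sharp_wedge, map_sub, map_smul, map_smul, hN Y Z, hN X Z]
    module
  | h2 π ρ h h' =>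
    obtain ⟨π', h⟩ := h
    obtain ⟨ρ', h'⟩ := h'
    exact ⟨π' + ρ', fun α => by
      simp only [sharp_add, flat_add, LinearMap.add_apply, map_add, h, h']⟩

/-- With S = T⁻¹ and its transpose S^*, write S π~ = S (1 - π~ η~) S π~ = S π~ S^* - (S π~) η~ (S
π~). The first term is the image of π under S and the second is the image of η under the skew map S
π~, so both are bivector fields. -/
theorem exists_isTauBivector (h : IsUnit (T (-π) η)) : ∃ π', IsTauBivector (-η) π π' := by
  obtain ⟨ρ₁, h1⟩ := exists_sharp_eq_conj (invT π η) π
  obtain ⟨ρ₂, h2⟩ := exists_sharp_eq_form η (invT π η ∘ₗ sharp π) (fun α β => by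
    rw [LinearMap.comp_apply, LinearMap.comp_apply, ← sharp_comp_invT h β, dual_sharp,
      neg_neg]
    rfl)
  refine ⟨ρ₁ - ρ₂, (isTauBivector_iff h).2 fun α => ?_⟩
  have e : ρ₁ - ρ₂ = ρ₁ + -ρ₂ := sub_eq_add_neg _ _
  rw [e, sharp_add, sharp_neg, LinearMap.add_apply, LinearMap.neg_apply, h1, h2,
    sharp_comp_invT h, LinearMap.comp_apply, LinearMap.comp_apply, ← sub_eq_add_neg, ← map_sub,
    ← T_neg_apply, invT_T h]

/-- The pullback of forms by an endomorphism of the module of vector fields. -/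
def pull (g : Module.End A (VectorField A)) : Forms A →ₗ[A] Forms A where
  toFun η k := (η k).compLinearMap g
  map_add' _ _ := rfl
  map_smul' _ _ := rfl

theorem pull_wedgeLeft (g : Module.End A (VectorField A)) (α : Module.Dual A (VectorField A))
    (η : Forms A) : pull g (wedgeLeft α η) = wedgeLeft (α ∘ₗ g) (pull g η) := by
  funext k
  cases k with
  | zero => rfl
  | succ k =>
    ext v
    change AlternatingMap.alternatizeUncurryFin (α.smulRight (η k)) (fun i => g (v i)) =
      AlternatingMap.alternatizeUncurryFin ((α ∘ₗ g).smulRight ((η k).compLinearMap g)) v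
    rw [AlternatingMap.alternatizeUncurryFin_apply, AlternatingMap.alternatizeUncurryFin_apply]
    rfl

theorem contract_pull (g : Module.End A (VectorField A)) (X : VectorField A) (η : Forms A) :
    contract X (pull g η) = pull g (contract (g X) η) := by
  funext k
  ext v
  change η (k + 1) (fun i => g (Matrix.vecCons X v i)) =
    η (k + 1) (Matrix.vecCons (g X) fun i => g (v i))
  congr 1
  funext i
  refine Fin.cases rfl (fun i => rfl) i

theorem pull_oneForm (g : Module.End A (VectorField A)) : pull g (oneForm : Forms A) = oneForm := by
  funext k
  cases k with
  | zero => rfl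
  | succ k => rfl

theorem pull_pull (g h : Module.End A (VectorField A)) (η : Forms A) :
    pull g (pull h η) = pull (h * g) η := rfl

theorem pull_one (η : Forms A) : pull 1 η = η := rfl

/-- Endomorphisms of the module of vector fields whose transpose preserves `1`-forms. -/
def PreservesForms (g : Module.End A (VectorField A)) : Prop :=
  ∀ α ∈ formDual A, α ∘ₗ g ∈ formDual A

theorem pull_mem_deg {g : Module.End A (VectorField A)} (hg : PreservesForms g) {l : ℕ}
    {x : Forms A} (hx : x ∈ OmegaDeg A l) : pull g x ∈ OmegaDeg A l := by
  induction hx using Submodule.span_induction with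
  | mem x hx =>
    obtain ⟨gs, rfl, rfl⟩ := hx
    induction gs with
    | nil => rw [wedgeList, pull_oneForm]; exact wedgeList_mem []
    | cons f gs ih =>
      rw [wedgeList, pull_wedgeLeft]
      exact wedgeLeft_mem_of_mem_formDual (hg _ (differential_mem_formDual f)) ih
  | zero => rw [map_zero]; exact zero_mem _
  | add x y _ _ h h' => rw [map_add]; exact add_mem h h'
  | smul f x _ h => rw [map_smul]; exact Submodule.smul_mem _ f h

theorem pull_mem {g : Module.End A (VectorField A)} (hg : PreservesForms g)
    {x : Forms A} (hx : x ∈ Omega A) : pull g x ∈ Omega A := by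
  induction hx using Submodule.span_induction with
  | mem x hx =>
    obtain ⟨gs, rfl⟩ := hx
    exact omegaDeg_le _ (pull_mem_deg hg (wedgeList_mem gs))
  | zero => rw [map_zero]; exact zero_mem _
  | add x y _ _ h h' => rw [map_add]; exact add_mem h h'
  | smul f x _ h => rw [map_smul]; exact Submodule.smul_mem _ f h

/-- The pullback of a differential form of degree `l`. -/
def DiffForm.pull {g : Module.End A (VectorField A)} (hg : PreservesForms g) {l : ℕ}
    (η : DiffForm A l) : DiffForm A l := ⟨TwistedPoisson.pull g η.1, pull_mem_deg hg η.2⟩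

theorem flat_pull {g : Module.End A (VectorField A)} (hg : PreservesForms g) (η : DiffForm A 2)
    (X : VectorField A) : flat (η.pull hg) X = flat η (g X) ∘ₗ g := by
  ext Y
  have e : contract Y (contract X (pull g η.1)) = pull g (contract (g Y) (contract (g X) η.1)) := by
    rw [contract_pull, contract_pull]
  refine (congrArg (fun ζ : Forms A => ζ 0 ![]) e).trans ?_
  change (contract (g Y) (contract (g X) η.1)) 0 _ = (contract (g Y) (contract (g X) η.1)) 0 _
  congr 1
  exact Subsingleton.elim _ _

theorem toDual_pull {g : Module.End A (VectorField A)} (hg : PreservesForms g) (α : DiffForm A 1) :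
    (α.pull hg).toDual = α.toDual ∘ₗ g := by
  ext X
  refine (congrArg (fun ζ : Forms A => ζ 0 ![]) (contract_pull g X α.1)).trans ?_
  change (contract (g X) α.1) 0 _ = (contract (g X) α.1) 0 _
  congr 1
  exact Subsingleton.elim _ _

theorem isTauForm_iff {η' : DiffForm A 2} :
    IsTauForm (-π) η η' ↔ ∀ X, flat η' X = flat η (invT π η X) :=
  LinearMap.ext_iff

theorem preservesForms_T : PreservesForms (T (-π) η) := fun _ hα => dual_comp_T_mem hα

theorem preservesForms_invT (h : IsUnit (T (-π) η)) : PreservesForms (invT π η) :=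
  fun _ hα => dual_comp_invT_mem h hα

/-- The dual splitting is η~ S = S^* η~ S - (η~ S) π~ (η~ S): the pullback of η by S minus the
pullback of π by the skew map η~ S. -/
theorem exists_isTauForm (h : IsUnit (T (-π) η)) : ∃ η', IsTauForm (-π) η η' := by
  obtain ⟨ζ, hζ⟩ := exists_flat_eq_bivector π (flat η ∘ₗ invT π η) (fun X Y => by
    rw [LinearMap.comp_apply, LinearMap.comp_apply, ← flat_comp_invT h Y, flat_swap]
    rfl) (fun X => flat_mem_formDual _ _)
  refine ⟨η.pull (preservesForms_invT h) - ζ, isTauForm_iff.2 fun X => ?_⟩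
  rw [flat_sub, LinearMap.sub_apply, flat_pull, hζ, LinearMap.comp_apply, LinearMap.comp_apply,
    flat_comp_invT h, ← map_sub, ← map_sub, ← T_neg_apply, T_invT h]

theorem existsUnique_isTauForm (h : IsUnit (T (-π) η)) : ∃! η', IsTauForm (-π) η η' := by
  obtain ⟨η', h'⟩ := exists_isTauForm h
  exact ⟨η', h', fun ζ hζ => flat_injective (hζ.trans h'.symm)⟩

end GaugeAlgebra

/-! ### Lifting bundle automorphisms to `C` by conjugation with pullbacks. -/

section Lift
variable {A : Type*} [CommRing A] [Algebra ℝ A]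

/-- The pullback as an operator on `Ω`. -/
def pullOp {g : Module.End A (VectorField A)} (hg : PreservesForms g) : Op A where
  toFun x := ⟨pull g x.1, pull_mem hg x.2⟩
  map_add' x y := Subtype.ext (map_add (pull g) x.1 y.1)
  map_smul' c x := Subtype.ext ((pull g).map_smul_of_tower c x.1)

theorem pullOp_degree {g : Module.End A (VectorField A)} (hg : PreservesForms g) :
    pullOp hg ∈ HasDegree A 0 := by
  intro l x hx j hj
  change (x.1 j).compLinearMap g = 0
  rw [hx j (by omega)]
  rfl

theorem pullOp_opFun {g : Module.End A (VectorField A)} (hg : PreservesForms g) (f : A) :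
    pullOp hg * opFun f = opFun f * pullOp hg :=
  LinearMap.ext fun x => Subtype.ext (map_smul (pull g) f x.1)

theorem pullOp_one {g : Module.End A (VectorField A)} (hg : PreservesForms g) :
    pullOp hg (DiffForms.one A) = DiffForms.one A :=
  Subtype.ext (pull_oneForm g)

variable {a b : Module.End A (VectorField A)}

theorem pullOp_mul_pullOp (h : b * a = 1) (ha : PreservesForms a) (hb : PreservesForms b) :
    pullOp ha * pullOp hb = 1 :=
  LinearMap.ext fun x => Subtype.ext (by
    change pull a (pull b x.1) = x.1
    rw [pull_pull, h, pull_one])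

/-- The conjugate is the wedge product with dg ∘ b. This commutes with functions and anticommutes
with every dh, so it has order zero although dg ∘ b need not be exact. -/
theorem pullOp_opD_pullOp_mem (h : a * b = 1) (ha : PreservesForms a) (hb : PreservesForms b)
    (g : A) : pullOp hb * opD g * pullOp ha ∈ OrdLT A 1 1 := by
  have e : ∀ x : DiffForms A, ((pullOp hb * opD g * pullOp ha) x).1 =
      wedgeLeft (differential g ∘ₗ b) x.1 := fun x => by
    change pull b (wedgeLeft (differential g) (pull a x.1)) = _
    rw [pull_wedgeLeft, pull_pull, h, pull_one]
  refine mem_ordLT_succ.2 ⟨?_, fun f => ?_, fun h => ?_⟩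
  · have := hasDegree_mul (hasDegree_mul (pullOp_degree hb) (opD_degree g)) (pullOp_degree ha)
    rwa [zero_add, add_zero] at this
  · rw [mem_ordLT_zero, sub_eq_zero]
    refine LinearMap.ext fun x => Subtype.ext ?_
    rw [Module.End.mul_apply, e]
    change wedgeLeft _ (f • x.1) = f • ((pullOp hb * opD g * pullOp ha) x).1
    rw [e, map_smul]
  · rw [mem_ordLT_zero, zpow_one, neg_one_smul, sub_neg_eq_add, ← eq_neg_iff_add_eq_zero]
    refine LinearMap.ext fun x => Subtype.ext ?_
    rw [Module.End.mul_apply, e]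
    change wedgeLeft _ (wedgeLeft _ x.1) =
      -wedgeLeft (differential h) ((pullOp hb * opD g * pullOp ha) x).1
    rw [e, wedgeLeft_anticomm]

/-- The commutator of the conjugate of P with dg is the conjugate of the commutator of P with a
conjugated dg. The latter has order zero, and by `ordLT_scomm` commutators with any operator of
order zero lower the order. -/
theorem conj_mem (hab : a * b = 1) (hba : b * a = 1) (ha : PreservesForms a)
    (hb : PreservesForms b) (k : ℕ) {m : ℤ} {P : Op A} (hP : P ∈ OrdLT A k m) :
    pullOp ha * P * pullOp hb ∈ OrdLT A k m := by
  induction k generalizing m P with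
  | zero => rw [mem_ordLT_zero.1 hP, mul_zero, zero_mul]; exact zero_mem _
  | succ k ih =>
    have hP' := mem_ordLT_succ.1 hP
    refine mem_ordLT_succ.2 ⟨?_, fun f => ?_, fun g => ?_⟩
    · have := hasDegree_mul (hasDegree_mul (pullOp_degree ha) hP'.1) (pullOp_degree hb)
      rwa [zero_add, add_zero] at this
    · have e : pullOp ha * P * pullOp hb * opFun f - opFun f * (pullOp ha * P * pullOp hb) =
          pullOp ha * (P * opFun f - opFun f * P) * pullOp hb := by
        rw [mul_assoc _ (pullOp hb), pullOp_opFun, ← mul_assoc, ← mul_assoc (opFun f),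
          ← mul_assoc (opFun f), ← pullOp_opFun]
        noncomm_ring
      rw [e]
      exact ih (hP'.2.1 f)
    · have h1 := ordLT_scomm (b := 0) hP (pullOp_opD_pullOp_mem hab ha hb g)
      have e : pullOp ha * P * pullOp hb * opD g - (-1 : ℝ) ^ m • (opD g *
          (pullOp ha * P * pullOp hb)) = pullOp ha * (P * (pullOp hb * opD g * pullOp ha) -
            (-1 : ℝ) ^ (m * 1) • (pullOp hb * opD g * pullOp ha * P)) * pullOp hb := by
        have h2 := pullOp_mul_pullOp hba ha hb
        rw [mul_one, mul_sub, sub_mul, mul_smul_comm, smul_mul_assoc]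
        have e1 : pullOp ha * (P * (pullOp hb * opD g * pullOp ha)) * pullOp hb =
            pullOp ha * P * pullOp hb * opD g * (pullOp ha * pullOp hb) := by noncomm_ring
        have e2 : pullOp ha * (pullOp hb * opD g * pullOp ha * P) * pullOp hb =
            (pullOp ha * pullOp hb) * (opD g * (pullOp ha * P * pullOp hb)) := by noncomm_ring
        rw [e1, e2, h2, mul_one, one_mul]
      rw [e]
      exact ih h1

/-- The action on `C` of conjugation by a pullback. -/
noncomputable def conjLinear (hab : a * b = 1) (hba : b * a = 1) (ha : PreservesForms a)
    (hb : PreservesForms b) : C A →ₗ[ℝ] C A :=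
  C.mapCoeff (fun _ => LinearMap.mulRight ℝ (pullOp hb) ∘ₗ LinearMap.mulLeft ℝ (pullOp ha))
    (fun _ k _ hP => conj_mem hab hba ha hb k hP)

theorem conj_mem_ord (hab : a * b = 1) (hba : b * a = 1) (ha : PreservesForms a)
    (hb : PreservesForms b) {k m : ℤ} {P : Op A} (hP : P ∈ Ord A k m) :
    pullOp ha * P * pullOp hb ∈ Ord A k m := conj_mem hab hba ha hb _ hP

section
variable (hab : a * b = 1) (hba : b * a = 1) (ha : PreservesForms a) (hb : PreservesForms b)

theorem conjLinear_sym {k l : ℤ} {P : Op A} (hP : P ∈ Ord A k (l - k)) :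
    conjLinear hab hba ha hb (sym k l P) = sym k l (pullOp ha * P * pullOp hb) :=
  C.mapCoeff_sym _ _ hP

theorem conjLinear_mem {k l : ℤ} {x : C A} (hx : x ∈ gr A k l) :
    conjLinear hab hba ha hb x ∈ gr A k l := by
  obtain ⟨P, hP, rfl⟩ := hx
  rw [conjLinear_sym hab hba ha hb hP]
  exact sym_mem_gr (conj_mem_ord hab hba ha hb hP)

theorem conjLinear_mul (x y : C A) : conjLinear hab hba ha hb (x * y) =
    conjLinear hab hba ha hb x * conjLinear hab hba ha hb y := by
  induction x using C_induction with
  | zero => simp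
  | add x x' h h' => simp only [add_mul, map_add, h, h']
  | homogeneous k l x hx =>
    induction y using C_induction with
    | zero => simp
    | add y y' h h' => simp only [mul_add, map_add, h, h']
    | homogeneous k' l' y hy =>
      obtain ⟨P, hP, rfl⟩ := hx
      obtain ⟨Q, hQ, rfl⟩ := hy
      have h2 := pullOp_mul_pullOp hab hb ha
      rw [sym_mul hP hQ, conjLinear_sym _ _ _ _ (ord_mul_sym hP hQ), conjLinear_sym _ _ _ _ hP,
        conjLinear_sym _ _ _ _ hQ, sym_mul (conj_mem_ord hab hba ha hb hP)
          (conj_mem_ord hab hba ha hb hQ)]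
      congr 1
      have e : pullOp ha * P * pullOp hb * (pullOp ha * Q * pullOp hb) =
        pullOp ha * P * (pullOp hb * pullOp ha) * Q * pullOp hb := by noncomm_ring
      rw [e, h2, mul_one]
      noncomm_ring

theorem conjLinear_bracket (x y : C A) : conjLinear hab hba ha hb (C.bracket x y) =
    C.bracket (conjLinear hab hba ha hb x) (conjLinear hab hba ha hb y) := by
  induction x using C_induction with
  | zero => simp
  | add x x' h h' => simp only [LinearMap.add_apply, map_add, h, h']
  | homogeneous k l x hx =>
    induction y using C_induction with
    | zero => simp
    | add y y' h h' => simp only [map_add, h, h']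
    | homogeneous k' l' y hy =>
      obtain ⟨P, hP, rfl⟩ := hx
      obtain ⟨Q, hQ, rfl⟩ := hy
      have h2 := pullOp_mul_pullOp hab hb ha
      have e : ∀ P Q, pullOp ha * P * pullOp hb * (pullOp ha * Q * pullOp hb) =
          pullOp ha * (P * Q) * pullOp hb := fun P Q => by
        have e : pullOp ha * P * pullOp hb * (pullOp ha * Q * pullOp hb) =
          pullOp ha * P * (pullOp hb * pullOp ha) * Q * pullOp hb := by noncomm_ring
        rw [e, h2, mul_one]
        noncomm_ring
      rw [bracket_sym hP hQ, conjLinear_sym _ _ _ _ (ord_opComm_sym hP hQ),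
        conjLinear_sym _ _ _ _ hP, conjLinear_sym _ _ _ _ hQ,
        bracket_sym (conj_mem_ord hab hba ha hb hP) (conj_mem_ord hab hba ha hb hQ)]
      congr 1
      rw [opComm, opComm, e, e, mul_sub, sub_mul, mul_smul_comm, smul_mul_assoc]

theorem conjLinear_conjLinear (x : C A) :
    conjLinear hba hab hb ha (conjLinear hab hba ha hb x) = x := by
  induction x using C_induction with
  | zero => simp
  | add x x' h h' => simp only [map_add, h, h']
  | homogeneous k l x hx =>
    obtain ⟨P, hP, rfl⟩ := hx
    have h2 := pullOp_mul_pullOp hab hb ha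
    rw [conjLinear_sym _ _ _ _ hP, conjLinear_sym _ _ _ _ (conj_mem_ord hab hba ha hb hP)]
    congr 1
    have e : pullOp hb * (pullOp ha * P * pullOp hb) * pullOp ha =
      (pullOp hb * pullOp ha) * P * (pullOp hb * pullOp ha) := by noncomm_ring
    rw [e, h2, one_mul, mul_one]

theorem conjLinear_form {l : ℕ} (η : DiffForm A l) :
    conjLinear hab hba ha hb (form η) = form (η.pull ha) := by
  obtain ⟨T, h1, h2⟩ := exists_op η
  rw [form_eq_sym h1 h2, conjLinear_sym _ _ _ _ (mem_ord_zero h1)]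
  refine (form_eq_sym (conj_mem hab hba ha hb _ h1) ?_).symm
  rw [Module.End.mul_apply, Module.End.mul_apply, pullOp_one]
  exact congrArg (pull a) h2

/-- Forms are pulled back by `a` while vector fields are pushed by its inverse `b`; so the lift of
T⁻¹ is obtained with `a` = T and `b` = T⁻¹. -/
theorem conjLinear_vec (X : VectorField A) :
    conjLinear hab hba ha hb (vec X) = vec (b X) := by
  rw [vec_eq_sym, vec_eq_sym, conjLinear_sym _ _ _ _ (opContract_mem_ord X)]
  congr 1
  refine LinearMap.ext fun x => Subtype.ext ?_
  change pull a (contract X (pull b x.1)) = contract (b X) x.1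
  rw [contract_pull, pull_pull, hba, pull_one]

theorem conjLinear_fn (f : A) : conjLinear hab hba ha hb (fn f) = fn f := by
  rw [fn_eq_sym, conjLinear_sym _ _ _ _ (opFun_mem_ord f), pullOp_opFun, mul_assoc,
    pullOp_mul_pullOp hba ha hb, mul_one]

end

theorem fn_one : fn (1 : A) = 1 := by
  have h : ∀ x : C A, fn 1 * x = x := by
    intro x
    induction x using C_induction with
    | zero => simp
    | add x x' h h' => simp only [mul_add, h, h']
    | homogeneous k l x hx =>
      obtain ⟨P, hP, rfl⟩ := hx
      have e : (opFun 1 : Op A) = 1 := LinearMap.ext fun x => one_smul A x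
      rw [fn_eq_sym, sym_mul (opFun_mem_ord 1) hP, zero_add, zero_add, e, one_mul]
  simpa using h 1

theorem mem_weight_map {L : C A →ₗ[ℝ] C A} (hL : ∀ k l x, x ∈ gr A k l → L x ∈ gr A k l)
    {w : ℤ} {x : C A} (hx : x ∈ weight A w) : L x ∈ weight A w :=
  weight_le (S := (weight A w).comap L)
    (fun k l e y hy => gr_le_weight e (hL k l y hy)) hx

theorem mem_filtration_map {L : C A →ₗ[ℝ] C A} (hL : ∀ k l x, x ∈ gr A k l → L x ∈ gr A k l)
    {p : ℤ} {x : C A} (hx : x ∈ filtration A p) : L x ∈ filtration A p :=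
  filtration_le (S := (filtration A p).comap L)
    (fun k l e y hy => gr_le_filtration e (hL k l y hy)) hx

theorem isPoissonEnd_conjLinear (hab : a * b = 1) (hba : b * a = 1) (ha : PreservesForms a)
    (hb : PreservesForms b) : IsPoissonEnd (conjLinear hab hba ha hb) where
  map_bracket := conjLinear_bracket hab hba ha hb
  map_weight _ _ hx := mem_weight_map (fun _ _ _ => conjLinear_mem hab hba ha hb) hx
  map_fn := conjLinear_fn hab hba ha hb

/-- The algebra automorphism with given linear inverse. -/
noncomputable def algEquivOfInverse (L L' : C A →ₗ[ℝ] C A) (h : ∀ x, L' (L x) = x)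
    (h' : ∀ x, L (L' x) = x) (hfn : L (fn 1) = fn 1) (hmul : ∀ x y, L (x * y) = L x * L y) :
    C A ≃ₐ[ℝ] C A :=
  AlgEquiv.ofLinearEquiv (LinearEquiv.ofLinearMap L L' (LinearMap.ext h') (LinearMap.ext h))
    (by rw [fn_one] at hfn; exact hfn) hmul

theorem isGauge_algEquivOfInverse (L L' : C A →ₗ[ℝ] C A) (h : ∀ x, L' (L x) = x)
    (h' : ∀ x, L (L' x) = x) (hfn : L (fn 1) = fn 1) (hmul : ∀ x y, L (x * y) = L x * L y)
    (hL : IsPoissonEnd L) (hL' : IsPoissonEnd L') :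
    IsGauge (algEquivOfInverse L L' h h' hfn hmul) where
  map_bracket := hL.map_bracket
  map_weight w x := ⟨fun hx => by rw [← h x]; exact hL'.map_weight w _ hx, hL.map_weight w x⟩
  map_fn := hL.map_fn

/-- The lift to `C` of the automorphism `b` with inverse `a`. -/
noncomputable def liftEquiv (hab : a * b = 1) (hba : b * a = 1) (ha : PreservesForms a)
    (hb : PreservesForms b) : C A ≃ₐ[ℝ] C A :=
  algEquivOfInverse (conjLinear hab hba ha hb) (conjLinear hba hab hb ha)
    (conjLinear_conjLinear hab hba ha hb) (conjLinear_conjLinear hba hab hb ha)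
    (conjLinear_fn hab hba ha hb 1) (conjLinear_mul hab hba ha hb)

theorem isLift_liftEquiv (hab : a * b = 1) (hba : b * a = 1) (ha : PreservesForms a)
    (hb : PreservesForms b) : IsLift b (liftEquiv hab hba ha hb) where
  isGauge := isGauge_algEquivOfInverse _ _ _ _ _ _ (isPoissonEnd_conjLinear hab hba ha hb)
    (isPoissonEnd_conjLinear hba hab hb ha)
  map_bideg k l x := by
    rw [bideg_eq_gr]
    exact ⟨fun hx => by
      rw [← conjLinear_conjLinear hab hba ha hb x]; exact conjLinear_mem hba hab hb ha hx,
      conjLinear_mem hab hba ha hb⟩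
  map_vec := conjLinear_vec hab hba ha hb

end Lift

/-! ### Exponentials on generators and the fundamental identity. -/

section TwistGenerators
variable {A : Type*} [CommRing A] [Algebra ℝ A]

theorem isTwistable_form (η : DiffForm A 2) : IsTwistable (form η) := Or.inr (form_mem_gr η)

theorem isTwistable_bivec (π : Bivector A) : IsTwistable (bivec π) := Or.inl (bivec_mem_gr π)

theorem isPoissonEnd_twist {a : C A} (ha : IsTwistable a) (h : ∀ f, C.bracket a (fn f) = 0) :
    IsPoissonEnd (twistLinear ha) where
  map_bracket := twist_bracket ha
  map_weight _ _ hx := twist_mem_weight ha hx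
  map_fn f := expEnd_of_eq_zero (h f)

theorem isPoissonEnd_twist_form (η : DiffForm A 2) :
    IsPoissonEnd (twistLinear (isTwistable_form η)) :=
  isPoissonEnd_twist _ (bracket_form_fn η)

theorem isPoissonEnd_twist_bivec (π : Bivector A) :
    IsPoissonEnd (twistLinear (isTwistable_bivec π)) :=
  isPoissonEnd_twist _ (bracket_bivec_fn π)

theorem twist_add {a : C A} (ha : IsTwistable a) (x y : C A) :
    twist a (x + y) = twist a x + twist a y := map_add (twistLinear ha) x y

theorem twist_sub {a : C A} (ha : IsTwistable a) (x y : C A) :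
    twist a (x - y) = twist a x - twist a y := map_sub (twistLinear ha) x y

/-- On vector fields and 1-forms the exponential series stop after the linear term, so the
exponentials act on TM ⊕ T^*M as unipotent block matrices, computed here and in the next three
lemmas. -/
theorem twist_form_form (η : DiffForm A 2) {l : ℕ} (ζ : DiffForm A l) :
    twist (form η) (form ζ) = form ζ := expEnd_of_eq_zero (bracket_form_form η ζ)

theorem twist_form_vec (η : DiffForm A 2) (X : VectorField A) :
    twist (form η) (vec X) = vec X - form (η.contract X) := by
  rw [twist_eq_expEnd, expEnd_of_sq_eq_zero, bracket_form_vec, sub_eq_add_neg]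
  rw [bracket_form_vec, map_neg, bracket_form_form, neg_zero]

theorem twist_bivec_vec (π : Bivector A) (X : VectorField A) :
    twist (bivec π) (vec X) = vec X := expEnd_of_eq_zero (bracket_bivec_vec π X)

theorem twist_bivec_form (π : Bivector A) (α : DiffForm A 1) :
    twist (bivec π) (form α) = form α - vec (sharp π α.toDual) := by
  rw [twist_eq_expEnd, expEnd_of_sq_eq_zero, bracket_bivec_form, sub_eq_add_neg]
  rw [bracket_bivec_form, map_neg, bracket_bivec_vec, neg_zero]

/-- Rigidity replaces the addition law of the exponential: the composite is a Poisson map and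
visibly fixes the generators. -/
theorem twist_neg_form (η : DiffForm A 2) (x : C A) :
    twist (form (-η)) (twist (form η) x) = x := by
  refine ((isPoissonEnd_twist_form (-η)).comp (isPoissonEnd_twist_form η)).eq_id
    (fun g => ?_) (fun X => ?_) x
  · change twist _ (twist _ _) = _
    rw [twist_form_form, twist_form_form]
  · change twist _ (twist _ _) = _
    rw [twist_form_vec, twist_sub (isTwistable_form _), twist_form_vec, twist_form_form]
    have : (-η).contract X = -η.contract X := rfl
    rw [this, form_neg]
    abel

theorem twist_form_neg (η : DiffForm A 2) (x : C A) :
    twist (form η) (twist (form (-η)) x) = x := by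
  have := twist_neg_form (-η) x
  have e : - -η = η := neg_neg η
  rwa [e] at this

theorem twist_neg_bivec (π : Bivector A) (x : C A) :
    twist (bivec (-π)) (twist (bivec π) x) = x := by
  refine ((isPoissonEnd_twist_bivec (-π)).comp (isPoissonEnd_twist_bivec π)).eq_id
    (fun g => ?_) (fun X => ?_) x
  · change twist _ (twist _ _) = _
    rw [twist_bivec_form, twist_sub (isTwistable_bivec _), twist_bivec_form, twist_bivec_vec,
      sharp_neg, LinearMap.neg_apply, vec_neg]
    abel
  · change twist _ (twist _ _) = _
    rw [twist_bivec_vec, twist_bivec_vec]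

theorem twist_bivec_neg (π : Bivector A) (x : C A) :
    twist (bivec π) (twist (bivec (-π)) x) = x := by
  have := twist_neg_bivec (-π) x
  have e : - -π = π := neg_neg π
  rwa [e] at this

/-- The bracket {η, h_d} = -dη is again a form and commutes with η. This is the source of the change
φ ↦ φ - dη. -/
theorem twist_form_hd (η : DiffForm A 2) : twist (form η) (hd A) = hd A - form η.d := by
  have h : C.bracket (form η) (hd A) = -form η.d := by
    rw [bracket_swap_of_even (form_mem_gr η) hd_mem_gr (by decide), bracket_hd_form]
  rw [twist_eq_expEnd, expEnd_of_sq_eq_zero, h, sub_eq_add_neg]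
  rw [h, map_neg, bracket_form_form, neg_zero]

theorem twist_form_hd_add_form (η : DiffForm A 2) (φ : DiffForm A 3) :
    twist (form η) (hd A + form φ) = hd A + form (φ - η.d) := by
  rw [twist_add (isTwistable_form η), twist_form_hd, twist_form_form, form_sub]
  abel

/-- `exp X_η` as an automorphism, for a `2`-form `η`. -/
noncomputable def twistEquiv (η : DiffForm A 2) : C A ≃ₐ[ℝ] C A :=
  algEquivOfInverse (twistLinear (isTwistable_form η)) (twistLinear (isTwistable_form (-η)))
    (twist_neg_form η) (twist_form_neg η) ((isPoissonEnd_twist_form η).map_fn 1)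
    (twist_mul (isTwistable_form η))

theorem isGauge_twistEquiv (η : DiffForm A 2) : IsGauge (twistEquiv η) :=
  isGauge_algEquivOfInverse _ _ _ _ _ _ (isPoissonEnd_twist_form η) (isPoissonEnd_twist_form (-η))

theorem twistEquiv_mem_filtration (η : DiffForm A 2) (p : ℤ) (x : C A) :
    twistEquiv η x ∈ filtration A p ↔ x ∈ filtration A p :=
  ⟨fun hx => by
    rw [← twist_neg_form η x]
    exact twist_mem_filtration (form_mem_gr (-η)) hx,
    fun hx => twist_mem_filtration (form_mem_gr η) hx⟩

theorem IsLift.mem_gr {g : Module.End A (VectorField A)} {Ψ : C A ≃ₐ[ℝ] C A} (h : IsLift g Ψ)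
    {k l : ℤ} {x : C A} (hx : x ∈ gr A k l) : Ψ x ∈ gr A k l := by
  by_cases hk : k < 0
  · rw [eq_zero_of_mem_gr hk hx, map_zero]; exact zero_mem _
  lift k to ℕ using by omega
  rw [← bideg_eq_gr] at hx ⊢
  exact (h.map_bideg k l x).2 hx

theorem IsLift.symm_mem_gr {g : Module.End A (VectorField A)} {Ψ : C A ≃ₐ[ℝ] C A} (h : IsLift g Ψ)
    {k l : ℤ} {x : C A} (hx : x ∈ gr A k l) : Ψ.symm x ∈ gr A k l := by
  by_cases hk : k < 0
  · rw [eq_zero_of_mem_gr hk hx, map_zero]; exact zero_mem _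
  lift k to ℕ using by omega
  rw [← bideg_eq_gr] at hx ⊢
  exact (h.map_bideg k l _).1 (by rwa [Ψ.apply_symm_apply])

theorem IsLift.mem_filtration {g : Module.End A (VectorField A)} {Ψ : C A ≃ₐ[ℝ] C A}
    (h : IsLift g Ψ) (p : ℤ) (x : C A) : Ψ x ∈ filtration A p ↔ x ∈ filtration A p :=
  ⟨fun hx => by
    rw [← Ψ.symm_apply_apply x]
    exact mem_filtration_map (L := Ψ.symm.toLinearMap) (fun _ _ _ => h.symm_mem_gr) hx,
    fun hx => mem_filtration_map (L := Ψ.toLinearMap) (fun _ _ _ => h.mem_gr) hx⟩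

theorem IsGauge.trans {Φ Ψ : C A ≃ₐ[ℝ] C A} (h : IsGauge Φ) (h' : IsGauge Ψ) :
    IsGauge (Φ.trans Ψ) where
  map_bracket x y := by simp only [AlgEquiv.trans_apply, h.map_bracket, h'.map_bracket]
  map_weight w x := (h'.map_weight w _).trans (h.map_weight w x)
  map_fn f := by simp only [AlgEquiv.trans_apply, h.map_fn, h'.map_fn]

variable {π : Bivector A} {η : DiffForm A 2}

/-- The canonical lift of `T(-π, η)⁻¹`. -/
noncomputable def liftInvT (h : IsUnit (T (-π) η)) : C A ≃ₐ[ℝ] C A :=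
  liftEquiv (LinearMap.ext (T_invT h)) (LinearMap.ext (invT_T h)) preservesForms_T
    (preservesForms_invT h)

theorem isLift_liftInvT (h : IsUnit (T (-π) η)) :
    IsLift (Ring.inverse (T (-π) η)) (liftInvT h) := isLift_liftEquiv _ _ _ _

theorem liftInvT_vec (h : IsUnit (T (-π) η)) (X : VectorField A) :
    liftInvT h (vec X) = vec (invT π η X) := 
  conjLinear_vec (LinearMap.ext (T_invT h)) (LinearMap.ext (invT_T h)) _ _ X

theorem liftInvT_form (h : IsUnit (T (-π) η)) {l : ℕ} (ζ : DiffForm A l) :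
    liftInvT h (form ζ) = form (ζ.pull (preservesForms_T (π := π) (η := η))) :=
  
  conjLinear_form (LinearMap.ext (T_invT h)) (LinearMap.ext (invT_T h)) _ _ ζ

theorem flat_invT_comp_T (h : IsUnit (T (-π) η)) (X : VectorField A) :
    flat η (invT π η X) ∘ₗ T (-π) η = flat η X := by
  ext Y
  rw [← flat_comp_invT h, LinearMap.comp_apply, LinearMap.comp_apply, invT_T h]

/-- `F_{T⁻¹} exp X_{τ_{-π} η} exp X_π = exp X_{τ_{-η} π} exp X_η`. -/
theorem liftInvT_twist_twist (h : IsUnit (T (-π) η)) {π' : Bivector A} {η' : DiffForm A 2}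
    (hπ : IsTauBivector (-η) π π') (hη : IsTauForm (-π) η η') (x : C A) :
    liftInvT h (twist (form η') (twist (bivec π) x)) = twist (bivec π') (twist (form η) x) := by
  rw [isTauBivector_iff h] at hπ
  rw [isTauForm_iff] at hη
  have hL : IsPoissonEnd ((liftInvT h).toLinearMap ∘ₗ twistLinear (isTwistable_form η') ∘ₗ
      twistLinear (isTwistable_bivec π)) :=
    IsPoissonEnd.comp ⟨(isLift_liftInvT h).isGauge.map_bracket,
      fun w x => ((isLift_liftInvT h).isGauge.map_weight w x).2,
      (isLift_liftInvT h).isGauge.map_fn⟩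
      ((isPoissonEnd_twist_form η').comp (isPoissonEnd_twist_bivec π))
  -- Composing the left-hand side with the inverse of the right-hand side gives a Poisson map, and
  -- rigidity leaves only the values on dg and X to check.
  have hL' := ((isPoissonEnd_twist_form (-η)).comp (isPoissonEnd_twist_bivec (-π'))).comp hL
  have key : ∀ y, twist (form (-η)) (twist (bivec (-π')) (liftInvT h (twist (form η')
      (twist (bivec π) y)))) = y := by
    refine hL'.eq_id (fun g => ?_) (fun X => ?_)
    · change twist (form (-η)) (twist (bivec (-π')) (liftInvT h (twist (form η')
        (twist (bivec π) (form (dForm g)))))) = form (dForm g)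
      -- The vector parts agree since π'~ = T⁻¹ π~. For the form parts, the transpose T^* of T
      -- satisfies T^* η'~ = η~, so T^*(dg + η'~ π~ dg) = (dg - η~ π~ dg) + η~ π~ dg = dg.
      have e : liftInvT h (twist (form η') (twist (bivec π) (form (dForm g)))) =
          twist (bivec π') (twist (form η) (form (dForm g))) := by
        rw [twist_bivec_form, twist_sub (isTwistable_form _), twist_form_form, twist_form_vec,
          twist_form_form, twist_bivec_form, map_sub, map_sub, liftInvT_form, liftInvT_form,
          liftInvT_vec, hπ, sub_sub_eq_add_sub, ← form_add]
        congr 2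
        refine toDual_injective ?_
        change ((dForm g).pull preservesForms_T).toDual +
          ((η'.contract (sharp π (dForm g).toDual)).pull preservesForms_T).toDual = (dForm g).toDual
        rw [toDual_pull, toDual_pull, dual_T, ← flat_apply, hη, flat_invT_comp_T h,
          sub_add_cancel]
      rw [e, twist_neg_bivec, twist_neg_form]
    · change twist (form (-η)) (twist (bivec (-π')) (liftInvT h (twist (form η')
        (twist (bivec π) (vec X))))) = vec X
      -- Here the vector parts agree by T⁻¹ X = X + T⁻¹ π~ η~ X, and the form parts by T^* η'~ X =
      -- η~ X.
      have e : liftInvT h (twist (form η') (twist (bivec π) (vec X))) =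
          twist (bivec π') (twist (form η) (vec X)) := by
        rw [twist_bivec_vec, twist_form_vec, twist_form_vec, twist_sub (isTwistable_bivec _),
          twist_bivec_vec, twist_bivec_form, map_sub, liftInvT_form, liftInvT_vec, hπ,
          invT_eq_right h X, vec_add, ← flat_apply]
        have e2 : (η'.contract X).pull (preservesForms_T (π := π) (η := η)) = η.contract X := by
          refine toDual_injective ?_
          rw [toDual_pull, ← flat_apply, ← flat_apply, hη, flat_invT_comp_T h]
        rw [e2]
        abel
      rw [e, twist_neg_bivec, twist_neg_form]
  have := congrArg (fun y => twist (bivec π') (twist (form η) y)) (key x)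
  rwa [twist_form_neg, twist_bivec_neg] at this

end TwistGenerators

/-! ### Bidegree components of Θ, the twisted Poisson condition and the structure equations. -/

section Components
variable {A : Type*} [CommRing A] [Algebra ℝ A]

/-- The component of `Θ_{φ,π}` of bidegree `(3, 0)`. -/
noncomputable def psiTwist (φ : DiffForm A 3) (π : Bivector A) : C A :=
  (2⁻¹ : ℝ) • C.bracket (bivec π) (C.bracket (bivec π) (hd A)) +
    (6⁻¹ : ℝ) • C.bracket (bivec π) (C.bracket (bivec π) (C.bracket (bivec π) (form φ)))

theorem bracket_bivec_mem (π : Bivector A) {k l : ℤ} {x : C A} (hx : x ∈ gr A k l) :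
    C.bracket (bivec π) x ∈ gr A (k + 1) (l - 1) :=
  gr_cast (by ring) (by ring) (bracket_mem_gr (bivec_mem_gr π) hx)

theorem muTwist_mem (φ : DiffForm A 3) (π : Bivector A) : muTwist φ π ∈ gr A 1 2 :=
  add_mem hd_mem_gr (bracket_bivec_mem π (form_mem_gr φ))

theorem gammaTwist_mem (φ : DiffForm A 3) (π : Bivector A) : gammaTwist φ π ∈ gr A 2 1 :=
  add_mem (bracket_bivec_mem π hd_mem_gr)
    (Submodule.smul_mem _ _ (bracket_bivec_mem π (bracket_bivec_mem π (form_mem_gr φ))))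

theorem psiTwist_mem (φ : DiffForm A 3) (π : Bivector A) : psiTwist φ π ∈ gr A 3 0 :=
  add_mem (Submodule.smul_mem _ _ (bracket_bivec_mem π (bracket_bivec_mem π hd_mem_gr)))
    (Submodule.smul_mem _ _ (bracket_bivec_mem π (bracket_bivec_mem π
      (bracket_bivec_mem π (form_mem_gr φ)))))

/-- The bracket with π shifts bidegrees by (1, -1), so the series ends with the square on h_d and
the cube on φ; the terms are then collected by bidegree. -/
theorem Theta_eq (φ : DiffForm A 3) (π : Bivector A) :
    Theta φ π = muTwist φ π + gammaTwist φ π + form φ + psiTwist φ π := by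
  have h1 : C.bracket (bivec π) (C.bracket (bivec π) (C.bracket (bivec π) (hd A))) = 0 :=
    eq_zero_of_mem_gr' (by norm_num) (bracket_bivec_mem π (bracket_bivec_mem π
      (bracket_bivec_mem π hd_mem_gr)))
  have h2 : C.bracket (bivec π) (C.bracket (bivec π) (C.bracket (bivec π)
      (C.bracket (bivec π) (form φ)))) = 0 :=
    eq_zero_of_mem_gr' (by norm_num) (bracket_bivec_mem π (bracket_bivec_mem π
      (bracket_bivec_mem π (bracket_bivec_mem π (form_mem_gr φ)))))
  have h : (C.bracket (bivec π) ^ 4) (hd A + form φ) = 0 := by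
    simp only [pow_succ, pow_zero, one_mul, Module.End.mul_apply, map_add, h1, h2, map_zero,
      add_zero]
  rw [Theta, twist_eq_expEnd, expEnd_eq_sum h, muTwist, gammaTwist, psiTwist]
  simp only [Finset.sum_range_succ, Finset.sum_range_zero, pow_zero, pow_succ, one_mul,
    Module.End.mul_apply, Module.End.one_apply, map_add, h1, Nat.factorial]
  norm_num
  module

theorem pr_Theta_three (φ : DiffForm A 3) (π : Bivector A) :
    pr 3 0 (Theta φ π) = psiTwist φ π := by
  rw [Theta_eq, map_add, map_add, map_add, pr_of_ne (by omega) (muTwist_mem φ π),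
    pr_of_ne (by omega) (gammaTwist_mem φ π), pr_of_ne (by omega) (form_mem_gr φ),
    pr_of_mem (psiTwist_mem φ π), zero_add, zero_add, zero_add]

theorem pr_Theta_two (φ : DiffForm A 3) (π : Bivector A) :
    pr 2 1 (Theta φ π) = gammaTwist φ π := by
  rw [Theta_eq, map_add, map_add, map_add, pr_of_ne (by omega) (muTwist_mem φ π),
    pr_of_mem (gammaTwist_mem φ π), pr_of_ne (by omega) (form_mem_gr φ),
    pr_of_ne (by omega) (psiTwist_mem φ π), zero_add, add_zero, add_zero]

/-- Brackets of multivector fields with functions would have l = -1 and vanish automatically, so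
only 1-forms have to be tested. -/
theorem eq_zero_of_bracket_form {k : ℤ} (hk : 1 ≤ k) {x : C A} (hx : x ∈ gr A k 0)
    (h : ∀ α : DiffForm A 1, C.bracket x (form α) = 0) : x = 0 :=
  eq_zero_of_bracket_eq_zero hk hx
    (fun f => eq_zero_of_mem_gr' (by norm_num) (bracket_mem_gr hx (fn_mem_gr f))) fun g => h _

theorem bracket_form_mem {k : ℤ} {x : C A} (hx : x ∈ gr A k 0) (α : DiffForm A 1) :
    C.bracket x (form α) ∈ gr A (k - 1) 0 :=
  gr_cast (by ring) (by norm_num) (bracket_mem_gr hx (form_mem_gr α))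

theorem eq_zero_of_evalTrivector {P : C A} (hP : P ∈ gr A 3 0)
    (h : ∀ α β γ, evalTrivector P α β γ = 0) : P = 0 := by
  refine eq_zero_of_bracket_form (by norm_num) hP fun γ => ?_
  refine eq_zero_of_bracket_form (by norm_num) (bracket_form_mem hP γ) fun β => ?_
  exact eq_zero_of_bracket_form (by norm_num) (bracket_form_mem (bracket_form_mem hP γ) β)
    fun α => h α β γ

theorem form_eq_fn (ζ : DiffForm A 0) : form ζ = fn (ζ.1 0 ![]) := by
  rw [fn_eq_sym]
  refine form_eq_sym (opFun_mem _) (funext fun j => ?_)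
  cases j with
  | zero =>
    ext v
    rw [Subsingleton.elim v ![]]
    exact mul_one _
  | succ j =>
    rw [omegaDeg_apply_of_ne ζ.2 (j + 1) (by omega)]
    exact smul_zero (M := A) (A := AltForm A (j + 1)) _

theorem fn_neg (f : A) : fn (-f) = -fn f := by
  rw [fn_eq_sym, fn_eq_sym, ← sym_neg (opFun_mem_ord f)]
  congr 1
  exact LinearMap.ext fun x => neg_smul f x

theorem bracket_bivec_bracket_form (π : Bivector A) (u : C A) (α : DiffForm A 1) :
    C.bracket (C.bracket (bivec π) u) (form α) = C.bracket (bivec π) (C.bracket u (form α)) +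
      C.bracket u (vec (sharp π α.toDual)) := by
  rw [bracket_jacobi_of_even (bivec_mem_gr π) (by decide), bracket_bivec_form, map_neg]
  abel

theorem bracket_bivec_bracket_vec (π : Bivector A) (u : C A) (X : VectorField A) :
    C.bracket (C.bracket (bivec π) u) (vec X) = C.bracket (bivec π) (C.bracket u (vec X)) := by
  rw [bracket_jacobi_of_even (bivec_mem_gr π) (by decide), bracket_bivec_vec, map_zero, add_zero]

theorem bracket_form_vec_of_odd {l : ℕ} (hl : Odd (l + 1)) (η : DiffForm A (l + 1))
    (X : VectorField A) : C.bracket (form η) (vec X) = form (η.contract X) := by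
  rw [bracket_swap_of_odd (form_mem_gr η) (vec_mem_gr X), bracket_vec_form]
  obtain ⟨m, hm⟩ := hl
  exact ⟨-m - 1, by rw [hm]; push_cast; ring⟩

/-- Bracketing with a 1-form α commutes with X_π up to the bracket with π~ α, and that one commutes
with X_π. Since forms commute with each other, γ, β and α in turn must each use up one factor X_π,
with 3, 2 and 1 choices; hence the factor 6. -/
theorem evalTrivector_bivec_cubed (φ : DiffForm A 3) (π : Bivector A) (α β γ : DiffForm A 1) :
    evalTrivector (C.bracket (bivec π) (C.bracket (bivec π) (C.bracket (bivec π) (form φ))))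
      α β γ = (6 : ℝ) • fn (φ.1 3 ![sharp π α.toDual, sharp π β.toDual, sharp π γ.toDual]) := by
  have h1 : ∀ u : C A, C.bracket u (form γ) = 0 →
      C.bracket (C.bracket (bivec π) (C.bracket (bivec π) (C.bracket (bivec π) u))) (form γ) =
        (3 : ℝ) • C.bracket (bivec π) (C.bracket (bivec π)
          (C.bracket u (vec (sharp π γ.toDual)))) := by
    intro u hu
    simp only [bracket_bivec_bracket_form, bracket_bivec_bracket_vec, hu, map_add, map_zero]
    module
  have h2 : ∀ u : C A, C.bracket u (form β) = 0 →
      C.bracket (C.bracket (bivec π) (C.bracket (bivec π) u)) (form β) =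
        (2 : ℝ) • C.bracket (bivec π) (C.bracket u (vec (sharp π β.toDual))) := by
    intro u hu
    simp only [bracket_bivec_bracket_form, bracket_bivec_bracket_vec, hu, map_add, map_zero]
    module
  have h3 : ∀ u : C A, C.bracket u (form α) = 0 →
      C.bracket (C.bracket (bivec π) u) (form α) = C.bracket u (vec (sharp π α.toDual)) := by
    intro u hu
    rw [bracket_bivec_bracket_form, hu, map_zero, zero_add]
  unfold evalTrivector
  rw [h1 _ (bracket_form_form φ γ), bracket_form_vec_of_odd (by decide), map_smul,
    LinearMap.smul_apply, h2 _ (bracket_form_form _ β), bracket_form_vec, map_smul, map_smul,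
    LinearMap.smul_apply, LinearMap.smul_apply, map_neg, map_neg, LinearMap.neg_apply,
    h3 _ (bracket_form_form _ α), bracket_form_vec_of_odd (by decide), form_eq_fn, ← fn_neg,
    smul_smul]
  norm_num
  congr 1
  -- Contracting the intermediate 2-form produced a sign, and the arguments appear in the order γ,
  -- β, α. Exchanging the outer two cancels the sign.
  have e := (φ.1 3).map_swap (i := 0) (j := 2)
    ![sharp π α.toDual, sharp π β.toDual, sharp π γ.toDual] (by decide)
  rw [← neg_eq_iff_eq_neg] at e
  rw [← e]
  congr 1
  change φ.1 3 ![sharp π γ.toDual, sharp π β.toDual, sharp π α.toDual] = _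
  congr 1
  funext i
  fin_cases i <;> rfl

/-- Since [π, π] = -{π, {π, h_d}}, the value of `psiTwist` on three 1-forms is the value of φ on
their images under π~ minus half the value of [π, π]. A trivector field is determined by such
values. -/
theorem isTwistedPoisson_iff (φ : DiffForm A 3) (π : Bivector A) :
    IsTwistedPoisson φ π ↔ φ.d = 0 ∧ psiTwist φ π = 0 := by
  have hs : schoutenSelf π = -C.bracket (bivec π) (C.bracket (bivec π) (hd A)) :=
    bracket_swap_of_even (bracket_bivec_mem π hd_mem_gr) (bivec_mem_gr π) (by decide)
  have he : ∀ α β γ, evalTrivector (psiTwist φ π) α β γ =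
      fn (φ.1 3 ![sharp π α.toDual, sharp π β.toDual, sharp π γ.toDual]) -
        (2⁻¹ : ℝ) • evalTrivector (schoutenSelf π) α β γ := by
    intro α β γ
    have h6 := evalTrivector_bivec_cubed φ π α β γ
    rw [hs, psiTwist]
    unfold evalTrivector at h6 ⊢
    simp only [map_add, map_smul, map_neg, LinearMap.add_apply, LinearMap.smul_apply,
      LinearMap.neg_apply, h6]
    module
  refine and_congr_right fun _ => ⟨fun h => ?_, fun h α β γ => ?_⟩
  · refine eq_zero_of_evalTrivector (psiTwist_mem φ π) fun α β γ => ?_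
    rw [he, h, sub_self]
  · have := he α β γ
    have h0 : evalTrivector (0 : C A) α β γ = 0 := by
      simp only [evalTrivector, map_zero, LinearMap.zero_apply]
    rw [h, h0, eq_comm, sub_eq_zero] at this
    exact this.symm

theorem exteriorDerivative_exteriorDerivative {x : Forms A} (hx : x ∈ Omega A) :
    exteriorDerivative (exteriorDerivative x) = 0 := by
  induction hx using Submodule.span_induction with
  | mem x hx =>
    obtain ⟨gs, rfl⟩ := hx
    rw [exteriorDerivative_wedgeList, map_zero]
  | zero => rw [map_zero, map_zero]
  | add x y _ _ h h' => rw [map_add, map_add, h, h', add_zero]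
  | smul f x _ h =>
    rw [exteriorDerivative_smul, map_add, exteriorDerivative_wedgeLeft, exteriorDerivative_smul, h,
      smul_zero, add_zero, neg_add_cancel]

theorem d_sub_d {φ : DiffForm A 3} (h : φ.d = 0) (η : DiffForm A 2) : (φ - η.d).d = 0 :=
  Subtype.ext (by
    have h1 : exteriorDerivative φ.1 = 0 := congrArg Subtype.val h
    have h2 := exteriorDerivative_exteriorDerivative (omegaDeg_le _ η.2)
    change exteriorDerivative (φ.1 - exteriorDerivative η.1) = 0
    rw [map_sub, h1, h2, sub_zero])

theorem bracket_hd_hd : C.bracket (hd A) (hd A) = 0 := by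
  have h : (opDeRham * opDeRham : Op A) = 0 :=
    LinearMap.ext fun x => Subtype.ext (exteriorDerivative_exteriorDerivative x.2)
  rw [hd_eq_sym, bracket_sym opDeRham_mem_ord opDeRham_mem_ord, opComm, h, smul_zero, sub_zero,
    sym_zero]

theorem bracket_hd_bracket_form {φ : DiffForm A 3} (h : φ.d = 0) :
    C.bracket (hd A) (form φ) = 0 := by
  rw [bracket_hd_form, h, form_zero]

theorem bracket_form_hd {φ : DiffForm A 3} (h : φ.d = 0) :
    C.bracket (form φ) (hd A) = 0 := by
  rw [bracket_swap_of_odd (form_mem_gr φ) hd_mem_gr (by decide), bracket_hd_bracket_form h]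

theorem bracket_Theta_Theta {φ : DiffForm A 3} (h : φ.d = 0) (π : Bivector A) :
    C.bracket (Theta φ π) (Theta φ π) = 0 := by
  rw [Theta, ← twist_bracket (isTwistable_bivec π)]
  simp only [map_add, LinearMap.add_apply, bracket_hd_hd, bracket_hd_bracket_form h,
    bracket_form_hd h, bracket_form_form, add_zero]
  exact expEnd_of_eq_zero (map_zero _)

/-- For odd `x` the Jacobi identity reads 2 {x, {x, y}} = {{x, x}, y}. -/
theorem bracket_bracket_eq_zero_of_odd {k l : ℤ} {x : C A} (hx : x ∈ gr A k l) (h : Odd (l - k))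
    (h' : C.bracket x x = 0) (y : C A) : C.bracket x (C.bracket x y) = 0 := by
  have := bracket_jacobi_of_odd hx hx h h y
  rw [h', map_zero, LinearMap.zero_apply, ← two_smul ℝ] at this
  exact (smul_eq_zero.1 this).resolve_left two_ne_zero

/-- The automorphism exp X_π reduces the claim to h_d + φ. This sum is not homogeneous, so the
Jacobi identity is used for h_d, for φ and for the pair separately, with d² = 0, {φ, φ} = 0 and dφ =
0. -/
theorem bracket_Theta_bracket_Theta {φ : DiffForm A 3} (h : φ.d = 0) (π : Bivector A) (x : C A) :
    C.bracket (Theta φ π) (C.bracket (Theta φ π) x) = 0 := by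
  rw [← twist_bivec_neg π x, Theta, ← twist_bracket (isTwistable_bivec π),
    ← twist_bracket (isTwistable_bivec π)]
  generalize twist (bivec (-π)) x = y
  have h1 := bracket_bracket_eq_zero_of_odd hd_mem_gr (by decide) (bracket_hd_hd (A := A)) y
  have h2 := bracket_bracket_eq_zero_of_odd (form_mem_gr φ) (by decide) (bracket_form_form φ φ) y
  have h3 := bracket_jacobi_of_odd hd_mem_gr (form_mem_gr φ) (by decide) (by decide) y
  rw [bracket_hd_bracket_form h, map_zero, LinearMap.zero_apply] at h3
  have e : C.bracket (hd A + form φ) (C.bracket (hd A + form φ) y) = 0 := by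
    simp only [map_add, LinearMap.add_apply, h1, h2, zero_add, add_zero]
    rwa [add_comm]
  rw [e]
  exact expEnd_of_eq_zero (map_zero _)

theorem bracket_Theta_mem_weight (φ : DiffForm A 3) (π : Bivector A) {w : ℤ} {x : C A}
    (hx : x ∈ weight A w) : C.bracket (Theta φ π) x ∈ weight A (w + 1) := by
  rw [Theta_eq]
  simp only [map_add, LinearMap.add_apply]
  exact add_mem (add_mem (add_mem (bracket_mem_weight (muTwist_mem φ π) hx (by ring))
    (bracket_mem_weight (gammaTwist_mem φ π) hx (by ring)))
    (bracket_mem_weight (form_mem_gr φ) hx (by push_cast; ring)))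
    (bracket_mem_weight (psiTwist_mem φ π) hx (by ring))

theorem IsTwistedPoisson.Theta_eq {φ : DiffForm A 3} {π : Bivector A} (h : IsTwistedPoisson φ π) :
    Theta φ π = muTwist φ π + gammaTwist φ π + form φ := by
  rw [TwistedPoisson.Theta_eq, ((isTwistedPoisson_iff φ π).1 h).2, add_zero]

/-- The four structure equations are, up to factors 2, the components of the vanishing bracket in
bidegrees (1, 3), (3, 1), (2, 2) and (0, 4). -/
theorem isQuasiLieBialgebroid_of_bracket_eq_zero {μ γ f : C A} (hμ : μ ∈ gr A 1 2)
    (hγ : γ ∈ gr A 2 1) (hφ : f ∈ gr A 0 3)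
    (hΘ : C.bracket (μ + γ + f) (μ + γ + f) = 0) : IsQuasiLieBialgebroid μ γ f := by
  have e0 : C.bracket f f = 0 := eq_zero_of_mem_gr (by norm_num) (bracket_mem_gr hφ hφ)
  have e1 : C.bracket f μ = C.bracket μ f := bracket_swap_of_odd hφ hμ (by decide)
  have e2 : C.bracket f γ = C.bracket γ f := bracket_swap_of_odd hφ hγ (by decide)
  have e3 : C.bracket γ μ = C.bracket μ γ := bracket_swap_of_odd hγ hμ (by decide)
  simp only [map_add, LinearMap.add_apply, e0, e1, e2, e3, add_zero] at hΘ
  have m1 : C.bracket μ f ∈ gr A 0 4 := 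
    gr_cast (by norm_num) (by norm_num) (bracket_mem_gr hμ hφ)
  have m2 : C.bracket μ μ ∈ gr A 1 3 := 
    gr_cast (by norm_num) (by norm_num) (bracket_mem_gr hμ hμ)
  have m3 : C.bracket γ f ∈ gr A 1 3 := 
    gr_cast (by norm_num) (by norm_num) (bracket_mem_gr hγ hφ)
  have m4 : C.bracket μ γ ∈ gr A 2 2 := 
    gr_cast (by norm_num) (by norm_num) (bracket_mem_gr hμ hγ)
  have m5 : C.bracket γ γ ∈ gr A 3 1 := 
    gr_cast (by norm_num) (by norm_num) (bracket_mem_gr hγ hγ)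
  have two : ∀ x : C A, x + x = 0 → x = 0 := fun x hx => by
    rw [← two_smul ℝ] at hx
    exact (smul_eq_zero.1 hx).resolve_left two_ne_zero
  have p := fun k l => congrArg (pr k l) hΘ
  simp only [map_add, map_zero] at p
  refine ⟨?_, ?_, ?_, ?_, ?_, ?_, ?_⟩
  · rw [bideg_eq_gr]; exact hμ
  · rw [bideg_eq_gr]; exact hγ
  · rw [bideg_eq_gr]; exact hφ
  · have := p 1 3
    rw [pr_of_mem m2, pr_of_mem m3, pr_of_ne (by omega) m1, pr_of_ne (by omega) m4,
      pr_of_ne (by omega) m5] at this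
    refine two _ (Eq.trans ?_ this)
    module
  · have := p 3 1
    rwa [pr_of_mem m5, pr_of_ne (by omega) m1, pr_of_ne (by omega) m4,
      pr_of_ne (by omega) m2, pr_of_ne (by omega) m3, zero_add, zero_add, zero_add, zero_add,
      add_zero, add_zero] at this
  · have := p 2 2
    rw [pr_of_mem m4, pr_of_ne (by omega) m1, pr_of_ne (by omega) m5,
      pr_of_ne (by omega) m2, pr_of_ne (by omega) m3] at this
    refine two _ (Eq.trans ?_ this)
    abel
  · have := p 0 4
    rw [pr_of_mem m1, pr_of_ne (by omega) m4, pr_of_ne (by omega) m5,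
      pr_of_ne (by omega) m2, pr_of_ne (by omega) m3] at this
    refine two _ (Eq.trans ?_ this)
    abel

theorem IsTwistedPoisson.isQuasiLieBialgebroid {φ : DiffForm A 3} {π : Bivector A}
    (h : IsTwistedPoisson φ π) :
    IsQuasiLieBialgebroid (muTwist φ π) (gammaTwist φ π) (form φ) :=
  isQuasiLieBialgebroid_of_bracket_eq_zero (muTwist_mem φ π) (gammaTwist_mem φ π) (form_mem_gr φ)
    (by rw [← h.Theta_eq]; exact bracket_Theta_Theta h.1 π)

end Components

/-! ### The gauge transformation Φ and its effect on Θ, ψ and γ. -/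

section GaugeTransformation
variable {A : Type*} [CommRing A] [Algebra ℝ A] {π : Bivector A} {η : DiffForm A 2}

/-- The gauge transformation `F_{T⁻¹} exp X_{η'}`. -/
noncomputable def gaugeEquiv (h : IsUnit (T (-π) η)) (η' : DiffForm A 2) : C A ≃ₐ[ℝ] C A :=
  (twistEquiv η').trans (liftInvT h)

theorem isGauge_gaugeEquiv (h : IsUnit (T (-π) η)) (η' : DiffForm A 2) :
    IsGauge (gaugeEquiv h η') := (isGauge_twistEquiv η').trans (isLift_liftInvT h).isGauge

theorem gaugeEquiv_mem_filtration (h : IsUnit (T (-π) η)) (η' : DiffForm A 2) (p : ℤ) (x : C A) :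
    gaugeEquiv h η' x ∈ filtration A p ↔ x ∈ filtration A p :=
  ((isLift_liftInvT h).mem_filtration p _).trans (twistEquiv_mem_filtration η' p x)

theorem gaugeEquiv_Theta (h : IsUnit (T (-π) η)) {π' : Bivector A} {η' : DiffForm A 2}
    (hπ : IsTauBivector (-η) π π') (hη : IsTauForm (-π) η η') (φ : DiffForm A 3) :
    gaugeEquiv h η' (Theta φ π) = Theta (φ - η.d) π' := by
  rw [Theta, Theta, ← twist_form_hd_add_form, ← liftInvT_twist_twist h hπ hη]
  rfl

theorem IsLift.pr_apply {g : Module.End A (VectorField A)} {Ψ : C A ≃ₐ[ℝ] C A} (h : IsLift g Ψ)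
    (k l : ℤ) (x : C A) : pr k l (Ψ x) = Ψ (pr k l x) := by
  induction x using C_induction with
  | zero => simp
  | add x y hx hy => simp only [map_add, hx, hy]
  | homogeneous k' l' x hx =>
    by_cases e : k' = k ∧ l' = l
    · obtain ⟨rfl, rfl⟩ := e
      rw [pr_of_mem hx, pr_of_mem (h.mem_gr hx)]
    · rw [pr_of_ne (by omega) hx, pr_of_ne (by omega) (h.mem_gr hx), map_zero]

/-- In the highest order the exponential of a 2-form is invisible, so only the lift acts there. -/
theorem pr_gaugeEquiv (h : IsUnit (T (-π) η)) (η' : DiffForm A 2) {k k' : ℤ} (l' : ℤ)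
    (hk : k ≤ k') {l : ℤ} {x : C A} (hx : x ∈ gr A k l) :
    pr k' l' (gaugeEquiv h η' x) = liftInvT h (pr k' l' x) := by
  change pr k' l' (liftInvT h (twist (form η') x)) = _
  rw [(isLift_liftInvT h).pr_apply, pr_twist (form_mem_gr η') hk hx]

/-- No component of Θ has order above 3, so `pr_gaugeEquiv` applies to each of them. -/
theorem psiTwist_gauge (h : IsUnit (T (-π) η)) {π' : Bivector A} {η' : DiffForm A 2}
    (hπ : IsTauBivector (-η) π π') (hη : IsTauForm (-π) η η') (φ : DiffForm A 3) :
    psiTwist (φ - η.d) π' = liftInvT h (psiTwist φ π) := by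
  rw [← pr_Theta_three, ← pr_Theta_three, ← gaugeEquiv_Theta h hπ hη, Theta_eq]
  simp only [map_add]
  rw [pr_gaugeEquiv h η' 0 (by norm_num) (muTwist_mem φ π),
    pr_gaugeEquiv h η' 0 (by norm_num) (gammaTwist_mem φ π),
    pr_gaugeEquiv h η' 0 (by norm_num) (form_mem_gr φ),
    pr_gaugeEquiv h η' 0 (by norm_num) (psiTwist_mem φ π)]

theorem isTwistedPoisson_gauge (h : IsUnit (T (-π) η)) {π' : Bivector A} {η' : DiffForm A 2}
    (hπ : IsTauBivector (-η) π π') (hη : IsTauForm (-π) η η') {φ : DiffForm A 3}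
    (hφ : IsTwistedPoisson φ π) : IsTwistedPoisson (φ - η.d) π' := by
  rw [isTwistedPoisson_iff] at hφ ⊢
  exact ⟨d_sub_d hφ.1 η, by rw [psiTwist_gauge h hπ hη, hφ.2, map_zero]⟩

/-- The Poisson condition is essential: without it ψ, of order 3, would contribute to order 2
through exp X_{η'}. -/
theorem gammaTwist_gauge (h : IsUnit (T (-π) η)) {π' : Bivector A} {η' : DiffForm A 2}
    (hπ : IsTauBivector (-η) π π') (hη : IsTauForm (-π) η η') {φ : DiffForm A 3}
    (hφ : IsTwistedPoisson φ π) :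
    gammaTwist (φ - η.d) π' = liftInvT h (gammaTwist φ π) := by
  rw [← pr_Theta_two, ← pr_Theta_two, ← gaugeEquiv_Theta h hπ hη, hφ.Theta_eq]
  simp only [map_add]
  rw [pr_gaugeEquiv h η' 1 (by norm_num) (muTwist_mem φ π),
    pr_gaugeEquiv h η' 1 (by norm_num) (gammaTwist_mem φ π),
    pr_gaugeEquiv h η' 1 (by norm_num) (form_mem_gr φ)]

end GaugeTransformation

/-! ### Induced isomorphisms of spectral sequences and Poisson cohomology. -/

section Cohomology
variable {A : Type*} [CommRing A] [Algebra ℝ A] {Φ : C A ≃ₐ[ℝ] C A} {Θ Θ' : C A}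

/-- The isomorphism of subquotients induced by a linear isomorphism. -/
noncomputable def subquotientEquiv {V : Type*} [AddCommGroup V] [Module ℝ V] (e : V ≃ₗ[ℝ] V)
    {Z B Z' B' : Submodule ℝ V} (hZ : Z.map e.toLinearMap = Z') (hB : B.map e.toLinearMap = B') :
    (Z ⧸ B.comap Z.subtype) ≃ₗ[ℝ] (Z' ⧸ B'.comap Z'.subtype) :=
  Submodule.Quotient.equiv _ _ (LinearEquiv.ofSubmodules e Z Z' hZ) (by
    subst hZ hB
    ext ⟨y, hy⟩
    constructor
    · rintro ⟨x, hx, hxy⟩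
      exact ⟨x, hx, congrArg Subtype.val hxy⟩
    · rintro ⟨x, hx, hxy⟩
      obtain ⟨z, hz, hzy⟩ := hy
      obtain rfl : x = z := e.injective (hxy.trans hzy.symm)
      exact ⟨⟨x, hz⟩, hx, Subtype.ext hxy⟩)

theorem subquotientEquiv_mk {V : Type*} [AddCommGroup V] [Module ℝ V] (e : V ≃ₗ[ℝ] V)
    {Z B Z' B' : Submodule ℝ V} (hZ : Z.map e.toLinearMap = Z') (hB : B.map e.toLinearMap = B')
    (x : Z) (h : e x ∈ Z') :
    subquotientEquiv e hZ hB (Submodule.Quotient.mk x) = Submodule.Quotient.mk ⟨e x, h⟩ := rfl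

theorem map_eq_of_mem_iff {V : Type*} [AddCommGroup V] [Module ℝ V] (e : V ≃ₗ[ℝ] V)
    {Z Z' : Submodule ℝ V} (h : ∀ x, e x ∈ Z' ↔ x ∈ Z) : Z.map e.toLinearMap = Z' := by
  ext y
  constructor
  · rintro ⟨x, hx, rfl⟩
    exact (h x).2 hx
  · intro hy
    exact ⟨e.symm y, (h _).1 (by rwa [e.apply_symm_apply]), e.apply_symm_apply y⟩

theorem apply_mem_cycles (hΦ : IsGauge Φ)
    (hF : ∀ p x, Φ x ∈ filtration A p ↔ x ∈ filtration A p) (hΘ : Φ Θ = Θ') (r p n : ℤ) (x : C A) :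
    Φ x ∈ cycles Θ' r p n ↔ x ∈ cycles Θ r p n := by
  simp only [cycles, Submodule.mem_inf, Submodule.mem_comap, hF, hΦ.map_weight, ← hΘ,
    ← hΦ.map_bracket]

theorem map_cycles (hΦ : IsGauge Φ)
    (hF : ∀ p x, Φ x ∈ filtration A p ↔ x ∈ filtration A p) (hΘ : Φ Θ = Θ') (r p n : ℤ) :
    (cycles Θ r p n).map Φ.toLinearEquiv.toLinearMap = cycles Θ' r p n :=
  map_eq_of_mem_iff _ (apply_mem_cycles hΦ hF hΘ r p n)

theorem map_boundaries (hΦ : IsGauge Φ)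
    (hF : ∀ p x, Φ x ∈ filtration A p ↔ x ∈ filtration A p) (hΘ : Φ Θ = Θ') (r p n : ℤ) :
    (boundaries Θ r p n).map Φ.toLinearEquiv.toLinearMap = boundaries Θ' r p n := by
  have e : Φ.toLinearEquiv.toLinearMap ∘ₗ C.bracket Θ =
      C.bracket Θ' ∘ₗ Φ.toLinearEquiv.toLinearMap :=
    LinearMap.ext fun x => (hΦ.map_bracket Θ x).trans (by rw [hΘ]; rfl)
  rw [boundaries, boundaries, Submodule.map_sup, map_cycles hΦ hF hΘ, ← Submodule.map_comp, e,
    Submodule.map_comp, map_cycles hΦ hF hΘ]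

/-- Pages, differentials and identifications are built from the bracket with Θ, the weight and the
filtration, all of which Φ respects. The hypotheses on Θ only ensure that {Θ, x} lies in the cycles
in which d_r takes its values. -/
theorem nonempty_spectralIso (hΦ : IsGauge Φ)
    (hF : ∀ p x, Φ x ∈ filtration A p ↔ x ∈ filtration A p) (hΘ : Φ Θ = Θ')
    (hsq : ∀ x, C.bracket Θ (C.bracket Θ x) = 0)
    (hw : ∀ w x, x ∈ weight A w → C.bracket Θ x ∈ weight A (w + 1)) :
    Nonempty (SpectralIso Θ Θ') := by
  have hc := apply_mem_cycles hΦ hF hΘ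
  have hb : ∀ x, C.bracket Θ' (Φ x) = Φ (C.bracket Θ x) := fun x => by
    rw [hΦ.map_bracket, hΘ]
  refine ⟨⟨fun r p n => subquotientEquiv Φ.toLinearEquiv (map_cycles hΦ hF hΘ r p n)
    (map_boundaries hΦ hF hΘ r p n), fun r p n x hx => ?_, fun r p n x hx hy => ?_⟩⟩
  · have hd : C.bracket Θ x ∈ cycles Θ r (p + r) (n + 1) := by
      refine ⟨⟨hx.2, hw n x hx.1.2⟩, ?_⟩
      change C.bracket Θ (C.bracket Θ x) ∈ filtration A (p + r + r)
      rw [hsq]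
      exact zero_mem _
    have hd' : C.bracket Θ' (Φ x) ∈ cycles Θ' r (p + r) (n + 1) := by
      rw [hb]; exact (hc _ _ _ _).2 hd
    refine ⟨hd, Φ x, (hc _ _ _ _).2 hx, hd', rfl, ?_⟩
    refine (subquotientEquiv_mk _ _ _ _ ((hc _ _ _ _).2 hd)).trans ?_
    exact congrArg Submodule.Quotient.mk (Subtype.ext (hb x).symm)
  · exact ⟨Φ x, (hc _ _ _ _).2 hx, (hc _ _ _ _).2 hy, rfl, rfl⟩

/-- The lift Ψ is used rather than Φ because exp X_{η'} sends X to X - η'~ X and so does not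
preserve multivector fields; Ψ preserves each bidegree. -/
theorem nonempty_poissonCohomology {g : Module.End A (VectorField A)} {Ψ : C A ≃ₐ[ℝ] C A}
    (hΨ : IsLift g Ψ) {φ φ' : DiffForm A 3} {π π' : Bivector A}
    (hγ : gammaTwist φ' π' = Ψ (gammaTwist φ π)) (k : ℕ) :
    Nonempty (PoissonCohomology φ π k ≃ₗ[ℝ] PoissonCohomology φ' π' k) := by
  have hb : ∀ x, C.bracket (gammaTwist φ' π') (Ψ x) = Ψ (C.bracket (gammaTwist φ π) x) :=
    fun x => by rw [hΨ.isGauge.map_bracket, hγ]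
  have e : Ψ.toLinearEquiv.toLinearMap ∘ₗ C.bracket (gammaTwist φ π) =
      C.bracket (gammaTwist φ' π') ∘ₗ Ψ.toLinearEquiv.toLinearMap :=
    LinearMap.ext fun x => (hb x).symm
  refine ⟨subquotientEquiv Ψ.toLinearEquiv (map_eq_of_mem_iff _ fun x => ?_) ?_⟩
  · change Ψ x ∈ _ ↔ _
    rw [poissonCocycles, poissonCocycles, Submodule.mem_inf, Submodule.mem_inf, hΨ.map_bideg,
      LinearMap.mem_ker, LinearMap.mem_ker, hb, map_eq_zero_iff Ψ Ψ.injective]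
  · rw [poissonCoboundaries, poissonCoboundaries, Submodule.map_iSup]
    refine iSup_congr fun j => ?_
    rw [Submodule.map_iSup]
    refine iSup_congr fun _ => ?_
    rw [← Submodule.map_comp, e, Submodule.map_comp,
      map_eq_of_mem_iff Ψ.toLinearEquiv (hΨ.map_bideg j 0)]

end Cohomology
end TwistedPoisson

/-! ### The theorem for the algebra of smooth functions on M. -/

theorem mainTheorem5 {n : ℕ} {M : Type*} [TopologicalSpace M] [T2Space M] [SigmaCompactSpace M]
    [ChartedSpace (EuclideanSpace ℝ (Fin n)) M] [IsManifold (𝓡 n) ∞ M] :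
    (∀ (φ : DiffForm (SmoothFun n M) 3) (π : Bivector (SmoothFun n M))
      (η : DiffForm (SmoothFun n M) 2), IsUnit (T (-π) η) →
      (∃ π', IsTauBivector (-η) π π') ∧ (∃! η', IsTauForm (-π) η η') ∧
      ∀ π' η', IsTauBivector (-η) π π' → IsTauForm (-π) η η' →
        (∃ Ψ Φ : C (SmoothFun n M) ≃ₐ[ℝ] C (SmoothFun n M),
          IsLift (Ring.inverse (T (-π) η)) Ψ ∧ (∀ x, Φ x = Ψ (twist (form η') x)) ∧
          IsGauge Φ ∧ PreservesLstar Φ ∧ Theta (φ - η.d) π' = Φ (Theta φ π)) ∧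
        (IsTwistedPoisson φ π → IsTwistedPoisson (φ - η.d) π')) ∧
    (∀ (φ φ' : DiffForm (SmoothFun n M) 3) (π π' : Bivector (SmoothFun n M)),
      IsTwistedPoisson φ π → IsTwistedPoisson φ' π' → GaugeEquivalent φ π φ' π' →
      IsQuasiLieBialgebroid (muTwist φ π) (gammaTwist φ π) (form φ) ∧
      IsQuasiLieBialgebroid (muTwist φ' π') (gammaTwist φ' π') (form φ') ∧
      QuasiLieBialgebroidIso (muTwist φ π) (gammaTwist φ π) (form φ)
        (muTwist φ' π') (gammaTwist φ' π') (form φ') ∧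
      Nonempty (SpectralIso (Theta φ π) (Theta φ' π')) ∧
      ∀ k, Nonempty (PoissonCohomology φ π k ≃ₗ[ℝ] PoissonCohomology φ' π' k)) := by
  refine ⟨fun φ π η h => ⟨exists_isTauBivector h, existsUnique_isTauForm h,
    fun π' η' hπ hη => ⟨⟨liftInvT h, gaugeEquiv h η', isLift_liftInvT h, fun _ => rfl,
      isGauge_gaugeEquiv h η', gaugeEquiv_mem_filtration h η' 1,
      (gaugeEquiv_Theta h hπ hη φ).symm⟩, isTwistedPoisson_gauge h hπ hη⟩⟩, ?_⟩
  rintro φ _ π π' hφ hφ' ⟨η, h, rfl, hπ⟩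
  obtain ⟨η', hη⟩ := exists_isTauForm h
  have hΘ := gaugeEquiv_Theta h hπ hη φ
  refine ⟨hφ.isQuasiLieBialgebroid, hφ'.isQuasiLieBialgebroid,
    ⟨gaugeEquiv h η', isGauge_gaugeEquiv h η', gaugeEquiv_mem_filtration h η' 1, ?_⟩,
    nonempty_spectralIso (isGauge_gaugeEquiv h η') (gaugeEquiv_mem_filtration h η') hΘ
      (bracket_Theta_bracket_Theta hφ.1 π) (fun _ _ => bracket_Theta_mem_weight φ π),
    nonempty_poissonCohomology (isLift_liftInvT h) (gammaTwist_gauge h hπ hη hφ)⟩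
  -- For twisted Poisson structures ψ vanishes, so μ + γ + φ is all of Θ on both sides.
  rw [← hφ.Theta_eq, hΘ, hφ'.Theta_eq]
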